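/- **Theorem 4.1.** For $N\ge 1$, $\epsilon>0$ let $$Z_{even}(s)=\int \exp\Big(-\tfrac1\epsilon\,\mathrm{tr}\big(\tfrac12M^2-\sum_{k\ge1}s_{2k}M^{2k}\big)\Big)\,dM$$ be the GUE partition function with even couplings (integral over Hermitian $N\times N$ matrices, understood perturbatively as a formal power series in $s_2,s_4,\dots$, normalized by its value at $s=0$). Then there are series $F_g$ ($g\ge0$) in $s_2,s_4,\dots$, whose coefficients (at monomials $\ne1$) are polynomials in $t$, only finitely many $g$ contributing to a given monomial, such that $\log\tilde Z=\sum_{g\ge0}\epsilon^{2g-2}F_g$ satisfies $$\log Z_{even}=\big(\Lambda^{1/2}+\Lambda^{-1/2}\big)\log\tilde Z,\qquad \Lambda=e^{\epsilon\partial_t},\quad t=N\epsilon,$$ up to terms independent of $s$. For any such $F_g$ put $\langle p_{2a_1}\cdots p_{2a_n}\rangle_g=\partial^nF_g/\partial s_{2a_1}\cdots\partial s_{2a_n}\big|_{s=0}$. Let $t\in\mathbb C\setminus\{0\}$ and consider the rational curve $y^2=\frac1{16}-\frac{t}{4x}$ with global coordinate $y$, so $x=4t/(1-16y^2)$, and involution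 $\sigma(x,y)=(x,-y)$. For all $g\ge0$, $n\ge1$ there is a (unique) function $G_{g,n}$, rational in $y_1,\dots,y_n$ and regular at all points with $y_i\ne0$, $16y_i^2\neq1$ and pairwise distinct $x_i$, whose expansion near $x_i=\infty$, on the sheet $y_i=-\frac14\sqrt{1-4t/x_i}$, is the series (convergent for $|x_i|$ large) $$G_{g,n}=\sum_{a_1,\dots,a_n\ge1}\langle p_{2a_1}\cdots p_{2a_n}\rangle_g\,x_1^{-a_1-1}\cdots x_n^{-a_n-1}.$$ Let $W_{g,n}=\hat G_{g,n}\,dx_1\cdots dx_n$, where $\hat G_{0,1}=-\frac14+\frac t{2x_1}+G_{0,1}$, $\hat G_{0,2}=\frac1{(x_1-x_2)^2}+G_{0,2}$ and $\hat G_{g,n}=G_{g,n}$ otherwise. Let $\omega_{g,n}$ be the Eynard–Orantin multidifferentials of the curve for its branch point $y=0$: $\omega_{0,1}=y\,dx$, $\omega_{0,2}=B=\frac{dy_1dy_2}{(y_1-y_2)^2}$ and, for $2g-2+n+1>0$ with $[n]=\{1,\dots,n\}$, $$\omega_{g,n+1}(p_0,p_{[n]})=\mathop{\mathrm{Res}}_{p\to\{y=0\}}K(p_0,p)\Big[\omega_{g-1,n+2}(p,\sigma(p),p_{[n]})+{\sum_{h,I}}'\omega_{h,|I|+1}(p,p_I)\,\omega_{g-h,n-|I|+1}(\sigma(p),p_{[n]\setminus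 I})\Big],$$ $$K(p_0,p)=\frac{\int_{\sigma(p)}^{p}B(p_0,\cdot)}{2\,(y(p)-y(\sigma(p)))\,dx(p)},$$ where the term $\omega_{g-1,n+2}$ is absent for $g=0$, and the sum is over $0\le h\le g$, $I\subset[n]$, without the terms $(h,I)=(0,\emptyset)$ and $(g,[n])$. Then $$W_{g,n}(p_1,\dots,p_n)=\omega_{g,n}(p_1,\dots,p_n)\qquad\text{for all } g\ge0,\ n\ge1$$ as multidifferentials on the curve (as an identity at all points with $y_i\ne0$, $16y_i^2\ne1$ and pairwise distinct $x_i$). In other words, the $W_{g,n}$ satisfy the Eynard–Orantin topological recursion, with $W_{0,1}=y\,dx$ and $W_{0,2}=B$. -/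

import Mathlib

open Filter Topology

noncomputable section

namespace ModifiedGUE

/-! ### The GUE partition function with even couplings -/

/-- The `N × N` Hermitian matrix with real coordinates `X`: diagonal entries `X i i`, and
`Re M i j = X i j`, `Im M i j = X j i` for `i < j`. -/
def hermitian {N : ℕ} (X : Fin N → Fin N → ℝ) : Matrix (Fin N) (Fin N) ℂ :=
  Matrix.of fun i j =>
    if i = j then (X i i : ℂ)
    else if i < j then (X i j : ℂ) + Complex.I * (X j i : ℂ)
    else (X j i : ℂ) - Complex.I * (X i j : ℂ)

/-- The integral of `f(M) exp(-tr M² / (2ε))` over Hermitian `N × N` matrices with respect to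
`dM = ∏ dM_ii ∏_{i<j} dRe M_ij dIm M_ij`. -/
def gueIntegral (N : ℕ) (ε : ℝ) (f : Matrix (Fin N) (Fin N) ℂ → ℂ) : ℂ :=
  ∫ X : Fin N → Fin N → ℝ,
    f (hermitian X) * Complex.exp (-(1 / (ε : ℂ)) * ((hermitian X ^ 2).trace / 2))

/-- The Gaussian (GUE) expectation value of `f`. -/
def gueExpectation (N : ℕ) (ε : ℝ) (f : Matrix (Fin N) (Fin N) ℂ → ℂ) : ℂ :=
  gueIntegral N ε f / gueIntegral N ε (fun _ => 1)

/-- `Z_even(s) / Z_even(0)`, where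
`Z_even(s) = ∫ exp(-(1/ε) tr (M²/2 - ∑_{k ≥ 1} s_{2k} M^{2k})) dM`
is understood perturbatively: a formal power series in the couplings, obtained by expanding
`exp(∑ s_{2k} ε⁻¹ tr M^{2k})` and integrating term by term.
The variable with index `k : ℕ+` is `s_{2k}`. -/
def evenPartition (N : ℕ) (ε : ℝ) : MvPowerSeries ℕ+ ℂ := fun m =>
  gueExpectation N ε fun M =>
    m.prod fun k r => ((ε : ℂ)⁻¹ * (M ^ (2 * (k : ℕ))).trace) ^ r / (r.factorial : ℂ)

/-- `log (Z_even(s) / Z_even(0))` as a formal power series in the couplings. -/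
def logEvenPartition (N : ℕ) (ε : ℝ) : MvPowerSeries ℕ+ ℂ :=
  (PowerSeries.log ℂ).subst (evenPartition N ε - 1)

/-! ### The modified free energy and its correlators -/

/-- `F g = F_g(s)` are the genus `g` parts of the modified free energy
`log Z̃ = ∑_g ε^(2g-2) F_g`, determined by
`log Z_even = (Λ^(1/2) + Λ^(-1/2)) log Z̃`, `Λ = exp(ε ∂_t)`, `t = N ε`.
The coefficients of the monomials in `s` are polynomials in `t`, and `Λ^(±1/2)` shifts `t`
by `± ε/2`. The part of `F_g` that does not depend on `s` never enters a correlator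
and is left unspecified. -/
structure IsModifiedFreeEnergy (F : ℕ → MvPowerSeries ℕ+ (Polynomial ℂ)) : Prop where
  /-- Only finitely many genera contribute to a given monomial in the couplings. -/
  finite : ∀ m : ℕ+ →₀ ℕ, m ≠ 0 → {g | MvPowerSeries.coeff m (F g) ≠ 0}.Finite
  shift : ∀ m : ℕ+ →₀ ℕ, m ≠ 0 → ∀ N : ℕ, 1 ≤ N → ∀ ε : ℝ, 0 < ε →
    MvPowerSeries.coeff m (logEvenPartition N ε) =
      ∑ᶠ g : ℕ, (ε : ℂ) ^ (2 * (g : ℤ) - 2) *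
        ((MvPowerSeries.coeff m (F g)).eval ((N : ℂ) * ε + ε / 2) +
          (MvPowerSeries.coeff m (F g)).eval ((N : ℂ) * ε - ε / 2))

/-- The connected correlator `⟨p_{2a_1} ⋯ p_{2a_n}⟩_g`, that is
`∂ⁿ F_g / ∂s_{2a_1} ⋯ ∂s_{2a_n}` at `s = 0`, evaluated at `t`. -/
def correlator (F : ℕ → MvPowerSeries ℕ+ (Polynomial ℂ)) (t : ℂ) (g : ℕ) {n : ℕ}
    (a : Fin n → ℕ+) : ℂ :=
  (MvPowerSeries.constantCoeff
    ((List.ofFn a).foldr (fun k f => MvPowerSeries.pderiv (Polynomial ℂ) k f) (F g))).eval t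

/-! ### Spectral curves and the Eynard-Orantin topological recursion -/

/-- The residue at `a` of `f(z) dz`. -/
def residue (f : ℂ → ℂ) (a : ℂ) : ℂ :=
  limUnder (𝓝[>] (0 : ℝ)) fun r =>
    (2 * (Real.pi : ℂ) * Complex.I)⁻¹ * ∮ z in C(a, r), f z

/-- The data of a spectral curve with global coordinate `z`: the functions `x` and `y`,
the branch point `a` (a nondegenerate critical point of `x`), the involution `σ` near `a` with
`x ∘ σ = x`, and the Bergman kernel `B(z, w) dz dw`. -/
structure SpectralCurve where
  x : ℂ → ℂ
  y : ℂ → ℂ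
  a : ℂ
  σ : ℂ → ℂ
  B : ℂ → ℂ → ℂ

/-- The recursion kernel
`K(z₀, z) = ∫_{σ(z)}^{z} B(z₀, ·) / (2 (y(z) - y(σ(z))) dx(z))`,
as the coefficient of `dz₀ / dz`; the integral is taken along the segment from `σ(z)` to `z`. -/
def SpectralCurve.kernel (C : SpectralCurve) (z₀ z : ℂ) : ℂ :=
  (∫ s in (0 : ℝ)..1, C.B z₀ (C.σ z + (s : ℂ) * (z - C.σ z)) * (z - C.σ z)) /
    (2 * (C.y z - C.y (C.σ z)) * deriv C.x z)

/-- The Eynard-Orantin multidifferentials: `C.omega g n z` is the coefficient of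
`dz_1 ⋯ dz_n` in `ω_{g,n}(z_1, …, z_n)`. The factors `deriv C.σ` come from pulling
a differential back along `σ`. As usual, the terms of the sum that contain `ω_{0,1}` are
left out. -/
def SpectralCurve.omega (C : SpectralCurve) : (g n : ℕ) → (Fin n → ℂ) → ℂ
  | _, 0, _ => 0
  | g, n + 1, z =>
    if g = 0 ∧ n = 0 then C.y (z 0) * deriv C.x (z 0)
    else if g = 0 ∧ n = 1 then C.B (z 0) (z (Fin.last n))
    else residue (fun p => C.kernel (z 0) p *
      ((match g with
        | 0 => 0
        | g' + 1 =>
          C.omega g' (n + 2) (Fin.cons p (Fin.cons (C.σ p) (Fin.tail z))) * deriv C.σ p) +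
       ∑ h : Fin (g + 1), ∑ I : Finset (Fin n),
        if _hI : (h.val = 0 ∧ I = ∅) ∨ (h.val = g ∧ I = Finset.univ) then 0
        else
          C.omega h.val (I.card + 1)
            (Fin.cons p fun i => Fin.tail z (I.orderEmbOfFin rfl i)) *
          (C.omega (g - h.val) (Iᶜ.card + 1)
            (Fin.cons (C.σ p) fun i => Fin.tail z (Iᶜ.orderEmbOfFin rfl i)) *
            deriv C.σ p))) C.a
  termination_by g n => 2 * g + n
  decreasing_by
    · omega
    · have h1 := h.isLt
      have h2 : I.card ≤ n := by simpa using I.card_le_univ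
      have h3 : I.card = n → I = Finset.univ := fun e => by
        rw [← Finset.card_eq_iff_eq_univ]; simpa using e
      by_cases h4 : I.card = n
      · have := h3 h4
        have : h.val ≠ g := fun e => _hI (Or.inr ⟨e, this⟩)
        omega
      · omega
    · have h1 := h.isLt
      have h2 : Iᶜ.card + I.card = n := by simp
      have h3 : I.card = 0 → I = ∅ := Finset.card_eq_zero.mp
      by_cases h4 : I.card = 0
      · have := h3 h4
        have : h.val ≠ 0 := fun e => _hI (Or.inl ⟨e, this⟩)
        omega
      · omega

/-- The rational spectral curve `y² = 1/16 - t/(4x)`, with global coordinate `y`, so that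
`x = 4t/(1 - 16y²)`; its involution is `(x, y) ↦ (x, -y)`, the branch point is `y = 0`, and its
Bergman kernel is `dy₁ dy₂ / (y₁ - y₂)²`. -/
def curve (t : ℂ) : SpectralCurve where
  x := fun y => 4 * t / (1 - 16 * y ^ 2)
  y := fun y => y
  a := 0
  σ := fun y => -y
  B := fun y₁ y₂ => 1 / (y₁ - y₂) ^ 2

/-! ### The correlation functions on the spectral curve -/

/-- The `n`-tuples of points of the curve (given by their `y`-coordinates), none of them
a zero or a pole of `dx`, with pairwise distinct `x`-coordinates. -/
def genericPoints (n : ℕ) : Set (Fin n → ℂ) :=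
  {y | (∀ i, y i ≠ 0 ∧ 16 * y i ^ 2 ≠ 1) ∧ ∀ i j, i ≠ j → y i ^ 2 ≠ y j ^ 2}

/-- `G` is the genus `g`, `n`-point function `G_{g,n}` regarded as a function on the spectral
curve: a rational function of the coordinates `y_1, …, y_n`, regular at generic points, whose
expansion at `x_i = ∞` on the sheet `y = -(1/4) √(1 - 4t/x)` is
`∑_{a_1, …, a_n ≥ 1} ⟨p_{2a_1} ⋯ p_{2a_n}⟩_g x_1^{-a_1-1} ⋯ x_n^{-a_n-1}`.
On generic points it is uniquely determined by these properties. -/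
structure IsCorrelationFunction (F : ℕ → MvPowerSeries ℕ+ (Polynomial ℂ)) (t : ℂ) (g n : ℕ)
    (G : (Fin n → ℂ) → ℂ) : Prop where
  rational : ∃ P Q : MvPolynomial (Fin n) ℂ, ∀ y ∈ genericPoints n,
    MvPolynomial.eval y Q ≠ 0 ∧ G y = MvPolynomial.eval y P / MvPolynomial.eval y Q
  expansion : ∃ R : ℝ, 0 < R ∧ ∀ y : Fin n → ℂ,
    (∀ i, (y i).re < 0 ∧ R < ‖(curve t).x (y i)‖) →
      HasSum (fun a : Fin n → ℕ+ =>
        correlator F t g a * ∏ i, ((curve t).x (y i))⁻¹ ^ ((a i : ℕ) + 1)) (G y)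

/-- The modification `Ĝ_{g,n}` of `G = G_{g,n}`:
`Ĝ_{0,1} = -1/4 + t/(2x_1) + G_{0,1}`, `Ĝ_{0,2} = 1/(x_1 - x_2)² + G_{0,2}`,
and `Ĝ_{g,n} = G_{g,n}` otherwise. -/
def modified (t : ℂ) : (g n : ℕ) → ((Fin n → ℂ) → ℂ) → (Fin n → ℂ) → ℂ
  | 0, 1, G, y => -(1 / 4) + t / (2 * (curve t).x (y 0)) + G y
  | 0, 2, G, y => 1 / ((curve t).x (y 0) - (curve t).x (y 1)) ^ 2 + G y
  | _, _, G, y => G y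

/-- The multidifferential `W_{g,n} = Ĝ_{g,n} dx_1 ⋯ dx_n`, as the coefficient of
`dy_1 ⋯ dy_n`. -/
def multidifferential (t : ℂ) (g n : ℕ) (G : (Fin n → ℂ) → ℂ) (y : Fin n → ℂ) : ℂ :=
  modified t g n G y * ∏ i, deriv (curve t).x (y i)

end ModifiedGUE

end

open ModifiedGUE

/-! The modified partition function has a concrete model. For an even weight the Hankel determinant
of size `N` splits by parity into two Hankel determinants with Laguerre weights `x^(∓1/2)
exp(-x/(2ε))`. Both belong to one family `laguerreTau ε k`, and after normalization `Z_even` at `N`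
is the product of the members `k = N` and `k = N - 1` (`evenPartition_eq`). Placing the `k`-th
factor at `t = (k + 1/2) ε` turns this factorization into the equation `log Z_even = (Λ^(1/2) +
Λ^(-1/2)) log Z̃`. The passage from Hermitian matrices to eigenvalues needs no change of variables:
both Gaussian expectations are normalized and obey the same loop equations, which have only one
solution (`gueExpectation_eq`).

Each factor satisfies Virasoro constraints (`virasoroDefect_modifiedLog`) in which the size of the
determinant and the exponent of the weight enter only through `t = (k + 1/2) ε` and `e = ε²`. The
constraints determine all coefficients of `ε² log Z̃` recursively as polynomials in `t` and `e`
(`exists_universal`); the coefficient of `e^g` is `F_g`. Any other solution `F` has the same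
correlators, because `Λ^(1/2) + Λ^(-1/2)` is injective on polynomials
(`IsModifiedFreeEnergy.coeff_eq`).

With `w = 1/x` the constraints become loop equations for generating series. The planar one-point
equation is the spectral curve (`curveSeries_sq`). Every other one is linear, `2 Y W + S = 0`, where
`Y` is the expansion of `y` and `S` is built from correlators of lower complexity, so it has exactly
one solution (`matches_of_isSource`). The topological recursion solves the same equation. On sources
that are monomials in `p^(-2)`, the residue against the kernel produces the coefficients of `(1 - 16
v)² / (y₀² - v)`, `v = p²`, collected in `kernelComb`; formal identities show that the same
combinations of the series `basisSeries`, the expansions of `y^(-2k-2) dy/dx`, solve the linear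
equation. `IsSource` records this agreement for each type of source: products of stable factors,
products with one factor `ω_{0,2}`, and the two initial cases `(0,3)` and `(1,1)`. Induction on `2g
+ n` gives `matches_stable`.

What remains is analytic: the series converge for large `|x_i|` on the sheet `Re y < 0`, and the
unstable functions `G_{0,1}` and `G_{0,2}` are computed in closed form. -/

noncomputable section
namespace ModifiedGUE
open MvPowerSeries Finset

/-! ### Differential calculus of formal power series in the couplings. -/

section Calculus
variable {A : Type*} [CommRing A]

/-- The derivation `∂/∂s_{2k}`, with the convention that it vanishes for `k = 0`. -/
def sDeriv (A : Type*) [CommRing A] (k : ℕ) :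
    Derivation A (MvPowerSeries ℕ+ A) (MvPowerSeries ℕ+ A) :=
  if h : 0 < k then pderiv A ⟨k, h⟩ else 0

@[simp] theorem sDeriv_zero : sDeriv A 0 = 0 := by simp [sDeriv]

theorem sDeriv_pnat (k : ℕ+) : sDeriv A k = pderiv A k := by
  simp only [sDeriv, k.pos, dif_pos]; rfl

theorem pderiv_comm (i j : ℕ+) (φ : MvPowerSeries ℕ+ A) :
    pderiv A i (pderiv A j φ) = pderiv A j (pderiv A i φ) := by
  classical
  ext n
  simp only [coeff_pderiv, Finsupp.add_apply, add_right_comm n (Finsupp.single i 1)]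
  by_cases h : i = j
  · subst h; rfl
  · simp [h, Ne.symm h]; ring

theorem sDeriv_comm (a b : ℕ) (φ : MvPowerSeries ℕ+ A) :
    sDeriv A a (sDeriv A b φ) = sDeriv A b (sDeriv A a φ) := by
  rcases Nat.eq_zero_or_pos a with rfl | ha
  · simp
  rcases Nat.eq_zero_or_pos b with rfl | hb
  · simp
  lift a to ℕ+ using ha
  lift b to ℕ+ using hb
  simp only [sDeriv_pnat, pderiv_comm]

/-- The finite part `∑_{k ∈ S} k s_{2k} ∂/∂s_{2(k+m)}` of `shiftOp`. -/
def shiftOpOn (S : Finset ℕ+) (m : ℕ) (φ : MvPowerSeries ℕ+ A) : MvPowerSeries ℕ+ A :=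
  ∑ k ∈ S, (k : ℕ) • (X k * sDeriv A (k + m) φ)

/-- The operator `∑_k k s_{2k} ∂/∂s_{2(k+m)}`. -/
def shiftOp (m : ℕ) (φ : MvPowerSeries ℕ+ A) : MvPowerSeries ℕ+ A :=
  fun μ => coeff μ (shiftOpOn μ.support m φ)

theorem coeff_X_mul_eq (k : ℕ+) (μ : ℕ+ →₀ ℕ) (φ : MvPowerSeries ℕ+ A) :
    coeff μ (X k * φ) = if k ∈ μ.support then coeff (μ - Finsupp.single k 1) φ else 0 := by
  classical
  rw [X_def, coeff_monomial_mul]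
  simp [Nat.one_le_iff_ne_zero]

/-- A term with factor `s_{2k}` only reaches monomials containing `s_{2k}`. Hence the infinite sum
may be truncated to one finite set that serves several monomials at once, which reduces identities
for `shiftOp` to finite sums of derivations. -/
theorem coeff_shiftOp_of_subset {S : Finset ℕ+} {μ : ℕ+ →₀ ℕ} (h : μ.support ⊆ S) (m : ℕ)
    (φ : MvPowerSeries ℕ+ A) : coeff μ (shiftOp m φ) = coeff μ (shiftOpOn S m φ) := by
  change coeff μ (shiftOpOn μ.support m φ) = _
  simp only [shiftOpOn, map_sum]
  refine Finset.sum_subset h fun k _ hk => ?_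
  rw [map_nsmul, coeff_X_mul_eq, if_neg hk, smul_zero]

theorem coeff_shiftOp (μ : ℕ+ →₀ ℕ) (m : ℕ) (φ : MvPowerSeries ℕ+ A) :
    coeff μ (shiftOp m φ) =
      ∑ k ∈ μ.support, (k : ℕ) * coeff (μ - Finsupp.single k 1) (sDeriv A (k + m) φ) := by
  change coeff μ (shiftOpOn μ.support m φ) = _
  simp only [shiftOpOn, map_sum]
  refine Finset.sum_congr rfl fun k hk => ?_
  rw [map_nsmul, coeff_X_mul_eq, if_pos hk, nsmul_eq_mul]

theorem shiftOp_smul (m : ℕ) (c : A) (φ : MvPowerSeries ℕ+ A) :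
    shiftOp m (c • φ) = c • shiftOp m φ := by
  ext μ
  simp only [coeff_shiftOp, map_smul, smul_eq_mul, Finset.mul_sum, Derivation.map_smul]
  exact Finset.sum_congr rfl fun k _ => by ring

/-- The commutator of the two operators: `∂/∂s_{2a}` commutes with the derivatives and hits only the
explicit coupling of the term `k = a`. -/
theorem sDeriv_shiftOp (a : ℕ+) (m : ℕ) (φ : MvPowerSeries ℕ+ A) :
    sDeriv A a (shiftOp m φ) = shiftOp m (sDeriv A a φ) + (a : ℕ) • sDeriv A (a + m) φ := by
  classical
  ext μ
  -- One truncation set for both monomials `μ` and `μ + δ_a`.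
  have hsub : μ.support ⊆ insert a μ.support := Finset.subset_insert _ _
  have hsub' : (μ + Finsupp.single a 1).support ⊆ insert a μ.support := by
    intro x hx
    by_cases h : x = a <;> simp_all
  rw [sDeriv_pnat, coeff_pderiv, coeff_shiftOp_of_subset hsub', ← coeff_pderiv, map_add,
    coeff_shiftOp_of_subset hsub, ← map_add]
  congr 1
  simp only [shiftOpOn, map_sum, map_nsmul, Derivation.leibniz, smul_eq_mul, smul_add,
    Finset.sum_add_distrib]
  congr 1
  · refine Finset.sum_congr rfl fun k _ => ?_
    rw [← sDeriv_pnat, sDeriv_comm]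
  · rw [Finset.sum_eq_single_of_mem a (Finset.mem_insert_self _ _)]
    · simp
    · intro b _ hb
      rw [pderiv_X_of_ne hb]; simp

/-! ### Iterated derivatives at the origin -/

/-- The value at `s = 0` of the derivative of `φ` with multi-index `μ`. -/
def derivAt (μ : ℕ+ →₀ ℕ) : MvPowerSeries ℕ+ A →ₗ[A] A :=
  ((μ.prod fun _ r => r.factorial : ℕ) : A) • coeff μ

theorem derivAt_apply (μ : ℕ+ →₀ ℕ) (φ : MvPowerSeries ℕ+ A) :
    derivAt μ φ = ((μ.prod fun _ r => r.factorial : ℕ) : A) * coeff μ φ := rfl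

theorem prod_factorial_add_single (μ : ℕ+ →₀ ℕ) (a : ℕ+) :
    ((μ + Finsupp.single a 1).prod fun _ r => r.factorial) =
      (μ.prod fun _ r => r.factorial) * (μ a + 1) := by
  classical
  have h1 : (μ + Finsupp.single a 1).support ⊆ insert a μ.support := by
    intro x hx
    by_cases h : x = a <;> simp_all
  rw [Finsupp.prod_of_support_subset _ h1 _ (by simp),
    Finsupp.prod_of_support_subset μ (Finset.subset_insert a _) _ (by simp),
    ← Finset.mul_prod_erase _ _ (Finset.mem_insert_self a _),
    ← Finset.mul_prod_erase _ (fun x => (μ x).factorial) (Finset.mem_insert_self a _)]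
  have : ∏ x ∈ (insert a μ.support).erase a, ((μ + Finsupp.single a 1 : ℕ+ →₀ ℕ) x).factorial =
      ∏ x ∈ (insert a μ.support).erase a, (μ x).factorial :=
    Finset.prod_congr rfl fun x hx => by
      simp [(Finset.ne_of_mem_erase hx)]
  rw [this]
  simp [Nat.factorial_succ]; ring

theorem derivAt_add_single (μ : ℕ+ →₀ ℕ) (a : ℕ+) (φ : MvPowerSeries ℕ+ A) :
    derivAt (μ + Finsupp.single a 1) φ = derivAt μ (sDeriv A a φ) := by
  rw [derivAt_apply, derivAt_apply, prod_factorial_add_single, sDeriv_pnat, coeff_pderiv]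
  push_cast; ring

@[simp] theorem derivAt_zero (φ : MvPowerSeries ℕ+ A) : derivAt 0 φ = constantCoeff φ := by
  simp [derivAt_apply]

variable {ι : Type*} [DecidableEq ι]

/-- The multi-index `∑_{i ∈ s} δ_{a_i}`. -/
def multiIndex (a : ι → ℕ+) (s : Finset ι) : ℕ+ →₀ ℕ := ∑ i ∈ s, Finsupp.single (a i) 1

theorem derivAt_multiIndex_insert (a : ι → ℕ+) {s : Finset ι} {i : ι} (hi : i ∉ s)
    (φ : MvPowerSeries ℕ+ A) :
    derivAt (multiIndex a (insert i s)) φ = derivAt (multiIndex a s) (sDeriv A (a i) φ) := by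
  rw [multiIndex, Finset.sum_insert hi, add_comm, ← derivAt_add_single]; rfl

/-- Iterated Leibniz rule. Labelling the derivatives by `ι` gives a sum over subsets without
multinomial factors, the form in which the recursion splits its points. -/
theorem derivAt_multiIndex_mul (a : ι → ℕ+) (s : Finset ι) (φ ψ : MvPowerSeries ℕ+ A) :
    derivAt (multiIndex a s) (φ * ψ) =
      ∑ J ∈ s.powerset, derivAt (multiIndex a J) φ * derivAt (multiIndex a (s \ J)) ψ := by
  induction s using Finset.induction_on generalizing φ ψ with
  | empty => simp [multiIndex]
  | insert i s hi ih =>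
    rw [derivAt_multiIndex_insert a hi, Derivation.leibniz, map_add, smul_eq_mul, smul_eq_mul, ih,
      ih, Finset.sum_powerset_insert hi]
    congr 1
    · refine Finset.sum_congr rfl fun J hJ => ?_
      have hJ := Finset.mem_powerset.mp hJ
      rw [Finset.insert_sdiff_of_notMem _ (fun h => hi (hJ h)), derivAt_multiIndex_insert]
      simp [hi]
    -- The other Leibniz term differentiates `φ`, and the induction hypothesis lists it by the
    -- subset falling on `ψ`; passing to complements restores the subset falling on `φ`.
    · rw [← Finset.sum_bij_ne_zero (s := s.powerset) (t := s.powerset)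
        (i := fun J _ _ => s \ J)
        (f := fun J => derivAt (multiIndex a J) ψ * derivAt (multiIndex a (s \ J)) (sDeriv A (a i) φ))
        (g := fun J => derivAt (multiIndex a (insert i J)) φ *
          derivAt (multiIndex a (insert i s \ insert i J)) ψ)]
      · intro J _ _; simp
      · intro J hJ _ K hK _ h
        have hJ := Finset.mem_powerset.mp hJ
        have hK := Finset.mem_powerset.mp hK
        rw [← Finset.sdiff_sdiff_eq_self hJ, h, Finset.sdiff_sdiff_eq_self hK]
      · intro K hK hne
        have hK := Finset.mem_powerset.mp hK
        refine ⟨s \ K, by simp, ?_, Finset.sdiff_sdiff_eq_self hK⟩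
        rw [Finset.sdiff_sdiff_eq_self hK]
        rw [derivAt_multiIndex_insert a (fun h => hi (hK h)),
          Finset.insert_sdiff_insert, Finset.sdiff_insert_of_notMem hi] at hne
        rwa [mul_comm]
      · intro J hJ _
        have hJ := Finset.mem_powerset.mp hJ
        rw [derivAt_multiIndex_insert a (by simp [hi]), Finset.insert_sdiff_insert,
          Finset.sdiff_insert_of_notMem hi, Finset.sdiff_sdiff_eq_self hJ, mul_comm]

/-- `shiftOp` vanishes at the origin, so only the commutators `sDeriv_shiftOp`, one for each
derivative, survive. -/
theorem derivAt_multiIndex_shiftOp (a : ι → ℕ+) (s : Finset ι) (m : ℕ) (φ : MvPowerSeries ℕ+ A) :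
    derivAt (multiIndex a s) (shiftOp m φ) =
      ∑ j ∈ s, (a j : ℕ) * derivAt (multiIndex a (s.erase j)) (sDeriv A (a j + m) φ) := by
  induction s using Finset.induction_on generalizing φ with
  | empty =>
    rw [multiIndex, Finset.sum_empty, derivAt_zero, ← coeff_zero_eq_constantCoeff_apply,
      coeff_shiftOp]
    simp
  | insert i s hi ih =>
    rw [derivAt_multiIndex_insert a hi, sDeriv_shiftOp, map_add, ih, Finset.sum_insert hi,
      Finset.erase_insert hi, map_nsmul, nsmul_eq_mul, add_comm]
    congr 1
    refine Finset.sum_congr rfl fun j hj => ?_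
    have hij : i ≠ j := fun h => hi (h ▸ hj)
    rw [Finset.erase_insert_of_ne hij, derivAt_multiIndex_insert a (by simp [hi]), sDeriv_comm]

end Calculus

/-! ### The logarithm of a power series -/

section Log

/-- Since `g` has no constant term, a given coefficient of `f(g)` sees only finitely many
coefficients of `f`; `f` may be replaced by a truncation, and for polynomials the chain rule is
algebra. -/
theorem pderiv_subst {f : PowerSeries ℂ} {g : MvPowerSeries ℕ+ ℂ} (hg : constantCoeff g = 0)
    (k : ℕ+) : pderiv ℂ k (f.subst g) = (PowerSeries.derivative ℂ f).subst g * pderiv ℂ k g := by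
  have hs : PowerSeries.HasSubst g := PowerSeries.HasSubst.of_constantCoeff_zero hg
  have hz : ∀ (d : ℕ+ →₀ ℕ) (n : ℕ), d.degree + 1 ≤ n → coeff d (g ^ n) = 0 := fun d n h =>
    coeff_eq_zero_of_constantCoeff_nilpotent (m := 1) (by simpa using hg) (by omega)
  have hp : ∀ p : Polynomial ℂ, pderiv ℂ k ((p : PowerSeries ℂ).subst g) =
      (PowerSeries.derivative ℂ (p : PowerSeries ℂ)).subst g * pderiv ℂ k g := fun p => by
    rw [PowerSeries.derivative_coe, PowerSeries.subst_coe hs, PowerSeries.subst_coe hs,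
      Derivation.comp_aeval_eq, smul_eq_mul]
  ext n
  -- The margin covers the extra degree of the coefficient being differentiated and the degree lost
  -- by differentiating the truncation.
  set N := n.degree + 3 with hN
  have h1 : ∀ d : ℕ+ →₀ ℕ, d.degree ≤ n.degree + 1 → ∀ f : PowerSeries ℂ,
      coeff d (f.subst g) = coeff d (((f.trunc N : Polynomial ℂ) : PowerSeries ℂ).subst g) := by
    intro d hd f
    rw [PowerSeries.coeff_subst hs, PowerSeries.coeff_subst hs]
    refine finsum_congr fun j => ?_
    rcases lt_or_ge j N with hj | hj
    · rw [PowerSeries.coeff_coe_trunc_of_lt hj]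
    · rw [hz d j (by omega)]; simp
  rw [coeff_pderiv, h1 _ (by simp [map_add, Finsupp.degree_single]), ← coeff_pderiv, hp, coeff_mul, coeff_mul]
  refine Finset.sum_congr rfl fun p hp => ?_
  congr 1
  have hpd : p.1.degree ≤ n.degree := by
    rw [← mem_antidiagonal.mp hp, map_add]; omega
  rw [PowerSeries.coeff_subst hs, PowerSeries.coeff_subst hs]
  refine finsum_congr fun j => ?_
  rcases lt_or_ge (j + 1) N with hj | hj
  · rw [PowerSeries.coeff_derivative, PowerSeries.coeff_derivative,
      PowerSeries.coeff_coe_trunc_of_lt hj]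
  · rw [hz p.1 j (by omega)]; simp

/-- The logarithm of a power series with constant coefficient `1`. -/
def logSeries (Z : MvPowerSeries ℕ+ ℂ) : MvPowerSeries ℕ+ ℂ := (PowerSeries.log ℂ).subst (Z - 1)

variable {Z Z' : MvPowerSeries ℕ+ ℂ}

theorem constantCoeff_logSeries (hZ : constantCoeff Z = 1) : constantCoeff (logSeries Z) = 0 :=
  PowerSeries.constantCoeff_subst_eq_zero (by simp [hZ]) _ PowerSeries.constantCoeff_log

theorem mul_pderiv_logSeries (hZ : constantCoeff Z = 1) (k : ℕ+) :
    Z * pderiv ℂ k (logSeries Z) = pderiv ℂ k Z := by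
  have h0 : constantCoeff (Z - 1) = 0 := by simp [hZ]
  have hs : PowerSeries.HasSubst (Z - 1) := PowerSeries.HasSubst.of_constantCoeff_zero h0
  have h1 : PowerSeries.derivative ℂ (PowerSeries.log ℂ) * (1 + PowerSeries.X) = 1 := by
    rw [PowerSeries.deriv_log, mul_add, mul_one]
    ext n
    cases n with
    | zero => simp
    | succ n => simp [PowerSeries.coeff_succ_mul_X, PowerSeries.coeff_one, pow_succ]
  have h2 := congrArg (PowerSeries.subst (Z - 1)) h1
  rw [PowerSeries.subst_mul hs, PowerSeries.subst_add hs, PowerSeries.subst_X hs,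
    ← map_one (PowerSeries.C (R := ℂ)), PowerSeries.subst_C, map_one, add_sub_cancel] at h2
  rw [logSeries, pderiv_subst h0, ← mul_assoc, mul_comm Z, h2, one_mul, map_sub, pderiv_one,
    sub_zero]

theorem mul_sDeriv_logSeries (hZ : constantCoeff Z = 1) (k : ℕ) :
    Z * sDeriv ℂ k (logSeries Z) = sDeriv ℂ k Z := by
  rcases Nat.eq_zero_or_pos k with rfl | hk
  · simp
  · lift k to ℕ+ using hk
    rw [sDeriv_pnat, mul_pderiv_logSeries hZ]

theorem logSeries_mul (hZ : constantCoeff Z = 1) (hZ' : constantCoeff Z' = 1) :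
    logSeries (Z * Z') = logSeries Z + logSeries Z' := by
  have hZZ : constantCoeff (Z * Z') = 1 := by simp [hZ, hZ']
  have hne : Z * Z' ≠ 0 := fun h => by simp [h] at hZZ
  refine pderiv.ext (fun k => mul_left_cancel₀ hne ?_) ?_
  · rw [mul_pderiv_logSeries hZZ, map_add, mul_add, mul_right_comm, mul_pderiv_logSeries hZ,
      mul_assoc, mul_pderiv_logSeries hZ', Derivation.leibniz, smul_eq_mul, smul_eq_mul]
    ring
  · simp [constantCoeff_logSeries, hZ, hZ', hZZ]

/-- At a monomial `μ`, all divisors of `μ` can use the truncation to `μ.support`, and there the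
operator is a finite combination of derivations. -/
theorem mul_shiftOp_logSeries (hZ : constantCoeff Z = 1) (m : ℕ) :
    Z * shiftOp m (logSeries Z) = shiftOp m Z := by
  classical
  ext μ
  rw [coeff_shiftOp_of_subset subset_rfl, coeff_mul]
  have key : ∀ p ∈ antidiagonal μ, p.2.support ⊆ μ.support := fun p hp => by
    rw [← mem_antidiagonal.mp hp]
    exact Finsupp.support_mono (by simp)
  rw [Finset.sum_congr rfl fun p hp => by rw [coeff_shiftOp_of_subset (key p hp)], ← coeff_mul]
  congr 1
  simp only [shiftOpOn, Finset.mul_sum, mul_smul_comm]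
  refine Finset.sum_congr rfl fun k _ => ?_
  rw [mul_left_comm, mul_sDeriv_logSeries hZ]

end Log
end ModifiedGUE
end

noncomputable section
namespace ModifiedGUE
open Finset MvPolynomial

/-! ### Product functionals and integration by parts -/

section Moments
variable {σ : Type*} [Fintype σ] {A : Type*} [CommRing A] [Algebra ℂ A]

/-- The linear functional on polynomials for which the variables are independent and `x_i ^ k`
has the value `μ i k`. -/
def momentFunctional (μ : σ → ℕ → A) : MvPolynomial σ ℂ →ₗ[ℂ] A :=
  (basisMonomials σ ℂ).constr ℂ fun κ => ∏ i, μ i (κ i)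

theorem momentFunctional_monomial (μ : σ → ℕ → A) (κ : σ →₀ ℕ) (c : ℂ) :
    momentFunctional μ (monomial κ c) = c • ∏ i, μ i (κ i) := by
  have h : monomial κ c = c • basisMonomials σ ℂ κ := by simp [smul_monomial]
  rw [h, map_smul, momentFunctional, Module.Basis.constr_basis]

theorem momentFunctional_prod_X_pow (μ : σ → ℕ → A) (κ : σ → ℕ) :
    momentFunctional μ (∏ i, X i ^ κ i) = ∏ i, μ i (κ i) := by
  have : (∏ i, X i ^ κ i : MvPolynomial σ ℂ) = monomial (Finsupp.equivFunOnFinite.symm κ) 1 := by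
    rw [monomial_eq, map_one, one_mul, Finsupp.prod_fintype _ _ (by simp)]
    rfl
  rw [this, momentFunctional_monomial, one_smul]
  rfl

theorem momentFunctional_X_mul_monomial (μ : σ → ℕ → A) (u : σ) (κ : σ →₀ ℕ) (c : ℂ) [DecidableEq σ] :
    momentFunctional μ (X u * monomial κ c) =
      c • (μ u (κ u + 1) * ∏ i ∈ univ.erase u, μ i (κ i)) := by
  rw [X, monomial_mul, one_mul, momentFunctional_monomial, ← mul_prod_erase _ _ (mem_univ u)]
  congr 2
  · simp [add_comm]
  · exact prod_congr rfl fun i hi => by simp [(ne_of_mem_erase hi)]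

/-- Gaussian integration by parts; the hypothesis is the case of a power of `x_u`. For `k = 0` the
truncated index `k - 1` is harmless because the factor `k` vanishes. -/
theorem momentFunctional_X_mul_of_gaussian {μ : σ → ℕ → A} {u : σ} {c : ℂ}
    (h : ∀ k, μ u (k + 1) = (c * k) • μ u (k - 1)) (P : MvPolynomial σ ℂ) :
    momentFunctional μ (X u * P) = c • momentFunctional μ (pderiv u P) := by
  classical
  induction P using MvPolynomial.induction_on' with
  | monomial κ a =>
    rw [momentFunctional_X_mul_monomial, pderiv_monomial, momentFunctional_monomial, h,
      ← mul_prod_erase _ _ (mem_univ u)]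
    have : ∏ i ∈ univ.erase u, μ i ((κ - Finsupp.single u 1 : σ →₀ ℕ) i) = ∏ i ∈ univ.erase u, μ i (κ i) :=
      prod_congr rfl fun i hi => by simp [(ne_of_mem_erase hi)]
    rw [this]
    simp only [Finsupp.coe_tsub, Pi.sub_apply, Finsupp.single_eq_same, smul_mul_assoc, smul_smul]
    congr 1
    ring
  | add p q hp hq => rw [mul_add, map_add, hp, hq, map_add, map_add, smul_add]

/-- Integration by parts for the weight `x^(β/2 - 1) exp(-x/(2c))`, whose moments satisfy the
assumed recursion. -/
theorem momentFunctional_X_mul_of_gamma {μ : σ → ℕ → A} {u : σ} {c β : ℂ}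
    (h : ∀ k : ℕ, μ u (k + 1) = (c * (β + 2 * k)) • μ u k) (P : MvPolynomial σ ℂ) :
    momentFunctional μ (X u * P) =
      c • momentFunctional μ (β • P + (2 : ℂ) • (X u * pderiv u P)) := by
  classical
  induction P using MvPolynomial.induction_on' with
  | monomial κ a =>
    rw [momentFunctional_X_mul_monomial, h, X_mul_pderiv_monomial, map_add, map_smul, map_smul,
      map_nsmul, momentFunctional_monomial, ← mul_prod_erase _ _ (mem_univ u)]
    simp only [smul_mul_assoc, smul_smul, ← Nat.cast_smul_eq_nsmul ℂ, ← add_smul]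
    congr 1
    ring
  | add p q hp hq =>
    have e : β • (p + q) + (2 : ℂ) • (X u * pderiv u (p + q)) =
        (β • p + (2 : ℂ) • (X u * pderiv u p)) + (β • q + (2 : ℂ) • (X u * pderiv u q)) := by
      rw [map_add, mul_add, smul_add, smul_add, add_add_add_comm]
    rw [mul_add, map_add, hp, hq, e, map_add (momentFunctional μ) (_ + _) (_ + _), smul_add]

end Moments

/-! ### The loop equations of an ensemble of eigenvalues -/

section Loop

theorem derivation_prod_eq {B ι : Type*} [CommRing B] [Algebra ℂ B] (D : Derivation ℂ B B)
    (s : Finset ι) (f h : ι → B) (hf : ∀ i ∈ s, D (f i) = h i * f i) :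
    D (∏ i ∈ s, f i) = (∑ i ∈ s, h i) * ∏ i ∈ s, f i := by
  classical
  induction s using Finset.induction_on with
  | empty => simp
  | insert i s hi ih =>
    rw [prod_insert hi, sum_insert hi, Derivation.leibniz, hf i (mem_insert_self i s),
      ih fun j hj => hf j (mem_insert_of_mem hj), smul_eq_mul, smul_eq_mul]
    ring

/-- The derivation of `ℂ[p_0, p_1, …]` with `p_j ↦ j p_{j + k - 1}`. -/
def powerSumDeriv (k : ℕ) : Derivation ℂ (MvPolynomial ℕ ℂ) (MvPolynomial ℕ ℂ) :=
  mkDerivation ℂ fun j => (j : ℂ) • X (j + k - 1)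

/-- Lets the single derivation `powerSumDeriv k` describe both traces of matrix powers and power
sums of eigenvalues, so that the two ensembles have literally the same loop equations. -/
theorem derivation_aeval_eq {B : Type*} [CommRing B] [Algebra ℂ B] (D : Derivation ℂ B B)
    (p : ℕ → B) (k : ℕ) (h : ∀ j, D (p j) = (j : ℂ) • p (j + k - 1)) (Q : MvPolynomial ℕ ℂ) :
    D (aeval p Q) = aeval p (powerSumDeriv k Q) := by
  induction Q using MvPolynomial.induction_on with
  | C a => simp [powerSumDeriv]
  | add P Q hP hQ => simp [hP, hQ]
  | mul_X P j hP => simp [hP, h, powerSumDeriv, Derivation.leibniz, mkDerivation_X]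

variable {N : ℕ}

/-- The derivation `∑_i x_i^k ∂/∂x_i`. -/
def eulerField (N k : ℕ) : Derivation ℂ (MvPolynomial (Fin N) ℂ) (MvPolynomial (Fin N) ℂ) :=
  mkDerivation ℂ fun i => X i ^ k

theorem eulerField_apply (k : ℕ) (P : MvPolynomial (Fin N) ℂ) :
    eulerField N k P = ∑ i, X i ^ k * pderiv i P := by
  have hsum : ∀ D : Fin N → Derivation ℂ (MvPolynomial (Fin N) ℂ) (MvPolynomial (Fin N) ℂ),
      ⇑(∑ i, D i) = ∑ i, ⇑(D i) := fun D => map_sum Derivation.coeFnAddMonoidHom D univ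
  have : eulerField N k = ∑ i, (X i ^ k : MvPolynomial (Fin N) ℂ) • pderiv i := by
    refine derivation_ext fun j => ?_
    rw [eulerField, mkDerivation_X, hsum, Finset.sum_apply,
      Finset.sum_eq_single_of_mem j (mem_univ j)]
    · simp
    · intro i _ hi
      simp [pderiv_X_of_ne hi.symm]
  rw [this, hsum, Finset.sum_apply]
  rfl

theorem eulerField_psum (k j : ℕ) :
    eulerField N k (psum (Fin N) ℂ j) = (j : ℂ) • psum (Fin N) ℂ (j + k - 1) := by
  simp only [psum, map_sum, Finset.smul_sum]
  refine Finset.sum_congr rfl fun i _ => ?_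
  rw [Derivation.leibniz_pow, eulerField, mkDerivation_X, smul_eq_mul, ← pow_add,
    Nat.cast_smul_eq_nsmul]
  rcases Nat.eq_zero_or_pos j with rfl | hj
  · simp
  · congr 2; omega

theorem eulerField_aeval_psum (k : ℕ) (Q : MvPolynomial ℕ ℂ) :
    eulerField N k (aeval (psum (Fin N) ℂ) Q) = aeval (psum (Fin N) ℂ) (powerSumDeriv k Q) :=
  derivation_aeval_eq _ _ _ (eulerField_psum k) Q

/-- The Vandermonde determinant. -/
def vandermondePoly (N : ℕ) : MvPolynomial (Fin N) ℂ := ∏ i : Fin N, ∏ j ∈ Ioi i, (X j - X i)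

/-- The field sends `x_j - x_i` to `x_j^k - x_i^k = h(i,j) (x_j - x_i)`. Twice the sum of the
symmetric `h` over pairs `i < j` is its full double sum, a sum of products of power sums, minus its
diagonal. -/
theorem two_smul_eulerField_vandermondePoly (k : ℕ) :
    2 * eulerField N k (vandermondePoly N) =
      (∑ a ∈ range k, psum (Fin N) ℂ a * psum (Fin N) ℂ (k - 1 - a) -
        (k : ℂ) • psum (Fin N) ℂ (k - 1)) * vandermondePoly N := by
  set h : Fin N → Fin N → MvPolynomial (Fin N) ℂ :=
    fun i j => ∑ a ∈ range k, X j ^ a * X i ^ (k - 1 - a) with hh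
  have hsymm : ∀ i j, h i j = h j i := fun i j => by
    simp only [hh]
    rw [← Finset.sum_range_reflect]
    refine Finset.sum_congr rfl fun a ha => ?_
    have := Finset.mem_range.mp ha
    rw [mul_comm]
    congr 2
    omega
  have h1 : eulerField N k (vandermondePoly N) =
      (∑ i, ∑ j ∈ Ioi i, h i j) * vandermondePoly N := by
    refine derivation_prod_eq _ _ _ _ fun i _ => derivation_prod_eq _ _ _ _ fun j _ => ?_
    rw [map_sub, eulerField, mkDerivation_X, mkDerivation_X, hh, geom_sum₂_mul]
  have h2 : ∑ i, ∑ j, h i j = ∑ a ∈ range k, psum (Fin N) ℂ a * psum (Fin N) ℂ (k - 1 - a) := by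
    simp only [hh, psum, Finset.sum_mul_sum]
    rw [Finset.sum_comm]
    simp_rw [Finset.sum_comm (s := range k)]
  have h3 : ∑ i, h i i = (k : ℂ) • psum (Fin N) ℂ (k - 1) := by
    simp only [hh, psum, Finset.smul_sum]
    refine Finset.sum_congr rfl fun i _ => ?_
    rw [Finset.sum_congr rfl (g := fun _ => X i ^ (k - 1))]
    · simp [Nat.cast_smul_eq_nsmul]
    · intro a ha
      have := Finset.mem_range.mp ha
      rw [← pow_add]; congr 1; omega
  have h4 : ∑ i, ∑ j ∈ Iio i, h i j = ∑ i, ∑ j ∈ Ioi i, h i j := by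
    rw [Finset.sum_comm' (t' := univ) (s' := fun j => Ioi j) (by simp)]
    exact Finset.sum_congr rfl fun i _ => Finset.sum_congr rfl fun j _ => hsymm _ _
  have h5 : ∀ i, ∑ j, h i j = ∑ j ∈ Iio i, h i j + ∑ j ∈ Ioi i, h i j + h i i := fun i => by
    have : (univ : Finset (Fin N)) = (Iio i ∪ Ioi i) ∪ {i} := by
      ext j; simp only [mem_univ, mem_union, mem_Iio, mem_Ioi, mem_singleton]; grind
    rw [this, Finset.sum_union, Finset.sum_union, Finset.sum_singleton]
    · exact Finset.disjoint_left.mpr fun j hj hj' =>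
        absurd (Finset.mem_Iio.mp hj) (Finset.mem_Ioi.mp hj').not_gt
    · simp
  rw [h1, ← h2, ← h3]
  simp_rw [h5]
  rw [Finset.sum_add_distrib, Finset.sum_add_distrib, h4]
  ring

variable {A : Type*} [CommRing A] [Algebra ℂ A]

theorem psum_mul_eq (k m : ℕ) (P : MvPolynomial (Fin N) ℂ) :
    psum (Fin N) ℂ (k + m) * P = ∑ i, X i ^ k * (X i ^ m * P) := by
  simp only [psum, Finset.sum_mul, pow_add, mul_assoc]

theorem sum_pderiv_pow_mul (k : ℕ) (P : MvPolynomial (Fin N) ℂ) :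
    ∑ i, pderiv i (X i ^ k * P) = (k : ℂ) • (psum (Fin N) ℂ (k - 1) * P) + eulerField N k P := by
  rw [eulerField_apply, psum, Finset.sum_mul, Finset.smul_sum, ← Finset.sum_add_distrib]
  refine Finset.sum_congr rfl fun i _ => ?_
  rw [Derivation.leibniz, Derivation.leibniz_pow, pderiv_X_self]
  simp only [smul_eq_mul, MvPolynomial.smul_eq_C_mul, nsmul_eq_mul, map_natCast]
  ring

theorem eulerField_mul_sq_vandermondePoly (k : ℕ) (Q : MvPolynomial (Fin N) ℂ) :
    eulerField N k (Q * vandermondePoly N ^ 2) =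
      (eulerField N k Q + (∑ a ∈ range k, psum (Fin N) ℂ a * psum (Fin N) ℂ (k - 1 - a) -
        (k : ℂ) • psum (Fin N) ℂ (k - 1)) * Q) * vandermondePoly N ^ 2 := by
  rw [Derivation.leibniz, Derivation.leibniz_pow, smul_eq_mul, smul_eq_mul, smul_eq_mul]
  have := two_smul_eulerField_vandermondePoly (N := N) k
  linear_combination (Q * vandermondePoly N) * this

/-- Integration by parts of `∑ ∂_i (x_i^k Q Δ²)`. The divergence `k p_{k-1}` of the field cancels
the diagonal term from the Vandermonde square. -/
theorem gaussian_loop_equation {μ : ℕ → A} {c : ℂ}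
    (h : ∀ k : ℕ, μ (k + 1) = (c * k) • μ (k - 1)) (k : ℕ) (Q : MvPolynomial (Fin N) ℂ) :
    momentFunctional (fun _ : Fin N => μ) (psum (Fin N) ℂ (k + 1) * Q * vandermondePoly N ^ 2) =
      c • momentFunctional (fun _ : Fin N => μ)
        ((∑ a ∈ range k, psum (Fin N) ℂ a * psum (Fin N) ℂ (k - 1 - a) * Q + eulerField N k Q) *
          vandermondePoly N ^ 2) := by
  rw [mul_assoc, add_comm, psum_mul_eq, map_sum]
  simp only [pow_one, fun i => momentFunctional_X_mul_of_gaussian (μ := fun _ : Fin N => μ) (u := i) h]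
  rw [← Finset.smul_sum, ← map_sum, sum_pderiv_pow_mul, eulerField_mul_sq_vandermondePoly]
  congr 2
  simp only [MvPolynomial.smul_eq_C_mul, ← Finset.sum_mul]
  ring

/-- The same argument for the weight `x^α exp(-x/(2c))` and the field `x_i^(m+1) ∂_i`; after the
cancellation the weight leaves the term `α p_m`. -/
theorem gamma_loop_equation {μ : ℕ → A} {c α : ℂ}
    (h : ∀ k : ℕ, μ (k + 1) = (c * ((2 * α + 2) + 2 * k)) • μ k) (m : ℕ)
    (Q : MvPolynomial (Fin N) ℂ) :
    momentFunctional (fun _ : Fin N => μ) (psum (Fin N) ℂ (m + 1) * Q * vandermondePoly N ^ 2) =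
      (2 * c) • momentFunctional (fun _ : Fin N => μ)
        ((∑ a ∈ range (m + 1), psum (Fin N) ℂ a * psum (Fin N) ℂ (m - a) * Q +
          α • (psum (Fin N) ℂ m * Q) + eulerField N (m + 1) Q) * vandermondePoly N ^ 2) := by
  rw [mul_assoc, add_comm, psum_mul_eq, map_sum]
  simp only [pow_one, fun i => momentFunctional_X_mul_of_gamma (μ := fun _ : Fin N => μ) (u := i) h]
  rw [← Finset.smul_sum, ← map_sum, mul_comm 2 c, mul_smul, ← map_smul _ (2 : ℂ)]
  congr 2
  have h1 : ∀ i : Fin N, X i * pderiv i (X i ^ m * (Q * vandermondePoly N ^ 2)) =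
      pderiv i (X i ^ (m + 1) * (Q * vandermondePoly N ^ 2)) -
        X i ^ m * (Q * vandermondePoly N ^ 2) := fun i => by
    rw [pow_succ' (X i) m, mul_assoc, Derivation.leibniz (pderiv i) (X i), pderiv_X_self]
    simp
  simp_rw [h1]
  rw [Finset.sum_add_distrib, ← Finset.smul_sum, ← Finset.smul_sum, Finset.sum_sub_distrib,
    sum_pderiv_pow_mul, eulerField_mul_sq_vandermondePoly, ← Finset.sum_mul]
  simp only [MvPolynomial.smul_eq_C_mul, ← Finset.sum_mul, Nat.add_sub_cancel, map_add, map_mul,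
    map_ofNat, psum, Nat.cast_add, Nat.cast_one, map_one]
  ring_nf

end Loop
end ModifiedGUE
end

noncomputable section
namespace ModifiedGUE
open Finset MvPolynomial

/-! ### Hankel determinants and their splitting by parity. -/

section Hankel
variable {A : Type*} [CommRing A] [Algebra ℂ A]

/-- The Hankel matrix of a sequence. -/
def hankel (μ : ℕ → A) (N : ℕ) : Matrix (Fin N) (Fin N) A := Matrix.of fun i j => μ (i + j)

/-- Heine's formula. In the expansion of both Vandermonde determinants, each permutation of the
first factor can be absorbed by relabelling the variables, giving `N!` copies of the Hankel
determinant. -/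
theorem momentFunctional_vandermondePoly_sq (μ : ℕ → A) (N : ℕ) :
    momentFunctional (fun _ : Fin N => μ) (vandermondePoly N ^ 2) =
      (N.factorial : ℂ) • (hankel μ N).det := by
  have hV : vandermondePoly N =
      ∑ s : Equiv.Perm (Fin N), ((Equiv.Perm.sign s : ℤ) : ℂ) • ∏ i, X i ^ (s i : ℕ) := by
    rw [vandermondePoly, ← Matrix.det_vandermonde, ← Matrix.det_transpose, Matrix.det_apply']
    refine Finset.sum_congr rfl fun s _ => ?_
    simp [Matrix.vandermonde_apply, MvPolynomial.smul_eq_C_mul]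
  have h1 : momentFunctional (fun _ : Fin N => μ) (vandermondePoly N ^ 2) =
      ∑ s : Equiv.Perm (Fin N), ∑ r : Equiv.Perm (Fin N),
        (((Equiv.Perm.sign s : ℤ) : ℂ) * ((Equiv.Perm.sign r : ℤ) : ℂ)) •
          ∏ i, μ ((s i : ℕ) + r i) := by
    rw [hV, sq, Finset.sum_mul_sum, map_sum]
    refine Finset.sum_congr rfl fun s _ => ?_
    rw [map_sum]
    refine Finset.sum_congr rfl fun r _ => ?_
    rw [smul_mul_smul_comm, map_smul, ← Finset.prod_mul_distrib]
    simp_rw [← pow_add]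
    rw [momentFunctional_prod_X_pow]
  have h2 : ∀ s : Equiv.Perm (Fin N), ∑ r : Equiv.Perm (Fin N),
        (((Equiv.Perm.sign s : ℤ) : ℂ) * ((Equiv.Perm.sign r : ℤ) : ℂ)) •
          ∏ i, μ ((s i : ℕ) + r i) = (hankel μ N).det := fun s => by
    rw [← Matrix.det_transpose, Matrix.det_apply', ← Equiv.sum_comp (Equiv.mulRight s)]
    refine Finset.sum_congr rfl fun r _ => ?_
    simp only [Equiv.coe_mulRight, Equiv.Perm.sign_mul, Equiv.Perm.coe_mul, Function.comp_apply]
    rw [← Equiv.prod_comp s fun j => (hankel μ N).transpose (r j) j]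
    have : ((Equiv.Perm.sign s : ℤ) : ℂ) * (((Equiv.Perm.sign r * Equiv.Perm.sign s : ℤˣ) : ℤ) : ℂ) =
        ((Equiv.Perm.sign r : ℤ) : ℂ) := by
      rcases Int.units_eq_one_or (Equiv.Perm.sign s) with h | h <;> simp [h]
    rw [this]
    simp [hankel, Algebra.smul_def]
  rw [h1, Finset.sum_congr rfl fun s _ => h2 s, Finset.sum_const, Finset.card_univ,
    Fintype.card_perm, Fintype.card_fin, Nat.cast_smul_eq_nsmul]

/-- Even and odd indices. -/
def parityEquiv (N : ℕ) : Fin ((N + 1) / 2) ⊕ Fin (N / 2) ≃ Fin N where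
  toFun := Sum.elim (fun i => ⟨2 * i, by omega⟩) (fun i => ⟨2 * i + 1, by omega⟩)
  invFun i := if h : (i : ℕ) % 2 = 0 then Sum.inl ⟨i / 2, by omega⟩ else Sum.inr ⟨i / 2, by omega⟩
  left_inv := by
    rintro (i | i)
    · simp
    · have h : ¬ (2 * (i : ℕ) + 1) % 2 = 0 := by omega
      have h' : (2 * (i : ℕ) + 1) / 2 = i := by omega
      simp [h']
  right_inv i := by
    by_cases h : (i : ℕ) % 2 = 0
    · simp only [h, dif_pos, Sum.elim_inl]; ext; simp; omega
    · simp only [h, dif_neg, not_false_eq_true, Sum.elim_inr]; ext; simp; omega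

/-- Entries whose row and column have different parity vanish, so sorting the indices by parity
makes the matrix block diagonal. This is the origin of the modified partition function. -/
theorem det_hankel_of_odd_eq_zero {A : Type*} [CommRing A] {μ : ℕ → A} (h : ∀ k, μ (2 * k + 1) = 0) (N : ℕ) :
    (hankel μ N).det = (hankel (fun k => μ (2 * k)) ((N + 1) / 2)).det *
      (hankel (fun k => μ (2 * k + 2)) (N / 2)).det := by
  rw [← Matrix.det_submatrix_equiv_self (parityEquiv N), ← Matrix.det_fromBlocks_zero₂₁ _ 0 _]
  congr 1
  ext i j
  rcases i with i | i <;> rcases j with j | j <;>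
    simp only [hankel, parityEquiv, Matrix.submatrix_apply, Equiv.coe_fn_mk, Sum.elim_inl,
      Sum.elim_inr, Matrix.of_apply, Matrix.fromBlocks_apply₁₁, Matrix.fromBlocks_apply₁₂,
      Matrix.fromBlocks_apply₂₁, Matrix.fromBlocks_apply₂₂, Matrix.zero_apply]
  · congr 1; ring
  · rw [← h (i + j)]; congr 1; ring
  · rw [← h (i + j)]; congr 1; ring
  · congr 1; ring

end Hankel

/-! ### Nonvanishing of the Gaussian Hankel determinants. -/

section Nondegenerate
open Polynomial

/-- A kernel vector is a nonzero polynomial `g` of degree below `N` with `L(P g) = 0` for all `P` of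
degree below `N`. Taking for `P` the Hermite polynomial of degree `d = deg g` and integrating by
parts `d` times gives `L(P g) = c^d d! lc(g) ≠ 0`. No positivity is involved. -/
theorem det_hankel_ne_zero_of_gaussian {μ : ℕ → ℂ} {c : ℂ} (hc : c ≠ 0) (h0 : μ 0 = 1)
    (h : ∀ k : ℕ, μ (k + 1) = (c * k) • μ (k - 1)) (N : ℕ) : (hankel μ N).det ≠ 0 := by
  set L : ℂ[X] →ₗ[ℂ] ℂ := (Polynomial.basisMonomials ℂ).constr ℂ μ with hL
  have hLm : ∀ k a, L (Polynomial.monomial k a) = a * μ k := fun k a => by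
    have : Polynomial.monomial k a = a • Polynomial.basisMonomials ℂ k := by
      simp [Polynomial.smul_monomial]
    rw [this, map_smul, hL, Module.Basis.constr_basis, smul_eq_mul]
  have hibp : ∀ P : ℂ[X], L (Polynomial.X * P) = c * L (derivative P) := fun P => by
    induction P using Polynomial.induction_on' with
    | add p q hp hq => rw [mul_add, map_add, hp, hq, derivative_add, map_add, mul_add]
    | monomial k a =>
      rw [X_mul_monomial, derivative_monomial, hLm, hLm, h, smul_eq_mul]
      ring
  -- The Hermite polynomials, generated by `H ↦ X H - c H'`.
  have hH : ∀ d : ℕ, ∃ H : ℂ[X], H.natDegree ≤ d ∧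
      ∀ g, L (H * g) = c ^ d * L (derivative^[d] g) := fun d => by
    induction d with
    | zero => exact ⟨1, by simp, by simp⟩
    | succ d ih =>
      obtain ⟨H, hd, hH⟩ := ih
      refine ⟨Polynomial.X * H - Polynomial.C c * derivative H, ?_, fun g => ?_⟩
      · refine (natDegree_sub_le _ _).trans (max_le ?_ ?_)
        · exact (natDegree_mul_le).trans (by rw [natDegree_X]; omega)
        · refine (natDegree_C_mul_le _ _).trans ((natDegree_derivative_le _).trans (by omega))
      · rw [sub_mul, map_sub, mul_assoc, hibp, derivative_mul, map_add, mul_assoc,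
          Polynomial.C_mul', map_smul, smul_eq_mul, hH, Function.iterate_succ_apply]
        ring
  intro hdet
  obtain ⟨v, hv, hMv⟩ := Matrix.exists_mulVec_eq_zero_iff.mpr hdet
  set g : ℂ[X] := ∑ j : Fin N, Polynomial.monomial j (v j) with hg
  have hcoeff : ∀ j : Fin N, g.coeff j = v j := fun j => by
    simp [hg, Polynomial.coeff_monomial, Fin.val_inj]
  have hg0 : g ≠ 0 := fun h0 => hv (funext fun j => by rw [← hcoeff, h0]; simp)
  have hdeg : g.natDegree < N := by
    by_contra hlt
    refine leadingCoeff_ne_zero.mpr hg0 ?_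
    rw [leadingCoeff, hg, Polynomial.finsetSum_coeff]
    refine Finset.sum_eq_zero fun j _ => ?_
    rw [Polynomial.coeff_monomial, if_neg]
    rw [← hg]; omega
  have hXg : ∀ i < N, ∀ a, L (Polynomial.monomial i a * g) = 0 := fun i hi a => by
    have := congrFun hMv ⟨i, hi⟩
    simp only [Matrix.mulVec, dotProduct, hankel, Matrix.of_apply, Pi.zero_apply] at this
    rw [hg, Finset.mul_sum, map_sum]
    simp_rw [monomial_mul_monomial, hLm]
    rw [← mul_zero a, ← this, Finset.mul_sum]
    exact Finset.sum_congr rfl fun j _ => by ring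
  obtain ⟨H, hHd, hHg⟩ := hH g.natDegree
  have h1 : L (H * g) = 0 := by
    rw [H.as_sum_range' (g.natDegree + 1) (by omega), Finset.sum_mul, map_sum]
    exact Finset.sum_eq_zero fun i hi => hXg i (by have := Finset.mem_range.mp hi; omega) _
  rw [hHg] at h1
  have h2 : derivative^[g.natDegree] g =
      Polynomial.monomial 0 ((g.natDegree.factorial : ℂ) * g.leadingCoeff) := by
    have hd0 : (derivative^[g.natDegree] g).natDegree = 0 := by
      have := natDegree_iterate_derivative g g.natDegree
      omega
    rw [eq_C_of_natDegree_eq_zero hd0, coeff_iterate_derivative]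
    rw [zero_add, Nat.descFactorial_self, nsmul_eq_mul]; rfl
  rw [h2, hLm, h0] at h1
  simp [hc, hg0, Nat.factorial_ne_zero] at h1

end Nondegenerate
end ModifiedGUE
end

noncomputable section
namespace ModifiedGUE
open Finset MvPolynomial

/-! ### Uniqueness of the solution of the loop equations -/

section Uniqueness

/-- The span of the products of power sums of bounded weight. -/
def weightSpan (n : ℕ) : Submodule ℂ (MvPolynomial ℕ ℂ) :=
  Submodule.span ℂ {P | ∃ l : Multiset ℕ, (l.map fun j => 2 * j + 1).sum ≤ n ∧
    P = (l.map X).prod}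

theorem weightSpan_mono {m n : ℕ} (h : m ≤ n) : weightSpan m ≤ weightSpan n :=
  Submodule.span_mono fun _ ⟨l, hl, e⟩ => ⟨l, hl.trans h, e⟩

theorem X_mul_mem_weightSpan {n : ℕ} {P : MvPolynomial ℕ ℂ} (h : P ∈ weightSpan n) (j : ℕ) :
    X j * P ∈ weightSpan (n + (2 * j + 1)) := by
  induction h using Submodule.span_induction with
  | mem P hP =>
    obtain ⟨l, hl, rfl⟩ := hP
    exact Submodule.subset_span ⟨j ::ₘ l, by rw [Multiset.map_cons, Multiset.sum_cons]; omega, by simp⟩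
  | zero => simp
  | add P Q _ _ hP hQ => rw [mul_add]; exact add_mem hP hQ
  | smul c P _ hP => rw [mul_smul_comm]; exact Submodule.smul_mem _ _ hP

theorem prod_X_mem_weightSpan (l : Multiset ℕ) :
    (l.map X).prod ∈ weightSpan (l.map fun j => 2 * j + 1).sum :=
  Submodule.subset_span ⟨l, le_rfl, rfl⟩

theorem powerSumDeriv_prod_X_mem (k : ℕ) (l : Multiset ℕ) :
    powerSumDeriv k (l.map X).prod ∈ weightSpan ((l.map fun j => 2 * j + 1).sum + 2 * k) := by
  induction l using Multiset.induction_on with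
  | empty => simp
  | cons j l ih =>
    simp only [Multiset.map_cons, Multiset.prod_cons, Multiset.sum_cons, Derivation.leibniz,
      smul_eq_mul]
    refine add_mem ?_ ?_
    · have h := X_mul_mem_weightSpan ih j
      exact weightSpan_mono (by omega) h
    · have h := X_mul_mem_weightSpan (prod_X_mem_weightSpan l) (j + k - 1)
      rw [powerSumDeriv, mkDerivation_X, mul_smul_comm, mul_comm (Multiset.prod _)]
      exact Submodule.smul_mem _ _ (weightSpan_mono (by omega) h)

theorem exists_mem_weightSpan (P : MvPolynomial ℕ ℂ) : ∃ n, P ∈ weightSpan n := by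
  induction P using MvPolynomial.induction_on with
  | C a =>
    refine ⟨0, ?_⟩
    have : (C a : MvPolynomial ℕ ℂ) = a • ((0 : Multiset ℕ).map X).prod := by
      simp [MvPolynomial.smul_eq_C_mul]
    rw [this]
    exact Submodule.smul_mem _ _ (prod_X_mem_weightSpan 0)
  | add P Q hP hQ =>
    obtain ⟨m, hm⟩ := hP
    obtain ⟨n, hn⟩ := hQ
    exact ⟨m + n, add_mem (weightSpan_mono (by omega) hm) (weightSpan_mono (by omega) hn)⟩
  | mul_X P j hP =>
    obtain ⟨m, hm⟩ := hP
    exact ⟨_, mul_comm P (X j) ▸ X_mul_mem_weightSpan hm j⟩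

/-- Induction on the weight in which `X j` counts `2j + 1`. The loop equation replaces the factor `X
(k + 1)`, of weight `2k + 3`, by terms raising the weight of `Q` by at most `2k`. The summand `1`
gives `X 0` positive weight, so removing it also lowers the weight. -/
theorem eq_of_loop_equations {φ ψ : MvPolynomial ℕ ℂ →ₗ[ℂ] ℂ} {c N : ℂ}
    (h1 : φ 1 = ψ 1) (hφ0 : ∀ Q, φ (X 0 * Q) = N * φ Q) (hψ0 : ∀ Q, ψ (X 0 * Q) = N * ψ Q)
    (hφ : ∀ k Q, φ (X (k + 1) * Q) =
      c * φ (∑ a ∈ range k, X a * X (k - 1 - a) * Q + powerSumDeriv k Q))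
    (hψ : ∀ k Q, ψ (X (k + 1) * Q) =
      c * ψ (∑ a ∈ range k, X a * X (k - 1 - a) * Q + powerSumDeriv k Q)) : φ = ψ := by
  have key : ∀ n, ∀ l : Multiset ℕ, (l.map fun j => 2 * j + 1).sum < n →
      φ (l.map X).prod = ψ (l.map X).prod := by
    intro n
    induction n with
    | zero => intro l hl; omega
    | succ n ih =>
      have ih' : ∀ m < n, ∀ P ∈ weightSpan m, φ P = ψ P := fun m hm P hP => by
        induction hP using Submodule.span_induction with
        | mem P hP => obtain ⟨l, hl, rfl⟩ := hP; exact ih l (by omega)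
        | zero => simp
        | add P Q _ _ hP hQ => rw [map_add, map_add, hP, hQ]
        | smul c P _ hP => rw [map_smul, map_smul, hP]
      intro l hl
      induction l using Multiset.induction_on with
      | empty => simpa using h1
      | cons j l _ =>
        rw [Multiset.map_cons, Multiset.sum_cons] at hl
        rw [Multiset.map_cons, Multiset.prod_cons]
        have hQ := prod_X_mem_weightSpan l
        rcases j with _ | k
        · rw [hφ0, hψ0, ih' _ (by omega) _ hQ]
        · rw [hφ, hψ, ih' (((l.map fun j => 2 * j + 1).sum) + 2 * k) (by omega)]
          refine add_mem (Submodule.sum_mem _ fun a ha => ?_) (powerSumDeriv_prod_X_mem k l)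
          have := Finset.mem_range.mp ha
          rw [mul_assoc]
          exact weightSpan_mono (by omega) (X_mul_mem_weightSpan (X_mul_mem_weightSpan hQ _) _)
  refine LinearMap.ext fun P => ?_
  obtain ⟨n, hn⟩ := exists_mem_weightSpan P
  induction hn using Submodule.span_induction with
  | mem P hP => obtain ⟨l, hl, rfl⟩ := hP; exact key _ l (Nat.lt_succ_self _)
  | zero => simp
  | add P Q _ _ hP hQ => rw [map_add, map_add, hP, hQ]
  | smul c P _ hP => rw [map_smul, map_smul, hP]

end Uniqueness

/-! ### Gaussian integrals over Hermitian matrices -/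

section Gaussian
open MeasureTheory

/-- The moments of the weight `exp (-b x²)`. -/
def gaussianMoment (b : ℝ) (k : ℕ) : ℂ := ∫ x : ℝ, (x : ℂ) ^ k * Complex.exp (-b * (x : ℂ) ^ 2)

theorem integrable_pow_mul_cexp {b : ℝ} (hb : 0 < b) (k : ℕ) :
    Integrable fun x : ℝ => (x : ℂ) ^ k * Complex.exp (-b * (x : ℂ) ^ 2) := by
  have h := integrable_rpow_mul_exp_neg_mul_sq hb (s := k) (by
    have : (0 : ℝ) ≤ k := Nat.cast_nonneg k
    linarith)
  simp_rw [Real.rpow_natCast] at h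
  convert h.ofReal (𝕜 := ℂ) using 2 with x
  simp

theorem gaussianMoment_succ {b : ℝ} (hb : 0 < b) (k : ℕ) :
    gaussianMoment b (k + 1) = ((1 / (2 * b) : ℂ) * k) • gaussianMoment b (k - 1) := by
  have hd : ∀ x : ℝ, HasDerivAt (fun x : ℝ => (x : ℂ) ^ k * Complex.exp (-b * (x : ℂ) ^ 2))
      (k * ((x : ℂ) ^ (k - 1) * Complex.exp (-b * (x : ℂ) ^ 2)) -
        2 * b * ((x : ℂ) ^ (k + 1) * Complex.exp (-b * (x : ℂ) ^ 2))) x := fun x => by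
    have h0 : HasDerivAt (fun z : ℂ => z ^ k * Complex.exp (-b * z ^ 2))
        (k * (x : ℂ) ^ (k - 1) * Complex.exp (-b * (x : ℂ) ^ 2) +
          (x : ℂ) ^ k * (Complex.exp (-b * (x : ℂ) ^ 2) * (-b * (2 * (x : ℂ))))) (x : ℂ) := by
      refine (hasDerivAt_pow k _).mul (HasDerivAt.cexp ?_)
      simpa using ((hasDerivAt_pow 2 (x : ℂ)).const_mul (-b : ℂ))
    convert h0.comp_ofReal using 1
    ring
  have hi := integrable_pow_mul_cexp hb
  have h := integral_eq_zero_of_hasDerivAt_of_integrable hd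
    (((hi (k - 1)).const_mul _).sub ((hi (k + 1)).const_mul _)) (hi k)
  rw [integral_sub ((hi (k - 1)).const_mul _) ((hi (k + 1)).const_mul _), integral_const_mul,
    integral_const_mul] at h
  change (k : ℂ) * gaussianMoment b (k - 1) - 2 * b * gaussianMoment b (k + 1) = 0 at h
  have hb' : (b : ℂ) ≠ 0 := by exact_mod_cast hb.ne'
  rw [smul_eq_mul]
  field_simp
  linear_combination -h

theorem gaussianMoment_zero_ne_zero {b : ℝ} (hb : 0 < b) : gaussianMoment b 0 ≠ 0 := by
  have h : gaussianMoment b 0 = ((∫ x : ℝ, Real.exp (-b * x ^ 2) : ℝ) : ℂ) := by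
    rw [gaussianMoment, ← integral_complex_ofReal]
    simp
  rw [h, integral_gaussian]
  have : 0 < Real.sqrt (Real.pi / b) := Real.sqrt_pos.mpr (by positivity)
  exact_mod_cast this.ne'

variable {N : ℕ}

/-- The rates of the independent Gaussian entries. -/
def entryRate (ε : ℝ) (u : Fin N × Fin N) : ℝ := if u.1 = u.2 then 1 / (2 * ε) else 1 / ε

theorem entryRate_pos {ε : ℝ} (hε : 0 < ε) (u : Fin N × Fin N) : 0 < entryRate ε u := by
  unfold entryRate; split_ifs <;> positivity

theorem trace_hermitian_sq (X : Fin N → Fin N → ℝ) (ε : ℝ) :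
    -(1 / (ε : ℂ)) * ((hermitian X ^ 2).trace / 2) =
      ∑ i, ∑ j, -(entryRate ε (i, j) : ℂ) * (X i j : ℂ) ^ 2 := by
  have h1 : (hermitian X ^ 2).trace =
      ∑ i, ∑ j, if i = j then (X i i : ℂ) ^ 2 else (X i j : ℂ) ^ 2 + (X j i : ℂ) ^ 2 := by
    rw [sq, Matrix.trace]
    refine Finset.sum_congr rfl fun i _ => ?_
    rw [Matrix.diag_apply, Matrix.mul_apply]
    refine Finset.sum_congr rfl fun j _ => ?_
    simp only [hermitian, Matrix.of_apply]
    rcases lt_trichotomy i j with h | h | h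
    · rw [if_neg h.ne, if_pos h, if_neg h.ne', if_neg h.not_gt, if_neg h.ne]
      linear_combination (-(X j i : ℂ) ^ 2) * Complex.I_sq
    · subst h; simp [sq]
    · rw [if_neg h.ne', if_neg h.not_gt, if_neg h.ne, if_pos h, if_neg h.ne']
      linear_combination (-(X i j : ℂ) ^ 2) * Complex.I_sq
  -- Each summand splits into a function of `X i j` and the transposed function of `X j i`. The
  -- double sum is therefore twice a sum over independent entries, which accounts for the different
  -- rates on and off the diagonal.
  have h2 : ∀ i j : Fin N, (if i = j then (X i i : ℂ) ^ 2 else (X i j : ℂ) ^ 2 + (X j i : ℂ) ^ 2) =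
      (if i = j then (X i j : ℂ) ^ 2 / 2 else (X i j : ℂ) ^ 2) +
        (if j = i then (X j i : ℂ) ^ 2 / 2 else (X j i : ℂ) ^ 2) := fun i j => by
    by_cases h : i = j
    · subst h; simp
    · simp [h, Ne.symm h]
  rw [h1]
  simp_rw [h2, Finset.sum_add_distrib]
  rw [Finset.sum_comm (f := fun i j => if j = i then (X j i : ℂ) ^ 2 / 2 else (X j i : ℂ) ^ 2),
    ← two_mul, mul_div_cancel_left₀ _ two_ne_zero, Finset.mul_sum]
  refine Finset.sum_congr rfl fun i _ => ?_
  rw [Finset.mul_sum]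
  refine Finset.sum_congr rfl fun j _ => ?_
  by_cases h : i = j
  · subst h; simp [entryRate]; ring
  · simp [entryRate, h]

/-- The Gaussian functional on polynomials in the real coordinates of a Hermitian matrix. -/
def entryFunctional (N : ℕ) (ε : ℝ) : MvPolynomial (Fin N × Fin N) ℂ →ₗ[ℂ] ℂ :=
  momentFunctional fun u => gaussianMoment (entryRate ε u)

theorem integral_eval_mul_cexp {ε : ℝ} (hε : 0 < ε) (P : MvPolynomial (Fin N × Fin N) ℂ) :
    (Integrable fun X : Fin N → Fin N → ℝ => eval (fun u => (X u.1 u.2 : ℂ)) P *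
      Complex.exp (-(1 / (ε : ℂ)) * ((hermitian X ^ 2).trace / 2))) ∧
    ∫ X : Fin N → Fin N → ℝ, eval (fun u => (X u.1 u.2 : ℂ)) P *
      Complex.exp (-(1 / (ε : ℂ)) * ((hermitian X ^ 2).trace / 2)) = entryFunctional N ε P := by
  induction P using MvPolynomial.induction_on' with
  | monomial κ c =>
    set f : Fin N → Fin N → ℝ → ℂ := fun i j x =>
      (x : ℂ) ^ κ (i, j) * Complex.exp (-(entryRate ε (i, j) : ℂ) * (x : ℂ) ^ 2) with hf
    have e : ∀ X : Fin N → Fin N → ℝ, eval (fun u => (X u.1 u.2 : ℂ)) (monomial κ c) *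
        Complex.exp (-(1 / (ε : ℂ)) * ((hermitian X ^ 2).trace / 2)) =
        c * ∏ i, ∏ j, f i j (X i j) := fun X => by
      rw [trace_hermitian_sq, Complex.exp_sum, eval_monomial,
        Finsupp.prod_fintype _ _ (by simp), mul_assoc, Fintype.prod_prod_type,
        ← Finset.prod_mul_distrib]
      congr 1
      refine Finset.prod_congr rfl fun i _ => ?_
      rw [Complex.exp_sum, ← Finset.prod_mul_distrib]
    simp_rw [e]
    have hint : ∀ i j, Integrable (f i j) := fun i j =>
      integrable_pow_mul_cexp (entryRate_pos hε (i, j)) _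
    have hint' : ∀ i, Integrable fun x : Fin N → ℝ => ∏ j, f i j (x j) := fun i =>
      Integrable.fintype_prod fun j => hint i j
    refine ⟨(Integrable.fintype_prod (f := fun i (x : Fin N → ℝ) => ∏ j, f i j (x j))
      fun i => hint' i).const_mul c, ?_⟩
    rw [integral_const_mul,
      integral_fintype_prod_volume_eq_prod (fun i (x : Fin N → ℝ) => ∏ j, f i j (x j))]
    simp_rw [integral_fintype_prod_volume_eq_prod]
    rw [entryFunctional, momentFunctional_monomial, Fintype.prod_prod_type, smul_eq_mul]
    rfl
  | add P Q hP hQ =>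
    simp only [map_add, add_mul]
    refine ⟨hP.1.add hQ.1, ?_⟩
    rw [integral_add hP.1 hQ.1, hP.2, hQ.2]

/-- The Hermitian matrix of linear polynomials in its real coordinates. -/
def hermitianPoly (N : ℕ) : Matrix (Fin N) (Fin N) (MvPolynomial (Fin N × Fin N) ℂ) :=
  Matrix.of fun i j =>
    if i = j then X (i, i)
    else if i < j then X (i, j) + C Complex.I * X (j, i)
    else X (j, i) - C Complex.I * X (i, j)

/-- The traces of the powers of `hermitianPoly`. -/
def tracePoly (N k : ℕ) : MvPolynomial (Fin N × Fin N) ℂ := (hermitianPoly N ^ k).trace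

theorem eval_tracePoly (X : Fin N → Fin N → ℝ) (k : ℕ) :
    eval (fun u => (X u.1 u.2 : ℂ)) (tracePoly N k) = (hermitian X ^ k).trace := by
  have h : (eval fun u : Fin N × Fin N => (X u.1 u.2 : ℂ)).mapMatrix (hermitianPoly N) =
      hermitian X := by
    ext i j
    simp only [hermitianPoly, hermitian, RingHom.mapMatrix_apply, Matrix.map_apply, Matrix.of_apply]
    split_ifs <;> simp
  rw [← h, ← map_pow, tracePoly, RingHom.mapMatrix_apply, Matrix.trace, map_sum]
  rfl

/-- The derivation dual to the entry `(j, i)` of a Hermitian matrix. -/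
def entryDeriv (i j : Fin N) :
    Derivation ℂ (MvPolynomial (Fin N × Fin N) ℂ) (MvPolynomial (Fin N × Fin N) ℂ) :=
  if i = j then pderiv (i, i)
  else if i < j then (1 / 2 : ℂ) • (pderiv (i, j) + Complex.I • pderiv (j, i))
  else (1 / 2 : ℂ) • (pderiv (j, i) - Complex.I • pderiv (i, j))

theorem entryDeriv_hermitianPoly (i j k l : Fin N) :
    entryDeriv i j (hermitianPoly N k l) = if k = j ∧ l = i then 1 else 0 := by
  have hX : ∀ a b c d : Fin N, pderiv (a, b) (X (c, d) : MvPolynomial (Fin N × Fin N) ℂ) =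
      if a = c ∧ b = d then 1 else 0 := fun a b c d => by
    simp [pderiv_X, Pi.single_apply, eq_comm]
  have hI : (C Complex.I * C Complex.I : MvPolynomial (Fin N × Fin N) ℂ) = -1 := by
    rw [← C_mul, Complex.I_mul_I, C_neg, C_1]
  have hhalf : (C (1 / 2) * 2 : MvPolynomial (Fin N × Fin N) ℂ) = 1 := by
    rw [← map_ofNat C 2, ← C_mul]; norm_num
  have hp : ∀ u, pderiv u (C Complex.I : MvPolynomial (Fin N × Fin N) ℂ) = 0 := fun u => pderiv_C
  have hn : ∀ {a b : Fin N}, a < b → a ≠ b ∧ b ≠ a ∧ ¬ b < a :=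
    fun h => ⟨h.ne, h.ne', h.not_gt⟩
  rcases lt_trichotomy i j with h | h | h <;> rcases lt_trichotomy k l with h' | h' | h'
  all_goals first | subst h | obtain ⟨h1, h2, h3⟩ := hn h
  all_goals first | subst h' | obtain ⟨h1', h2', h3'⟩ := hn h'
  all_goals
    simp only [entryDeriv, hermitianPoly, Matrix.of_apply, if_true, if_false, *,
      Derivation.smul_apply, Derivation.add_apply,
      Derivation.sub_apply, map_add, map_sub, Derivation.leibniz, smul_eq_mul, mul_zero,
      add_zero, MvPolynomial.smul_eq_C_mul]
  all_goals
    simp only [Fin.lt_def, Fin.ext_iff, ne_eq] at *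
    split_ifs <;> first
      | (exfalso; omega)
      | ring1
      | linear_combination C (1 / 2) * hI
      | linear_combination - C (1 / 2) * hI
      | linear_combination hhalf - C (1 / 2) * hI

/-- The Schwinger-Dyson equation `⟨M_ij P⟩ = ε ⟨∂P/∂M_ji⟩`. Off the diagonal the real coordinates
have variance `ε/2`, matching the factor `1/2` in `entryDeriv`. -/
theorem entryFunctional_hermitianPoly_mul {ε : ℝ} (hε : 0 < ε) (i j : Fin N)
    (P : MvPolynomial (Fin N × Fin N) ℂ) :
    entryFunctional N ε (hermitianPoly N i j * P) =
      (ε : ℂ) • entryFunctional N ε (entryDeriv i j P) := by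
  have hε' : (ε : ℂ) ≠ 0 := by exact_mod_cast hε.ne'
  have h : ∀ u : Fin N × Fin N, entryFunctional N ε (X u * P) =
      (if u.1 = u.2 then (ε : ℂ) else ε / 2) * entryFunctional N ε (pderiv u P) := fun u => by
    rw [entryFunctional, momentFunctional_X_mul_of_gaussian
      (μ := fun u : Fin N × Fin N => gaussianMoment (entryRate ε u))
      (gaussianMoment_succ (entryRate_pos hε u)), smul_eq_mul, entryRate]
    congr 1
    split_ifs
    · push_cast; field_simp
    · push_cast; field_simp
  unfold hermitianPoly entryDeriv
  rcases lt_trichotomy i j with hij | hij | hij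
  · simp only [Matrix.of_apply, hij, hij.ne, if_true, if_false, add_mul, map_add, smul_mul_assoc,
      ← MvPolynomial.smul_eq_C_mul, map_smul, h, hij.ne', Derivation.smul_apply, Derivation.add_apply, smul_eq_mul]
    ring
  · subst hij
    simp [h]
  · simp only [Matrix.of_apply, hij.not_gt, hij.ne', hij.ne, if_false, sub_mul, map_sub, smul_mul_assoc,
      ← MvPolynomial.smul_eq_C_mul, map_smul, h, Derivation.smul_apply, Derivation.sub_apply, smul_eq_mul]
    ring

end Gaussian
end ModifiedGUE
end

noncomputable section
namespace ModifiedGUE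
open Finset MvPolynomial

/-! ### Loop equations for matrices, and the passage from matrices to eigenvalues. -/

section MatrixDerivation
variable {B : Type*} [CommRing B] [Algebra ℂ B] {N : ℕ}

theorem derivation_matrix_pow (D : Derivation ℂ B B) (M : Matrix (Fin N) (Fin N) B) (k : ℕ) :
    (M ^ k).map D = ∑ a ∈ range k, M ^ a * M.map D * M ^ (k - 1 - a) := by
  induction k with
  | zero =>
    ext i j
    simp only [pow_zero, Matrix.map_apply, Matrix.one_apply, range_zero, sum_empty,
      Matrix.zero_apply]
    split_ifs <;> simp
  | succ k ih =>
    have h : (M ^ (k + 1)).map D = (M ^ k).map D * M + M ^ k * M.map D := by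
      ext i j
      simp only [pow_succ, Matrix.map_apply, Matrix.mul_apply, Matrix.add_apply, map_sum,
        Derivation.leibniz, smul_eq_mul, Finset.sum_add_distrib]
      rw [add_comm]
      congr 1
      exact Finset.sum_congr rfl fun l _ => by ring
    rw [h, ih, Finset.sum_range_succ, Finset.sum_mul]
    congr 1
    · refine Finset.sum_congr rfl fun a ha => ?_
      have := Finset.mem_range.mp ha
      rw [mul_assoc _ _ M, ← pow_succ]
      congr 2
      omega
    · simp

end MatrixDerivation

section MatrixLoop
variable {N : ℕ}

theorem entryDeriv_hermitianPoly_pow (i j p q : Fin N) (k : ℕ) :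
    entryDeriv i j ((hermitianPoly N ^ k) p q) =
      ∑ a ∈ range k, (hermitianPoly N ^ a) p j * (hermitianPoly N ^ (k - 1 - a)) i q := by
  have h := congrFun (congrFun (derivation_matrix_pow (entryDeriv i j) (hermitianPoly N) k) p) q
  rw [Matrix.map_apply] at h
  rw [h, Matrix.sum_apply]
  refine Finset.sum_congr rfl fun a _ => ?_
  rw [Matrix.mul_apply, Finset.sum_eq_single i]
  · rw [Matrix.mul_apply, Finset.sum_eq_single j]
    · simp [Matrix.map_apply, entryDeriv_hermitianPoly]
    · intro b _ hb
      simp [Matrix.map_apply, entryDeriv_hermitianPoly, hb]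
    · simp
  · intro b _ hb
    rw [Matrix.mul_apply, Finset.sum_eq_zero, zero_mul]
    intro c _
    simp [Matrix.map_apply, entryDeriv_hermitianPoly, hb]
  · simp

theorem entryDeriv_tracePoly (i j : Fin N) (m : ℕ) :
    entryDeriv i j (tracePoly N m) = (m : ℂ) • (hermitianPoly N ^ (m - 1)) i j := by
  rw [tracePoly, Matrix.trace, map_sum]
  simp only [Matrix.diag_apply, entryDeriv_hermitianPoly_pow]
  rw [Finset.sum_comm, Finset.sum_congr rfl (g := fun _ => (hermitianPoly N ^ (m - 1)) i j)]
  · simp [Nat.cast_smul_eq_nsmul]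
  · intro a ha
    have := Finset.mem_range.mp ha
    have e : m - 1 = (m - 1 - a) + a := by omega
    nth_rw 2 [e]
    rw [pow_add, Matrix.mul_apply]
    exact Finset.sum_congr rfl fun p _ => mul_comm _ _

/-- The derivation `∑_{ij} (M^k)_{ji} ∂/∂M_{ji}`. -/
def matrixField (N k : ℕ) :
    Derivation ℂ (MvPolynomial (Fin N × Fin N) ℂ) (MvPolynomial (Fin N × Fin N) ℂ) :=
  ∑ u : Fin N × Fin N, (hermitianPoly N ^ k) u.2 u.1 • entryDeriv u.1 u.2

theorem matrixField_apply (k : ℕ) (P : MvPolynomial (Fin N × Fin N) ℂ) :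
    matrixField N k P = ∑ i, ∑ j, (hermitianPoly N ^ k) j i * entryDeriv i j P := by
  have hsum : ∀ D : Fin N × Fin N → Derivation ℂ (MvPolynomial (Fin N × Fin N) ℂ)
      (MvPolynomial (Fin N × Fin N) ℂ), ⇑(∑ i, D i) = ∑ i, ⇑(D i) :=
    fun D => map_sum Derivation.coeFnAddMonoidHom D univ
  rw [matrixField, hsum, Finset.sum_apply, Fintype.sum_prod_type]
  rfl

theorem matrixField_tracePoly (k m : ℕ) :
    matrixField N k (tracePoly N m) = (m : ℂ) • tracePoly N (m + k - 1) := by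
  rw [matrixField_apply]
  simp only [entryDeriv_tracePoly, mul_smul_comm, ← Finset.smul_sum]
  rcases Nat.eq_zero_or_pos m with rfl | hm
  · simp
  · congr 1
    rw [tracePoly, show m + k - 1 = (m - 1) + k by omega, pow_add, Matrix.trace]
    refine Finset.sum_congr rfl fun i _ => ?_
    rw [Matrix.diag_apply, Matrix.mul_apply]
    exact Finset.sum_congr rfl fun p _ => mul_comm _ _

/-- The Schwinger-Dyson equation for `tr(M · M^k) Q`: when the derivative hits `M^k` the trace
splits in two, and when it hits `Q` two traces are joined. -/
theorem entryFunctional_loop_equation {ε : ℝ} (hε : 0 < ε) (k : ℕ) (Q : MvPolynomial ℕ ℂ) :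
    entryFunctional N ε (aeval (tracePoly N) (X (k + 1) * Q)) =
      (ε : ℂ) * entryFunctional N ε (aeval (tracePoly N)
        (∑ a ∈ range k, X a * X (k - 1 - a) * Q + powerSumDeriv k Q)) := by
  set R := aeval (tracePoly N) Q with hR
  have h1 : aeval (tracePoly N) (X (k + 1) * Q) =
      ∑ i, ∑ j, hermitianPoly N i j * ((hermitianPoly N ^ k) j i * R) := by
    rw [map_mul, aeval_X, tracePoly, pow_succ', Matrix.trace, Finset.sum_mul]
    refine Finset.sum_congr rfl fun i _ => ?_
    rw [Matrix.diag_apply, Matrix.mul_apply, Finset.sum_mul]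
    exact Finset.sum_congr rfl fun j _ => by rw [mul_assoc]
  have h2 : ∑ i, ∑ j, entryDeriv i j ((hermitianPoly N ^ k) j i * R) = aeval (tracePoly N)
      (∑ a ∈ range k, X a * X (k - 1 - a) * Q + powerSumDeriv k Q) := by
    rw [map_add, ← derivation_aeval_eq (matrixField N k) (tracePoly N) k (matrixField_tracePoly k),
      matrixField_apply]
    simp only [Derivation.leibniz, Finset.sum_add_distrib, smul_eq_mul]
    rw [add_comm]
    congr 1
    have h3 : ∑ i, ∑ j, entryDeriv i j ((hermitianPoly N ^ k) j i) =
        ∑ a ∈ range k, tracePoly N a * tracePoly N (k - 1 - a) := by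
      simp only [entryDeriv_hermitianPoly_pow]
      simp_rw [Finset.sum_comm (t := range k)]
      refine Finset.sum_congr rfl fun a _ => ?_
      rw [tracePoly, tracePoly, Matrix.trace, Matrix.trace, Finset.sum_mul_sum, Finset.sum_comm]
      rfl
    simp only [← Finset.mul_sum, h3, map_sum, map_mul, aeval_X, ← Finset.sum_mul, ← hR]
    ring
  rw [h1, ← h2]
  simp only [map_sum, entryFunctional_hermitianPoly_mul hε, smul_eq_mul, Finset.mul_sum]

/-- The normalized moments of the Gaussian weight of variance `ε`. -/
def normalizedMoment (ε : ℝ) (k : ℕ) : ℂ :=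
  gaussianMoment (1 / (2 * ε)) k / gaussianMoment (1 / (2 * ε)) 0

theorem normalizedMoment_zero {ε : ℝ} (hε : 0 < ε) : normalizedMoment ε 0 = 1 :=
  div_self (gaussianMoment_zero_ne_zero (by positivity))

theorem normalizedMoment_succ {ε : ℝ} (hε : 0 < ε) (k : ℕ) :
    normalizedMoment ε (k + 1) = ((ε : ℂ) * k) • normalizedMoment ε (k - 1) := by
  have hε' : (ε : ℂ) ≠ 0 := by exact_mod_cast hε.ne'
  rw [normalizedMoment, gaussianMoment_succ (by positivity), normalizedMoment, smul_eq_mul,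
    smul_eq_mul, mul_div_assoc]
  congr 2
  push_cast
  field_simp

/-- The Gaussian eigenvalue functional, normalized. -/
def eigenvalueFunctional (N : ℕ) (ε : ℝ) : MvPolynomial ℕ ℂ →ₗ[ℂ] ℂ where
  toFun Q := momentFunctional (fun _ : Fin N => normalizedMoment ε)
    (aeval (psum (Fin N) ℂ) Q * vandermondePoly N ^ 2) /
      momentFunctional (fun _ : Fin N => normalizedMoment ε) (vandermondePoly N ^ 2)
  map_add' P Q := by rw [map_add, add_mul, map_add, add_div]
  map_smul' c P := by
    rw [map_smul, smul_mul_assoc, map_smul, smul_eq_mul, RingHom.id_apply, smul_eq_mul,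
      mul_div_assoc]

theorem eigenvalueFunctional_apply (N : ℕ) (ε : ℝ) (Q : MvPolynomial ℕ ℂ) :
    eigenvalueFunctional N ε Q = momentFunctional (fun _ : Fin N => normalizedMoment ε)
      (aeval (psum (Fin N) ℂ) Q * vandermondePoly N ^ 2) /
      momentFunctional (fun _ : Fin N => normalizedMoment ε) (vandermondePoly N ^ 2) := rfl

theorem vandermondePoly_sq_moment_ne_zero (N : ℕ) {ε : ℝ} (hε : 0 < ε) :
    momentFunctional (fun _ : Fin N => normalizedMoment ε) (vandermondePoly N ^ 2) ≠ 0 := by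
  rw [momentFunctional_vandermondePoly_sq]
  refine smul_ne_zero (by exact_mod_cast N.factorial_ne_zero) ?_
  exact det_hankel_ne_zero_of_gaussian (by exact_mod_cast hε.ne') (normalizedMoment_zero hε)
    (normalizedMoment_succ hε) N

theorem entryFunctional_one_ne_zero (N : ℕ) {ε : ℝ} (hε : 0 < ε) : entryFunctional N ε 1 ≠ 0 := by
  rw [entryFunctional, ← C_1, ← monomial_zero', momentFunctional_monomial, one_smul]
  exact Finset.prod_ne_zero_iff.mpr fun u _ => gaussianMoment_zero_ne_zero (entryRate_pos hε u)

theorem gueIntegral_eq {ε : ℝ} (hε : 0 < ε) (Q : MvPolynomial ℕ ℂ) :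
    gueIntegral N ε (fun M => eval (fun k => (M ^ k).trace) Q) =
      entryFunctional N ε (aeval (tracePoly N) Q) := by
  rw [← (integral_eval_mul_cexp hε _).2, gueIntegral]
  congr 1
  ext X
  congr 1
  induction Q using MvPolynomial.induction_on with
  | C a => simp
  | add P Q hP hQ => rw [map_add, map_add, map_add, hP, hQ]
  | mul_X P k hP => rw [map_mul, map_mul, map_mul, hP, eval_X, aeval_X, eval_tracePoly]

/-- This plays the role of the Weyl integration formula: both functionals are normalized and satisfy
the loop equations to which `eq_of_loop_equations` applies. -/
theorem gueExpectation_eq {ε : ℝ} (hε : 0 < ε) (Q : MvPolynomial ℕ ℂ) :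
    gueExpectation N ε (fun M => eval (fun k => (M ^ k).trace) Q) = eigenvalueFunctional N ε Q := by
  set φ : MvPolynomial ℕ ℂ →ₗ[ℂ] ℂ := (entryFunctional N ε 1)⁻¹ •
    (entryFunctional N ε ∘ₗ (aeval (tracePoly N)).toLinearMap) with hφ
  have hφa : ∀ Q, φ Q = (entryFunctional N ε 1)⁻¹ * entryFunctional N ε (aeval (tracePoly N) Q) :=
    fun Q => rfl
  have key : φ = eigenvalueFunctional N ε := by
    refine eq_of_loop_equations (c := ε) (N := N) ?_ ?_ ?_ ?_ ?_
    · rw [hφa, eigenvalueFunctional_apply, map_one (aeval _), map_one (aeval _), one_mul,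
        inv_mul_cancel₀ (entryFunctional_one_ne_zero N hε),
        div_self (vandermondePoly_sq_moment_ne_zero N hε)]
    · intro Q
      rw [hφa, hφa, map_mul, aeval_X, tracePoly, pow_zero, Matrix.trace_one, Fintype.card_fin,
        ← map_natCast C, ← MvPolynomial.smul_eq_C_mul, map_smul, smul_eq_mul]
      ring
    · intro Q
      rw [eigenvalueFunctional_apply, eigenvalueFunctional_apply, map_mul (aeval _), aeval_X,
        show psum (Fin N) ℂ 0 = C (N : ℂ) by simp [psum], mul_assoc, ← MvPolynomial.smul_eq_C_mul,
        map_smul, smul_eq_mul, mul_div_assoc]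
    · intro k Q
      rw [hφa, hφa, entryFunctional_loop_equation hε]
      ring
    · intro k Q
      rw [eigenvalueFunctional_apply, eigenvalueFunctional_apply, map_mul (aeval _), aeval_X,
        gaussian_loop_equation (normalizedMoment_succ hε), eulerField_aeval_psum, smul_eq_mul,
        mul_div_assoc]
      simp only [map_add, map_sum, map_mul, aeval_X]
  rw [← key, hφa, gueExpectation, gueIntegral_eq hε, div_eq_inv_mul]
  congr 2
  simpa using gueIntegral_eq (N := N) hε 1

/-- The coefficients of the partition function in terms of eigenvalues. -/
theorem coeff_evenPartition {ε : ℝ} (hε : 0 < ε) (m : ℕ+ →₀ ℕ) :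
    MvPowerSeries.coeff m (evenPartition N ε) =
      (m.prod fun _ r => (r.factorial : ℂ))⁻¹ * ((ε : ℂ)⁻¹ ^ m.degree * eigenvalueFunctional N ε
        (m.prod fun k r => X (2 * (k : ℕ)) ^ r)) := by
  have h := gueExpectation_eq (N := N) hε ((m.prod fun _ r => (r.factorial : ℂ))⁻¹ •
    ((ε : ℂ)⁻¹ ^ m.degree • (m.prod fun k r => X (2 * (k : ℕ)) ^ r)))
  rw [map_smul, map_smul, smul_eq_mul, smul_eq_mul] at h
  rw [← h]
  change gueExpectation N ε _ = _
  congr 1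
  ext M
  simp only [MvPolynomial.smul_eval, Finsupp.prod, map_prod, map_pow, eval_X]
  rw [Finsupp.degree_apply, ← Finset.prod_pow_eq_pow_sum, ← Finset.prod_inv_distrib, ← Finset.prod_mul_distrib,
    ← Finset.prod_mul_distrib]
  refine Finset.prod_congr rfl fun k _ => ?_
  rw [mul_pow, div_eq_inv_mul]

end MatrixLoop
end ModifiedGUE
end

noncomputable section
namespace ModifiedGUE
open Finset

/-! ### Deformed moments -/

section Deformed
open MvPowerSeries

theorem finsupp_induction_add_single {ι : Type*} {p : (ι →₀ ℕ) → Prop} (h0 : p 0)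
    (h1 : ∀ m a, p m → p (m + Finsupp.single a 1)) (m : ι →₀ ℕ) : p m := by
  classical
  induction hd : m.degree generalizing m with
  | zero => rw [Finsupp.degree_eq_zero_iff] at hd; exact hd ▸ h0
  | succ d ih =>
    have hne : m ≠ 0 := fun h => by rw [h] at hd; simp at hd
    obtain ⟨a, ha⟩ := Finsupp.ne_iff.mp hne
    have hle : Finsupp.single a 1 ≤ m := by
      rw [Finsupp.single_le_iff]; exact Nat.one_le_iff_ne_zero.mpr ha
    rw [← tsub_add_cancel_of_le hle] at hd ⊢
    rw [map_add, Finsupp.degree_single] at hd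
    exact h1 _ _ (ih _ (by omega))

theorem eq_zero_of_derivAt_eq_zero {φ : MvPowerSeries ℕ+ ℂ} (h : ∀ μ, derivAt μ φ = 0) : φ = 0 := by
  ext μ
  have := h μ
  rw [derivAt_apply] at this
  refine (mul_eq_zero.mp this).resolve_left ?_
  exact_mod_cast Finset.prod_ne_zero_iff.mpr fun k _ => Nat.factorial_ne_zero _

/-- All derivatives at the origin of a member are multiples of constant terms of members. Identities
known only at `s = 0`, but for a whole family of insertions, thus extend to power series. -/
theorem eq_zero_of_pderiv_closed {ι : Type*} {φ : ι → MvPowerSeries ℕ+ ℂ} {c : ℂ}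
    {f : ℕ+ → ι → ι} (h0 : ∀ i, constantCoeff (φ i) = 0)
    (h : ∀ (a : ℕ+) i, sDeriv ℂ a (φ i) = c • φ (f a i)) (i : ι) : φ i = 0 := by
  refine eq_zero_of_derivAt_eq_zero fun μ => ?_
  induction μ using finsupp_induction_add_single generalizing i with
  | h0 => rw [derivAt_zero, h0]
  | h1 m a ih => rw [derivAt_add_single, h, map_smul, ih, smul_zero]

theorem eq_of_pderiv_closed {ι : Type*} {φ ψ : ι → MvPowerSeries ℕ+ ℂ} {c : ℂ}
    {f : ℕ+ → ι → ι} (h0 : ∀ i, constantCoeff (φ i) = constantCoeff (ψ i))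
    (h : ∀ (a : ℕ+) i, sDeriv ℂ a (φ i) = c • φ (f a i)) (h' : ∀ (a : ℕ+) i, sDeriv ℂ a (ψ i) = c • ψ (f a i))
    (i : ι) : φ i = ψ i := by
  rw [← sub_eq_zero]
  refine eq_zero_of_pderiv_closed (φ := fun i => φ i - ψ i) (c := c) (f := f) (fun i => ?_)
    (fun a i => ?_) i
  · rw [map_sub, h0, sub_self]
  · rw [map_sub, h, h', smul_sub]

theorem prod_factorial_ne_zero (m : ℕ+ →₀ ℕ) : (m.prod fun _ r => (r.factorial : ℂ)) ≠ 0 :=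
  Finset.prod_ne_zero_iff.mpr fun k _ => Nat.cast_ne_zero.mpr (Nat.factorial_ne_zero (m k))

/-- The moments of the Gaussian weight deformed by `exp (ε⁻¹ ∑ s_{2k} x^{2k})`. -/
def deformedMoment (ε : ℝ) (j : ℕ) : MvPowerSeries ℕ+ ℂ := fun m =>
  (m.prod fun _ r => (r.factorial : ℂ))⁻¹ * ((ε : ℂ)⁻¹ ^ m.degree *
    normalizedMoment ε (j + m.sum fun k r => r * (2 * k)))

theorem derivAt_deformedMoment (ε : ℝ) (j : ℕ) (m : ℕ+ →₀ ℕ) :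
    derivAt m (deformedMoment ε j) = (ε : ℂ)⁻¹ ^ m.degree *
      normalizedMoment ε (j + m.sum fun k r => r * (2 * k)) := by
  rw [derivAt_apply]
  change _ * ((m.prod fun _ r => (r.factorial : ℂ))⁻¹ * _) = _
  rw [← mul_assoc]
  have : ((m.prod fun _ r => r.factorial : ℕ) : ℂ) = m.prod fun _ r => (r.factorial : ℂ) := by
    simp [Finsupp.prod]
  rw [this, mul_inv_cancel₀ (prod_factorial_ne_zero m), one_mul]

theorem constantCoeff_deformedMoment (ε : ℝ) (j : ℕ) :
    constantCoeff (deformedMoment ε j) = normalizedMoment ε j := by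
  rw [← derivAt_zero, derivAt_deformedMoment]
  simp

theorem ext_derivAt {φ ψ : MvPowerSeries ℕ+ ℂ} (h : ∀ μ, derivAt μ φ = derivAt μ ψ) : φ = ψ := by
  rw [← sub_eq_zero]
  exact eq_zero_of_derivAt_eq_zero fun μ => by rw [map_sub, h, sub_self]

theorem sDeriv_deformedMoment (ε : ℝ) (j : ℕ) (a : ℕ+) :
    sDeriv ℂ a (deformedMoment ε j) = (ε : ℂ)⁻¹ • deformedMoment ε (j + 2 * a) := by
  refine ext_derivAt fun μ => ?_
  rw [← derivAt_add_single, derivAt_deformedMoment, map_smul, derivAt_deformedMoment, smul_eq_mul,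
    map_add, Finsupp.degree_single, pow_succ', mul_assoc,
    Finsupp.sum_add_index' (by simp) (by intros; ring), Finsupp.sum_single_index (by simp)]
  congr 3
  ring

theorem normalizedMoment_odd {ε : ℝ} (hε : 0 < ε) (k : ℕ) : normalizedMoment ε (2 * k + 1) = 0 := by
  induction k with
  | zero => rw [normalizedMoment_succ hε]; simp
  | succ k ih =>
    rw [normalizedMoment_succ hε, show 2 * (k + 1) - 1 = 2 * k + 1 by omega, ih, smul_zero]

theorem deformedMoment_odd {ε : ℝ} (hε : 0 < ε) (k : ℕ) : deformedMoment ε (2 * k + 1) = 0 := by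
  refine eq_zero_of_derivAt_eq_zero fun m => ?_
  have : 2 * k + 1 + (m.sum fun k r => r * (2 * (k : ℕ))) =
      2 * (k + m.sum fun k r => r * (k : ℕ)) + 1 := by
    rw [Finsupp.sum, Finsupp.sum, mul_add, Finset.mul_sum, add_right_comm]
    congr 2
    exact Finset.sum_congr rfl fun i _ => by ring
  rw [derivAt_deformedMoment, this, normalizedMoment_odd hε, mul_zero]

-- Differentiating the deformed weight brings down a power sum. The case `d = 2` is for eigenvalues,
-- `d = 1` for their squares.
open MvPolynomial in
theorem sDeriv_momentFunctional {μ : ℕ → MvPowerSeries ℕ+ ℂ} {c : ℂ} {d : ℕ} {N : ℕ} {a : ℕ+}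
    (h : ∀ j, sDeriv ℂ a (μ j) = c • μ (j + d * a)) (P : MvPolynomial (Fin N) ℂ) :
    sDeriv ℂ a (momentFunctional (fun _ => μ) P) =
      c • momentFunctional (fun _ => μ) (P * psum (Fin N) ℂ (d * a)) := by
  classical
  induction P using MvPolynomial.induction_on' with
  | add P Q hP hQ => rw [map_add, map_add, hP, hQ, add_mul, map_add, smul_add]
  | monomial κ b =>
    have h1 : ∀ (s : Finset (Fin N)), sDeriv ℂ a (∏ i ∈ s, μ (κ i)) =
        c • ∑ i ∈ s, ∏ l ∈ s, μ ((κ + Finsupp.single i (d * a) : Fin N →₀ ℕ) l) := fun s => by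
      induction s using Finset.induction_on with
      | empty => simp
      | insert i s hi ih =>
        rw [Finset.prod_insert hi, Derivation.leibniz, ih, h, Finset.sum_insert hi,
          Finset.prod_insert hi, smul_eq_mul, smul_eq_mul, smul_add, add_comm]
        congr 1
        · rw [mul_smul_comm, mul_comm]
          congr 2
          · simp
          · exact Finset.prod_congr rfl fun l hl => by
              simp [show l ≠ i from fun e => hi (e ▸ hl)]
        · rw [mul_smul_comm, Finset.mul_sum]
          congr 1
          refine Finset.sum_congr rfl fun l hl => ?_
          rw [Finset.prod_insert hi]
          simp [show i ≠ l from fun e => hi (e ▸ hl)]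
    rw [momentFunctional_monomial, Derivation.map_smul, h1, psum, Finset.mul_sum, map_sum,
      smul_comm, Finset.smul_sum, Finset.smul_sum]
    rw [Finset.smul_sum]
    refine Finset.sum_congr rfl fun i _ => ?_
    rw [X_pow_eq_monomial, monomial_mul, mul_one, momentFunctional_monomial]

open MvPolynomial in
theorem constantCoeff_momentFunctional {σ : Type*} [Fintype σ] (μ : σ → ℕ → MvPowerSeries ℕ+ ℂ)
    (P : MvPolynomial σ ℂ) : MvPowerSeries.constantCoeff (momentFunctional μ P) =
      momentFunctional (fun i k => MvPowerSeries.constantCoeff (μ i k)) P := by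
  induction P using MvPolynomial.induction_on' with
  | add P Q hP hQ => rw [map_add, map_add, map_add, hP, hQ]
  | monomial κ b =>
    rw [momentFunctional_monomial, momentFunctional_monomial, MvPowerSeries.constantCoeff_smul,
      map_prod]

end Deformed

/-! ### Factorization of the partition function -/

section Factorization

open MvPolynomial in
theorem derivAt_momentFunctional_deformedMoment (ε : ℝ) (N : ℕ) (m : ℕ+ →₀ ℕ)
    (P : MvPolynomial (Fin N) ℂ) :
    derivAt m (momentFunctional (fun _ : Fin N => deformedMoment ε) P) =
      (ε : ℂ)⁻¹ ^ m.degree * momentFunctional (fun _ : Fin N => normalizedMoment ε)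
        (P * m.prod fun k r => psum (Fin N) ℂ (2 * (k : ℕ)) ^ r) := by
  induction m using finsupp_induction_add_single generalizing P with
  | h0 =>
    rw [derivAt_zero, constantCoeff_momentFunctional]
    simp [constantCoeff_deformedMoment]
  | h1 m a ih =>
    rw [derivAt_add_single, sDeriv_momentFunctional fun j => sDeriv_deformedMoment ε j a, map_smul,
      ih, map_add, Finsupp.degree_single, pow_succ', smul_eq_mul, mul_assoc,
      Finsupp.prod_add_index' (by simp) (by intros; rw [pow_add]),
      Finsupp.prod_single_index (by simp), pow_one,
      mul_comm (psum (Fin N) ℂ _), ← mul_assoc (ε : ℂ)⁻¹]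

open MvPolynomial in
theorem momentFunctional_deformedMoment_eq {ε : ℝ} (hε : 0 < ε) (N : ℕ) :
    momentFunctional (fun _ : Fin N => deformedMoment ε) (vandermondePoly N ^ 2) =
      momentFunctional (fun _ : Fin N => normalizedMoment ε) (vandermondePoly N ^ 2) •
        evenPartition N ε := by
  have hne := vandermondePoly_sq_moment_ne_zero N hε
  refine ext_derivAt fun m => ?_
  rw [derivAt_momentFunctional_deformedMoment, map_smul, derivAt_apply, coeff_evenPartition hε,
    eigenvalueFunctional_apply, smul_eq_mul]
  have h1 : ((m.prod fun _ r => r.factorial : ℕ) : ℂ) = m.prod fun _ r => (r.factorial : ℂ) := by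
    simp [Finsupp.prod]
  have h2 : (m.prod fun _ r => (r.factorial : ℂ)) ≠ 0 :=
    prod_factorial_ne_zero m
  have h3 : aeval (psum (Fin N) ℂ) (m.prod fun k r => (X (2 * (k : ℕ)) ^ r : MvPolynomial ℕ ℂ)) =
      m.prod fun k r => psum (Fin N) ℂ (2 * (k : ℕ)) ^ r := by
    simp [Finsupp.prod]
  rw [h1, h3, mul_comm (vandermondePoly N ^ 2)]
  field_simp

/-- The parity shift of the factor with index `k`. -/
def parityShift (k : ℕ) : ℕ := (k + 1) % 2

/-- The moments of the `k`-th Laguerre factor. -/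
def laguerreMoment (ε : ℝ) (k j : ℕ) : MvPowerSeries ℕ+ ℂ :=
  deformedMoment ε (2 * j + 2 * parityShift k)

/-- The `k`-th factor, which is the modified partition function at `t = (k + 1/2) ε`. -/
def laguerreTau (ε : ℝ) (k : ℕ) : MvPowerSeries ℕ+ ℂ :=
  (hankel (laguerreMoment ε k) ((k + 1) / 2)).det

/-- The block of even indices has size `⌈N/2⌉` and unshifted weight, the block of odd indices has
size `⌊N/2⌋` and weight multiplied by `x²`. For odd `N` they are the factors `N` and `N - 1`, for
even `N` the factors `N - 1` and `N`. -/
theorem det_hankel_deformedMoment {ε : ℝ} (hε : 0 < ε) {N : ℕ} (hN : 1 ≤ N) :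
    (hankel (deformedMoment ε) N).det = laguerreTau ε N * laguerreTau ε (N - 1) := by
  rw [det_hankel_of_odd_eq_zero (deformedMoment_odd hε)]
  have key : ∀ a b n n' : ℕ, a = b → n = n' →
      (hankel (fun j => deformedMoment ε (2 * j + a)) n).det =
        (hankel (fun j => deformedMoment ε (2 * j + b)) n').det := by
    rintro a _ n _ rfl rfl; rfl
  change (hankel (fun j => deformedMoment ε (2 * j + 0)) _).det * _ =
    (hankel (fun j => deformedMoment ε (2 * j + 2 * ((N + 1) % 2))) _).det *
      (hankel (fun j => deformedMoment ε (2 * j + 2 * ((N - 1 + 1) % 2))) _).det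
  rcases Nat.even_or_odd' N with ⟨n, rfl | rfl⟩
  · rw [mul_comm]
    congr 1 <;> exact key _ _ _ _ (by omega) (by omega)
  · congr 1 <;> exact key _ _ _ _ (by omega) (by omega)

-- At `s = 0` this is a factor of the Gaussian Hankel determinant of size `k + 1`, which does not
-- vanish.
open MvPowerSeries in
theorem constantCoeff_laguerreTau_ne_zero {ε : ℝ} (hε : 0 < ε) (k : ℕ) :
    constantCoeff (laguerreTau ε k) ≠ 0 := by
  have h := momentFunctional_vandermondePoly_sq (deformedMoment ε) (k + 1)
  rw [det_hankel_deformedMoment hε (by omega)] at h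
  have h' := congrArg constantCoeff h
  rw [constantCoeff_momentFunctional, MvPowerSeries.constantCoeff_smul, map_mul] at h'
  simp only [constantCoeff_deformedMoment] at h'
  intro h0
  rw [Nat.add_sub_cancel, h0, mul_zero, smul_zero] at h'
  exact vandermondePoly_sq_moment_ne_zero (k + 1) hε h'

/-- The modified partition function at `t = (k + 1/2) ε`, normalized by its value at `s = 0`. -/
def modifiedPartition (ε : ℝ) (k : ℕ) : MvPowerSeries ℕ+ ℂ :=
  (MvPowerSeries.constantCoeff (laguerreTau ε k))⁻¹ • laguerreTau ε k

open MvPowerSeries in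
theorem constantCoeff_modifiedPartition {ε : ℝ} (hε : 0 < ε) (k : ℕ) :
    constantCoeff (modifiedPartition ε k) = 1 := by
  rw [modifiedPartition, MvPowerSeries.constantCoeff_smul, smul_eq_mul,
    inv_mul_cancel₀ (constantCoeff_laguerreTau_ne_zero hε k)]

open MvPowerSeries in
theorem evenPartition_eq {ε : ℝ} (hε : 0 < ε) {N : ℕ} (hN : 1 ≤ N) :
    evenPartition N ε = modifiedPartition ε N * modifiedPartition ε (N - 1) := by
  have h1 := momentFunctional_deformedMoment_eq hε N
  rw [momentFunctional_vandermondePoly_sq, det_hankel_deformedMoment hε hN] at h1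
  have hne := vandermondePoly_sq_moment_ne_zero N hε
  have hc : constantCoeff (evenPartition N ε) = 1 := by
    rw [← coeff_zero_eq_constantCoeff_apply, coeff_evenPartition hε, eigenvalueFunctional_apply]
    simp [hne]
  have h2 := congrArg constantCoeff h1
  rw [MvPowerSeries.constantCoeff_smul, MvPowerSeries.constantCoeff_smul, hc, map_mul,
    smul_eq_mul, smul_eq_mul, mul_one] at h2
  have h3 : evenPartition N ε = (momentFunctional (fun _ : Fin N => normalizedMoment ε)
      (vandermondePoly N ^ 2))⁻¹ • ((N.factorial : ℂ) • (laguerreTau ε N * laguerreTau ε (N - 1))) := by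
    rw [h1, smul_smul, inv_mul_cancel₀ hne, one_smul]
  rw [h3, ← h2, modifiedPartition, modifiedPartition, smul_mul_smul_comm, smul_smul]
  congr 1
  have := constantCoeff_laguerreTau_ne_zero hε N
  have := constantCoeff_laguerreTau_ne_zero hε (N - 1)
  have : (N.factorial : ℂ) ≠ 0 := by exact_mod_cast N.factorial_ne_zero
  field_simp

end Factorization
end ModifiedGUE
end

noncomputable section
namespace ModifiedGUE
open Finset

/-! ### Virasoro constraints -/

section Virasoro

theorem sDeriv_laguerreMoment (ε : ℝ) (k j : ℕ) (a : ℕ+) :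
    sDeriv ℂ a (laguerreMoment ε k j) = (ε : ℂ)⁻¹ • laguerreMoment ε k (j + 1 * a) := by
  rw [laguerreMoment, sDeriv_deformedMoment, laguerreMoment]
  congr 2
  ring

-- The substitution `x = λ²` turns the Gaussian weight into `x^α exp(-x/(2ε))` with `α = parityShift
-- k - 1/2`; on moments this is one step of the Gaussian recursion.
open MvPowerSeries in
theorem constantCoeff_laguerreMoment_succ {ε : ℝ} (hε : 0 < ε) (k j : ℕ) :
    constantCoeff (laguerreMoment ε k (j + 1)) =
      ((ε : ℂ) * ((2 * ((parityShift k : ℂ) - 1 / 2) + 2) + 2 * j)) •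
        constantCoeff (laguerreMoment ε k j) := by
  rw [laguerreMoment, laguerreMoment, constantCoeff_deformedMoment, constantCoeff_deformedMoment,
    show 2 * (j + 1) + 2 * parityShift k = (2 * j + 2 * parityShift k + 1) + 1 by ring,
    normalizedMoment_succ hε, Nat.add_sub_cancel]
  congr 2
  push_cast
  ring

@[simp] theorem constantCoeff_shiftOp (m : ℕ) (φ : MvPowerSeries ℕ+ ℂ) :
    MvPowerSeries.constantCoeff (shiftOp m φ) = 0 := by
  rw [← MvPowerSeries.coeff_zero_eq_constantCoeff_apply, coeff_shiftOp]
  simp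

theorem powerSumDeriv_mul_X (m : ℕ) (Q : MvPolynomial ℕ ℂ) (a : ℕ) :
    powerSumDeriv (m + 1) (Q * MvPolynomial.X a) = powerSumDeriv (m + 1) Q * MvPolynomial.X a +
      (a : ℂ) • (Q * MvPolynomial.X (a + m)) := by
  rw [Derivation.leibniz, powerSumDeriv, MvPolynomial.mkDerivation_X, smul_eq_mul, smul_eq_mul,
    mul_smul_comm, add_comm, mul_comm (MvPolynomial.X a)]
  rfl

/-- The value of a product of power sums in the `k`-th Laguerre ensemble. -/
def laguerreValue (ε : ℝ) (k : ℕ) : MvPolynomial ℕ ℂ →ₗ[ℂ] MvPowerSeries ℕ+ ℂ where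
  toFun Q := momentFunctional (fun _ : Fin ((k + 1) / 2) => laguerreMoment ε k)
    (MvPolynomial.aeval (MvPolynomial.psum (Fin ((k + 1) / 2)) ℂ) Q *
      vandermondePoly ((k + 1) / 2) ^ 2)
  map_add' P Q := by rw [map_add, add_mul, map_add]
  map_smul' c P := by rw [map_smul, smul_mul_assoc, map_smul]; rfl

theorem laguerreValue_apply (ε : ℝ) (k : ℕ) (Q : MvPolynomial ℕ ℂ) :
    laguerreValue ε k Q = momentFunctional (fun _ : Fin ((k + 1) / 2) => laguerreMoment ε k)
      (MvPolynomial.aeval (MvPolynomial.psum (Fin ((k + 1) / 2)) ℂ) Q *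
        vandermondePoly ((k + 1) / 2) ^ 2) := rfl

theorem sDeriv_laguerreValue (ε : ℝ) (k : ℕ) (a : ℕ+) (Q : MvPolynomial ℕ ℂ) :
    sDeriv ℂ a (laguerreValue ε k Q) = (ε : ℂ)⁻¹ • laguerreValue ε k (Q * MvPolynomial.X (a : ℕ)) := by
  rw [laguerreValue_apply, laguerreValue_apply,
    sDeriv_momentFunctional fun j => sDeriv_laguerreMoment ε k j a, map_mul (MvPolynomial.aeval _),
    MvPolynomial.aeval_X, one_mul, mul_right_comm]

theorem sDeriv_laguerreValue_of_pos (ε : ℝ) (k a : ℕ) (ha : 0 < a) (Q : MvPolynomial ℕ ℂ) :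
    sDeriv ℂ a (laguerreValue ε k Q) = (ε : ℂ)⁻¹ • laguerreValue ε k (Q * MvPolynomial.X a) := by
  lift a to ℕ+ using ha
  exact sDeriv_laguerreValue ε k a Q

-- At `s = 0` this is `gamma_loop_equation`. Both sides have the derivation rule `Q ↦ Q X_a`, since
-- the commutator of `∂/∂s_{2a}` with `shiftOp` supplies the joining term `a X_(a+m)`; hence the
-- identity holds as power series by `eq_of_pderiv_closed`.
open MvPolynomial in
theorem laguerreValue_loop {ε : ℝ} (hε : 0 < ε) (k m : ℕ) (Q : MvPolynomial ℕ ℂ) :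
    (2 * (ε : ℂ))⁻¹ • laguerreValue ε k (X (m + 1) * Q) =
      laguerreValue ε k (∑ a ∈ range (m + 1), X a * X (m - a) * Q +
        ((parityShift k : ℂ) - 1 / 2) • (X m * Q) + powerSumDeriv (m + 1) Q) +
      shiftOp m (laguerreValue ε k Q) := by
  have hε' : (2 * (ε : ℂ)) ≠ 0 := mul_ne_zero two_ne_zero (by exact_mod_cast hε.ne')
  refine eq_of_pderiv_closed (c := (ε : ℂ)⁻¹) (f := fun a Q => Q * X (a : ℕ))
    (φ := fun Q => (2 * (ε : ℂ))⁻¹ • laguerreValue ε k (X (m + 1) * Q))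
    (ψ := fun Q => laguerreValue ε k (∑ a ∈ range (m + 1), X a * X (m - a) * Q +
        ((parityShift k : ℂ) - 1 / 2) • (X m * Q) + powerSumDeriv (m + 1) Q) +
      shiftOp m (laguerreValue ε k Q)) (fun Q => ?_) (fun a Q => ?_) (fun a Q => ?_) Q
  · rw [MvPowerSeries.constantCoeff_smul, map_add, constantCoeff_shiftOp, add_zero,
      laguerreValue_apply, laguerreValue_apply, constantCoeff_momentFunctional,
      constantCoeff_momentFunctional, map_mul (aeval _), aeval_X,
      gamma_loop_equation (μ := fun j => MvPowerSeries.constantCoeff (laguerreMoment ε k j))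
        (constantCoeff_laguerreMoment_succ hε k), smul_smul, inv_mul_cancel₀ hε', one_smul,
      eulerField_aeval_psum]
    simp only [map_add, map_sum, map_mul, aeval_X, map_smul]
  · rw [Derivation.map_smul, sDeriv_laguerreValue, smul_comm, mul_assoc]
  · rw [map_add, sDeriv_laguerreValue, sDeriv_shiftOp, sDeriv_laguerreValue, shiftOp_smul,
      ← Nat.cast_smul_eq_nsmul ℂ,
      sDeriv_laguerreValue_of_pos ε k ((a : ℕ) + m) (by positivity), smul_comm _ ((ε : ℂ)⁻¹), ← smul_add, ← smul_add, add_mul,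
      add_mul, powerSumDeriv_mul_X, Finset.sum_mul, smul_mul_assoc]
    refine congrArg ((ε : ℂ)⁻¹ • ·) ?_
    rw [show ∑ b ∈ range (m + 1), X b * X (m - b) * (Q * X (a : ℕ)) +
        ((parityShift k : ℂ) - 1 / 2) • (X m * (Q * X (a : ℕ))) +
        (powerSumDeriv (m + 1) Q * X (a : ℕ) + (a : ℂ) • (Q * X ((a : ℕ) + m))) =
        ∑ b ∈ range (m + 1), X b * X (m - b) * Q * X (a : ℕ) +
        ((parityShift k : ℂ) - 1 / 2) • (X m * Q * X (a : ℕ)) +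
        powerSumDeriv (m + 1) Q * X (a : ℕ) + (a : ℂ) • (Q * X ((a : ℕ) + m)) by
      simp only [mul_assoc, add_assoc], map_add _ _ ((a : ℂ) • _), map_smul]
    rw [add_comm (shiftOp m _)]
    simp only [add_assoc]

/-- The linear Virasoro constraints. -/
theorem virasoro_laguerreValue {ε : ℝ} (hε : 0 < ε) (k m : ℕ) :
    (1 / 2 : ℂ) • sDeriv ℂ (m + 1) (laguerreValue ε k 1) =
      (ε : ℂ) ^ 2 • ∑ p ∈ antidiagonal m, sDeriv ℂ p.1 (sDeriv ℂ p.2 (laguerreValue ε k 1)) +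
      ((k + 1 / 2 : ℂ) * ε) • sDeriv ℂ m (laguerreValue ε k 1) + shiftOp m (laguerreValue ε k 1) +
      (if m = 0 then ((k + 1 / 2 : ℂ) ^ 2 / 4 - 1 / 16) else 0) • laguerreValue ε k 1 := by
  have hε' : (ε : ℂ) ≠ 0 := by exact_mod_cast hε.ne'
  set T := laguerreValue ε k 1 with hT
  set n : ℂ := (((k + 1) / 2 : ℕ) : ℂ) with hn
  -- The size `n` and the exponent `α` of the weight combine into a quantity that no longer sees the
  -- parity of `k`; this is why `t = (k + 1/2) ε`.
  have hk : 2 * n + ((parityShift k : ℂ) - 1 / 2) = k + 1 / 2 := by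
    have h1 : 2 * ((k + 1) / 2) + parityShift k = k + 1 := by unfold parityShift; omega
    have h2 : 2 * n + (parityShift k : ℂ) = k + 1 := by rw [hn]; exact_mod_cast h1
    linear_combination h2
  -- The exponents `±1/2` have equal squares, so `n² + α n = ((2n + α)² - α²)/4` is also independent
  -- of the parity.
  have hs : ((parityShift k : ℂ) - 1 / 2) ^ 2 = 1 / 4 := by
    have : parityShift k = 0 ∨ parityShift k = 1 := by unfold parityShift; omega
    rcases this with h | h <;> rw [h] <;> norm_num
  have hX0 : ∀ Q, laguerreValue ε k (MvPolynomial.X 0 * Q) = n • laguerreValue ε k Q := fun Q => by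
    rw [laguerreValue_apply, laguerreValue_apply, map_mul (MvPolynomial.aeval _),
      MvPolynomial.aeval_X, show MvPolynomial.psum (Fin ((k + 1) / 2)) ℂ 0 = MvPolynomial.C n by
        simp [MvPolynomial.psum, hn], mul_assoc, ← MvPolynomial.smul_eq_C_mul, map_smul]
  have hX1 : ∀ (a : ℕ) Q, 0 < a →
      laguerreValue ε k (MvPolynomial.X a * Q) = (ε : ℂ) • sDeriv ℂ a (laguerreValue ε k Q) :=
    fun a Q ha => by
      lift a to ℕ+ using ha
      rw [sDeriv_laguerreValue, smul_smul, mul_inv_cancel₀ hε', one_smul, mul_comm]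
  have h := laguerreValue_loop hε k m 1
  rw [mul_one, ← mul_one (MvPolynomial.X (m + 1)), hX1 _ _ (Nat.succ_pos m), smul_smul,
    show (2 * (ε : ℂ))⁻¹ * ε = 1 / 2 by field_simp, ← hT] at h
  rw [h, powerSumDeriv, Derivation.map_one_eq_zero, add_zero, ← Finset.Nat.sum_antidiagonal_eq_sum_range_succ (fun a b =>
    (MvPolynomial.X a * MvPolynomial.X b * 1 : MvPolynomial ℕ ℂ)), map_add, map_sum, map_smul]
  rcases Nat.eq_zero_or_pos m with rfl | hm
  · have hn2 : n * n + ((parityShift k : ℂ) - 1 / 2) * n = (k + 1 / 2 : ℂ) ^ 2 / 4 - 1 / 16 := by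
      linear_combination (1 / 4) * (2 * n + ((parityShift k : ℂ) - 1 / 2) + (k + 1 / 2)) * hk -
        (1 / 4) * hs
    rw [Finset.Nat.antidiagonal_zero, sum_singleton, sum_singleton, mul_assoc, hX0, hX0, ← hT,
      sDeriv_zero, if_pos rfl, ← hn2, add_smul, mul_smul n n, mul_smul (_ - _) n]
    simp only [Derivation.coe_zero, Pi.zero_apply, smul_zero, zero_add]
    rw [add_comm]
  · rw [if_neg hm.ne', zero_smul, add_zero, hX1 _ _ hm, ← hT]
    congr 1
    -- At both ends of the antidiagonal one factor is `p_0`, the number `n`. These terms, which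
    -- `sDeriv` at index `0` suppresses, join the term in `α` to give the coefficient `(k + 1/2) ε`.
    have key : ∀ p ∈ antidiagonal m, laguerreValue ε k (MvPolynomial.X p.1 * MvPolynomial.X p.2 * 1) =
        (ε : ℂ) ^ 2 • sDeriv ℂ p.1 (sDeriv ℂ p.2 T) +
          ((if p = (0, m) then (n * ε) • sDeriv ℂ m T else 0) +
            if p = (m, 0) then (n * ε) • sDeriv ℂ m T else 0) := by
      rintro ⟨a, b⟩ hp
      have hab : a + b = m := mem_antidiagonal.mp hp
      simp only [mul_assoc]
      rcases Nat.eq_zero_or_pos a with rfl | ha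
      · obtain rfl : b = m := by omega
        rw [hX0, hX1 _ _ hm, if_pos rfl, if_neg (by simp; omega)]
        simp only [sDeriv_zero, Derivation.coe_zero, Pi.zero_apply, smul_zero, zero_add, add_zero, ← hT]
        exact (mul_smul _ _ _).symm
      · rcases Nat.eq_zero_or_pos b with rfl | hb
        · obtain rfl : a = m := by omega
          rw [hX1 _ _ ha, hX0, if_neg (by simp; omega), if_pos rfl]
          simp only [sDeriv_zero, Derivation.coe_zero, Pi.zero_apply, map_zero, smul_zero, zero_add, ← hT,
            Derivation.map_smul]
          rw [mul_comm n]
          exact (mul_smul _ _ _).symm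
        · rw [hX1 _ _ ha, hX1 _ _ hb, if_neg (by simp; omega), if_neg (by simp; omega)]
          rw [add_zero, add_zero, ← hT, Derivation.map_smul, sq]
          exact (mul_smul _ _ _).symm
    rw [Finset.sum_congr rfl key, Finset.sum_add_distrib, Finset.sum_add_distrib,
      Finset.sum_ite_eq' , Finset.sum_ite_eq', if_pos (by simp), if_pos (by simp),
      ← Finset.smul_sum, add_assoc, smul_smul, ← add_smul, ← add_smul]
    congr 2
    linear_combination (ε : ℂ) * hk

theorem laguerreValue_one (ε : ℝ) (k : ℕ) :
    laguerreValue ε k 1 = ((((k + 1) / 2).factorial : ℕ) : ℂ) • laguerreTau ε k := by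
  rw [laguerreValue_apply, map_one (MvPolynomial.aeval _), one_mul,
    momentFunctional_vandermondePoly_sq]
  rfl

/-- The modified free energy at `t = (k + 1/2) ε`. -/
def modifiedLog (ε : ℝ) (k : ℕ) : MvPowerSeries ℕ+ ℂ := logSeries (modifiedPartition ε k)

/-- The linear constraint divided by the partition function: a second derivative of `Z` contributes
a second derivative of `log Z` and a product of first ones. -/
theorem virasoro_modifiedLog {ε : ℝ} (hε : 0 < ε) (k m : ℕ) :
    (1 / 2 : ℂ) • sDeriv ℂ (m + 1) (modifiedLog ε k) =
      (ε : ℂ) ^ 2 • ∑ p ∈ antidiagonal m, (sDeriv ℂ p.1 (sDeriv ℂ p.2 (modifiedLog ε k)) +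
        sDeriv ℂ p.1 (modifiedLog ε k) * sDeriv ℂ p.2 (modifiedLog ε k)) +
      ((k + 1 / 2 : ℂ) * ε) • sDeriv ℂ m (modifiedLog ε k) + shiftOp m (modifiedLog ε k) +
      MvPowerSeries.C (if m = 0 then ((k + 1 / 2 : ℂ) ^ 2 / 4 - 1 / 16) else 0) := by
  set Z := modifiedPartition ε k with hZ
  set H := modifiedLog ε k with hH
  have hc : MvPowerSeries.constantCoeff Z = 1 := constantCoeff_modifiedPartition hε k
  have hZ0 : Z ≠ 0 := fun h => by rw [h] at hc; simp at hc
  obtain ⟨c, hc0, hcT⟩ : ∃ c : ℂ, c ≠ 0 ∧ laguerreValue ε k 1 = c • Z := by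
    have h1 : ((((k + 1) / 2).factorial : ℕ) : ℂ) ≠ 0 := by exact_mod_cast Nat.factorial_ne_zero _
    have h2 := constantCoeff_laguerreTau_ne_zero hε k
    refine ⟨_, mul_ne_zero h1 h2, ?_⟩
    rw [laguerreValue_one, hZ, modifiedPartition, smul_smul, mul_assoc, mul_inv_cancel₀ h2, mul_one]
  have h1 : ∀ a, sDeriv ℂ a Z = Z * sDeriv ℂ a H := fun a => (mul_sDeriv_logSeries hc a).symm
  have h2 : ∀ a b, sDeriv ℂ a (sDeriv ℂ b Z) =
      Z * (sDeriv ℂ a (sDeriv ℂ b H) + sDeriv ℂ a H * sDeriv ℂ b H) := fun a b => by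
    rw [h1 b, Derivation.leibniz, h1 a, smul_eq_mul, smul_eq_mul]
    ring
  have h3 : shiftOp m Z = Z * shiftOp m H := (mul_shiftOp_logSeries hc m).symm
  have h4 := virasoro_laguerreValue hε k m
  simp only [hcT, Derivation.map_smul, shiftOp_smul, smul_comm _ c, ← Finset.smul_sum, ← smul_add]
    at h4
  have h5 := smul_right_injective _ hc0 h4
  simp only [h2] at h5
  simp only [h1, h3, ← Finset.mul_sum, ← mul_smul_comm] at h5
  refine mul_left_cancel₀ hZ0 ?_
  rw [h5, mul_add, mul_add, mul_add]
  congr 1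
  rw [MvPowerSeries.smul_eq_C_mul, mul_comm]

/-- The indices `N` and `N - 1` stand for `t = N ε ± ε/2`, so this is the defining shift equation of
the modified free energy. -/
theorem logEvenPartition_eq {ε : ℝ} (hε : 0 < ε) {N : ℕ} (hN : 1 ≤ N) :
    logEvenPartition N ε = modifiedLog ε N + modifiedLog ε (N - 1) := by
  rw [modifiedLog, modifiedLog, ← logSeries_mul (constantCoeff_modifiedPartition hε N)
    (constantCoeff_modifiedPartition hε (N - 1)), ← evenPartition_eq hε hN]
  rfl

end Virasoro
end ModifiedGUE
end

noncomputable section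
namespace ModifiedGUE
open Finset

/-! ### The universal free energy -/

section Universal

variable {A B : Type*} [CommRing A] [CommRing B]

theorem map_sDeriv (f : A →+* B) (k : ℕ) (φ : MvPowerSeries ℕ+ A) :
    MvPowerSeries.map f (sDeriv A k φ) = sDeriv B k (MvPowerSeries.map f φ) := by
  rcases Nat.eq_zero_or_pos k with rfl | hk
  · simp
  · lift k to ℕ+ using hk
    rw [sDeriv_pnat, sDeriv_pnat]
    ext m
    simp [MvPowerSeries.coeff_pderiv]

theorem map_shiftOp (f : A →+* B) (m : ℕ) (φ : MvPowerSeries ℕ+ A) :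
    MvPowerSeries.map f (shiftOp m φ) = shiftOp m (MvPowerSeries.map f φ) := by
  ext μ
  rw [MvPowerSeries.coeff_map, coeff_shiftOp, coeff_shiftOp, map_sum]
  refine sum_congr rfl fun k _ => ?_
  rw [map_mul, map_natCast, ← MvPowerSeries.coeff_map, map_sDeriv]

variable [Algebra ℂ A] [Algebra ℂ B]

/-- The difference of the two sides of the `m`-th Virasoro constraint. -/
def virasoroDefect (e t : A) (φ : MvPowerSeries ℕ+ A) (m : ℕ) : MvPowerSeries ℕ+ A :=
  sDeriv A (m + 1) φ - 2 * (MvPowerSeries.C e *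
      ∑ p ∈ antidiagonal m, sDeriv A p.1 (sDeriv A p.2 φ) +
    ∑ p ∈ antidiagonal m, sDeriv A p.1 φ * sDeriv A p.2 φ +
    MvPowerSeries.C t * sDeriv A m φ + shiftOp m φ +
    MvPowerSeries.C (if m = 0 then algebraMap ℂ A (1 / 4) * t ^ 2 - algebraMap ℂ A (1 / 16) * e
      else 0))

theorem map_virasoroDefect (f : A →ₐ[ℂ] B) (e t : A) (φ : MvPowerSeries ℕ+ A) (m : ℕ) :
    MvPowerSeries.map (f : A →+* B) (virasoroDefect e t φ m) =
      virasoroDefect (f e) (f t) (MvPowerSeries.map (f : A →+* B) φ) m := by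
  simp only [virasoroDefect, map_sub, map_add, map_mul, map_sum, map_sDeriv, map_shiftOp,
    MvPowerSeries.map_C, map_ofNat]
  congr 4
  split_ifs <;> simp

/-- The degree of a monomial in the couplings, where `s_{2k}` has degree `k`. -/
def couplingDegree : (ℕ+ →₀ ℕ) →+ ℕ := Finsupp.weight fun k : ℕ+ => (k : ℕ)

theorem couplingDegree_single (k : ℕ+) : couplingDegree (Finsupp.single k 1) = k := by
  simp [couplingDegree, Finsupp.weight_single]

theorem coeff_sDeriv_pnat (k : ℕ+) (μ : ℕ+ →₀ ℕ) (φ : MvPowerSeries ℕ+ A) :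
    MvPowerSeries.coeff μ (sDeriv A k φ) =
      ((μ k : ℂ) + 1) • MvPowerSeries.coeff (μ + Finsupp.single k 1) φ := by
  rw [sDeriv_pnat, MvPowerSeries.coeff_pderiv, Algebra.smul_def, map_add, map_one, map_natCast,
    mul_comm]

/-- The Virasoro constraints determine all coefficients recursively. -/
theorem coeff_mem_of_virasoroDefect_eq_zero {S : Subalgebra ℂ A} {e t : A} (he : e ∈ S)
    (ht : t ∈ S) {φ : MvPowerSeries ℕ+ A} (hφ : ∀ m, virasoroDefect e t φ m = 0) (n : ℕ) :
    ∀ μ, μ ≠ 0 → couplingDegree μ ≤ n → MvPowerSeries.coeff μ φ ∈ S := by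
  induction n with
  | zero =>
    intro μ hμ h
    obtain ⟨k, hk⟩ := Finsupp.ne_iff.mp hμ
    have h1 : Finsupp.single k 1 ≤ μ := by
      rw [Finsupp.single_le_iff]; exact Nat.one_le_iff_ne_zero.mpr hk
    obtain ⟨ν, rfl⟩ := exists_add_of_le h1
    rw [map_add, couplingDegree_single] at h
    have := k.pos
    omega
  | succ n ih =>
    intro μ hμ h
    obtain ⟨k, hk⟩ := Finsupp.ne_iff.mp hμ
    have h1 : Finsupp.single k 1 ≤ μ := by
      rw [Finsupp.single_le_iff]; exact Nat.one_le_iff_ne_zero.mpr hk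
    obtain ⟨ν, rfl⟩ := exists_add_of_le h1
    rw [map_add, couplingDegree_single] at h
    -- The constraint with index `k - 1` is used at the monomial `ν`. Its right side involves total
    -- degree at most `deg ν + k - 1`, one less than the degree of `μ`.
    have hD : ∀ (a : ℕ) κ, couplingDegree κ + a ≤ n → MvPowerSeries.coeff κ (sDeriv A a φ) ∈ S := by
      intro a κ hκ
      rcases Nat.eq_zero_or_pos a with rfl | ha
      · simp
      lift a to ℕ+ using ha
      rw [coeff_sDeriv_pnat]
      refine S.smul_mem (ih _ (fun h0 => ?_) ?_) _
      · have := DFunLike.congr_fun h0 a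
        simp at this
      · rwa [map_add, couplingDegree_single]
    obtain ⟨j, hj⟩ : ∃ j, (k : ℕ) = j + 1 := ⟨k - 1, (Nat.sub_add_cancel k.pos).symm⟩
    have h2 : MvPowerSeries.coeff ν (sDeriv A (j + 1) φ) ∈ S := by
      rw [sub_eq_zero.mp (hφ j), two_mul, map_add]
      suffices hs : MvPowerSeries.coeff ν (MvPowerSeries.C e *
          ∑ p ∈ antidiagonal j, sDeriv A p.1 (sDeriv A p.2 φ) +
          ∑ p ∈ antidiagonal j, sDeriv A p.1 φ * sDeriv A p.2 φ +
          MvPowerSeries.C t * sDeriv A j φ + shiftOp j φ +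
          MvPowerSeries.C (if j = 0 then algebraMap ℂ A (1 / 4) * t ^ 2 -
            algebraMap ℂ A (1 / 16) * e else 0)) ∈ S from S.add_mem hs hs
      simp only [map_add, map_sum, MvPowerSeries.coeff_C_mul]
      refine S.add_mem (S.add_mem (S.add_mem (S.add_mem (S.mul_mem he (S.sum_mem fun p hp => ?_))
        (S.sum_mem fun p hp => ?_)) (S.mul_mem ht (hD _ _ (by omega)))) ?_) ?_
      · have hpj := mem_antidiagonal.mp hp
        rcases Nat.eq_zero_or_pos p.1 with h0 | h0
        · rw [h0]; simp
        obtain ⟨a, ha⟩ : ∃ a : ℕ+, (a : ℕ) = p.1 := ⟨⟨p.1, h0⟩, rfl⟩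
        rw [← ha, coeff_sDeriv_pnat]
        refine S.smul_mem (hD _ _ ?_) _
        rw [map_add, couplingDegree_single]
        omega
      · have hpj := mem_antidiagonal.mp hp
        rw [MvPowerSeries.coeff_mul]
        refine S.sum_mem fun q hq => ?_
        have hq' := congrArg couplingDegree (mem_antidiagonal.mp hq)
        rw [map_add] at hq'
        exact S.mul_mem (hD _ _ (by omega)) (hD _ _ (by omega))
      · rw [coeff_shiftOp]
        refine S.sum_mem fun u hu => S.mul_mem (natCast_mem S _) (hD _ _ ?_)
        have h3 : Finsupp.single u 1 ≤ ν := by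
          rw [Finsupp.single_le_iff]
          exact Nat.one_le_iff_ne_zero.mpr (Finsupp.mem_support_iff.mp hu)
        obtain ⟨κ, rfl⟩ := exists_add_of_le h3
        rw [map_add, couplingDegree_single] at h
        rw [add_tsub_cancel_left]
        omega
      · classical
        rw [MvPowerSeries.coeff_C]
        split_ifs
        · exact S.sub_mem (S.mul_mem (S.algebraMap_mem _) (S.pow_mem ht 2))
            (S.mul_mem (S.algebraMap_mem _) he)
        all_goals exact S.zero_mem
    rw [← hj, coeff_sDeriv_pnat, add_comm ν] at h2
    have h3 := S.smul_mem h2 ((ν k : ℂ) + 1)⁻¹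
    rwa [smul_smul, inv_mul_cancel₀ (Nat.cast_add_one_ne_zero _), one_smul] at h3

open Polynomial in
/-- Evaluation of a polynomial in `t` and `e` at `t = (k + 1/2) ε`, `e = ε²`, for all `k`, `ε`. -/
def genusEval : ℂ[X][X] →ₐ[ℂ] (ℕ × Set.Ioi (0 : ℝ) → ℂ) :=
  AlgHom.pi fun d => (aeval (((d.2 : ℝ) : ℂ) ^ 2)).comp
    ((mapAlgHom (aeval (((d.1 : ℂ) + 1 / 2) * (d.2 : ℝ)))).restrictScalars ℂ)

open Polynomial in
theorem genusEval_apply (p : ℂ[X][X]) (k : ℕ) (ε : Set.Ioi (0 : ℝ)) :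
    genusEval p (k, ε) =
      (p.map (evalRingHom (((k : ℂ) + 1 / 2) * (ε : ℝ)))).eval (((ε : ℝ) : ℂ) ^ 2) := by
  rw [← coe_aeval_eq_evalRingHom, ← coe_aeval_eq_eval]
  rfl

-- For fixed `t > 0` the choices `ε = t/(k + 1/2)` give infinitely many values of `e = ε²` at the
-- same `t`. So the polynomial in `e` vanishes, and then each coefficient has infinitely many zeros
-- `t`.
open Polynomial in
theorem genusEval_injective : Function.Injective genusEval := by
  refine (injective_iff_map_eq_zero _).mpr fun p hp => ?_
  have h1 : ∀ t : ℝ, 0 < t → p.map (evalRingHom (t : ℂ)) = 0 := fun t ht => by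
    refine Polynomial.eq_zero_of_infinite_isRoot _ (Set.Infinite.mono (s := Set.range
      fun k : ℕ => (((t / (k + 1 / 2) : ℝ)) : ℂ) ^ 2) ?_ (Set.infinite_range_of_injective ?_))
    · rintro _ ⟨k, rfl⟩
      have hk : (0 : ℝ) < k + 1 / 2 := by positivity
      have h2 := congrFun hp (k, ⟨t / (k + 1 / 2), div_pos ht hk⟩)
      rw [genusEval_apply] at h2
      have h3 : ((k : ℂ) + 1 / 2) * ((t / (k + 1 / 2) : ℝ) : ℂ) = t := by
        have : ((k : ℂ) + 1 / 2) ≠ 0 := by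
          have := Complex.ofReal_ne_zero.mpr hk.ne'
          push_cast at this
          exact this
        push_cast
        rw [mul_div_cancel₀ _ this]
      simp only [h3] at h2
      exact h2
    · intro a b hab
      have hab' : (t / (a + 1 / 2)) ^ 2 = (t / (b + 1 / 2)) ^ 2 := Complex.ofReal_injective (by
        simpa only [Complex.ofReal_pow] using hab)
      have h4 := (pow_left_inj₀ (by positivity) (by positivity) two_ne_zero).mp hab'
      rw [div_eq_div_iff (by positivity) (by positivity)] at h4
      have h5 := mul_left_cancel₀ ht.ne' h4
      exact_mod_cast (add_right_cancel h5).symm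
  ext g : 1
  refine Polynomial.eq_zero_of_infinite_isRoot _ (Set.Infinite.mono (s := Set.range
      fun k : ℕ => ((k + 1 : ℝ) : ℂ)) ?_ (Set.infinite_range_of_injective ?_))
  · rintro _ ⟨k, rfl⟩
    have h2 := congrArg (fun q => coeff q g) (h1 (k + 1) (by positivity))
    simp only [coeff_map, coeff_zero] at h2
    exact h2
  · intro a b hab
    have : ((a : ℝ) + 1) = b + 1 := Complex.ofReal_injective hab
    exact_mod_cast add_right_cancel this

/-- The family of the rescaled free energies `ε² log Z̃`, over all `k` and `ε`. -/
def scaledLog : MvPowerSeries ℕ+ (ℕ × Set.Ioi (0 : ℝ) → ℂ) := fun μ d =>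
  ((d.2 : ℝ) : ℂ) ^ 2 * MvPowerSeries.coeff μ (modifiedLog d.2 d.1)

theorem coeff_scaledLog (μ : ℕ+ →₀ ℕ) (k : ℕ) (ε : Set.Ioi (0 : ℝ)) :
    MvPowerSeries.coeff μ scaledLog (k, ε) =
      ((ε : ℝ) : ℂ) ^ 2 * MvPowerSeries.coeff μ (modifiedLog ε k) := rfl

/-- Rescaling the free energy by `ε²` leaves only `e = ε²` and `t` in the constraints, both
polynomially. -/
theorem virasoroDefect_modifiedLog {ε : ℝ} (hε : 0 < ε) (k m : ℕ) :
    virasoroDefect ((ε : ℂ) ^ 2) (((k : ℂ) + 1 / 2) * ε) (((ε : ℂ) ^ 2) • modifiedLog ε k) m = 0 := by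
  have h := congrArg (fun φ => (2 * (ε : ℂ) ^ 2) • φ) (virasoro_modifiedLog hε k m)
  rw [virasoroDefect, sub_eq_zero]
  simp only [Derivation.map_smul, shiftOp_smul] at h ⊢
  rw [show (ε : ℂ) ^ 2 • sDeriv ℂ (m + 1) (modifiedLog ε k) =
    (2 * (ε : ℂ) ^ 2) • (1 / 2 : ℂ) • sDeriv ℂ (m + 1) (modifiedLog ε k) by
      rw [← mul_smul]; congr 1; ring, h]
  have h2 : (2 : MvPowerSeries ℕ+ ℂ) = MvPowerSeries.C 2 := (map_ofNat _ 2).symm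
  have h3 : MvPowerSeries.C (σ := ℕ+) (if m = 0 then algebraMap ℂ ℂ (1 / 4) * (((k : ℂ) + 1 / 2) * ε) ^ 2 -
      algebraMap ℂ ℂ (1 / 16) * (ε : ℂ) ^ 2 else 0) = MvPowerSeries.C ((ε : ℂ) ^ 2) *
      MvPowerSeries.C (if m = 0 then ((k + 1 / 2 : ℂ) ^ 2 / 4 - 1 / 16) else 0) := by
    rw [← map_mul]
    congr 1
    split_ifs
    · simp only [Algebra.algebraMap_self, RingHom.id_apply]; ring
    · simp
  rw [h3]
  simp only [MvPowerSeries.smul_eq_C_mul, sum_add_distrib, map_mul, map_pow]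
  rw [h2]
  have h4 : ∀ p ∈ antidiagonal m, (MvPowerSeries.C (ε : ℂ) ^ 2 * sDeriv ℂ p.1 (modifiedLog ε k) *
      (MvPowerSeries.C (ε : ℂ) ^ 2 * sDeriv ℂ p.2 (modifiedLog ε k))) =
      MvPowerSeries.C (ε : ℂ) ^ 2 * (MvPowerSeries.C (ε : ℂ) ^ 2 * (sDeriv ℂ p.1 (modifiedLog ε k) *
       sDeriv ℂ p.2 (modifiedLog ε k))) := fun p _ => by ring
  rw [sum_congr rfl h4]
  simp only [← mul_sum]
  ring

theorem virasoroDefect_scaledLog (m : ℕ) :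
    virasoroDefect (fun d => ((d.2 : ℝ) : ℂ) ^ 2) (fun d => ((d.1 : ℂ) + 1 / 2) * (d.2 : ℝ))
      scaledLog m = 0 := by
  ext μ d
  have h := virasoroDefect_modifiedLog d.2.2 d.1 m
  have h1 := map_virasoroDefect (Pi.evalAlgHom ℂ (fun _ : ℕ × Set.Ioi (0 : ℝ) => ℂ) d)
    (fun d => ((d.2 : ℝ) : ℂ) ^ 2) (fun d => ((d.1 : ℂ) + 1 / 2) * (d.2 : ℝ)) scaledLog m
  have h2 : MvPowerSeries.map (Pi.evalAlgHom ℂ (fun _ : ℕ × Set.Ioi (0 : ℝ) => ℂ) d :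
      (ℕ × Set.Ioi (0 : ℝ) → ℂ) →+* ℂ) scaledLog = (((d.2 : ℝ) : ℂ) ^ 2) • modifiedLog d.2 d.1 := by
    ext μ
    rfl
  rw [h2] at h1
  have h3 := congrArg (MvPowerSeries.coeff μ) (h1.trans h)
  exact h3

-- The image of `genusEval` is a subalgebra containing the functions `e` and `t`, so the Virasoro
-- recursion keeps all coefficients of the family inside it. Injectivity of `genusEval` carries the
-- constraints back to polynomials.
open Polynomial in
theorem exists_universal : ∃ Φ : MvPowerSeries ℕ+ ℂ[X][X],
    (∀ m, virasoroDefect X (C X) Φ m = 0) ∧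
    ∀ μ, genusEval (MvPowerSeries.coeff μ Φ) = MvPowerSeries.coeff μ scaledLog := by
  have he : (fun d : ℕ × Set.Ioi (0 : ℝ) => ((d.2 : ℝ) : ℂ) ^ 2) = genusEval X := by
    funext ⟨k, ε⟩
    rw [genusEval_apply]; simp
  have ht : (fun d : ℕ × Set.Ioi (0 : ℝ) => ((d.1 : ℂ) + 1 / 2) * (d.2 : ℝ)) = genusEval (C X) := by
    funext ⟨k, ε⟩
    rw [genusEval_apply]; simp
  have hV := virasoroDefect_scaledLog
  rw [he, ht] at hV
  have h0 : ∀ μ, ∃ p, genusEval p = MvPowerSeries.coeff μ scaledLog := fun μ => by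
    by_cases hμ : μ = 0
    · refine ⟨0, ?_⟩
      rw [map_zero, hμ]
      funext ⟨k, ε⟩
      rw [coeff_scaledLog, MvPowerSeries.coeff_zero_eq_constantCoeff_apply, modifiedLog,
        constantCoeff_logSeries (constantCoeff_modifiedPartition ε.2 k), mul_zero]
      rfl
    · exact coeff_mem_of_virasoroDefect_eq_zero (S := genusEval.range) ⟨_, rfl⟩ ⟨_, rfl⟩ hV _ μ hμ
        le_rfl
  choose Φ hΦ using h0
  refine ⟨Φ, fun m => ?_, hΦ⟩
  have h1 : MvPowerSeries.map (genusEval : ℂ[X][X] →+* _) Φ = scaledLog := by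
    ext1 μ
    exact hΦ μ
  have h2 := map_virasoroDefect genusEval X (C X) Φ m
  rw [h1, hV] at h2
  ext1 μ
  refine genusEval_injective ?_
  have h3 := congrArg (MvPowerSeries.coeff μ) h2
  rw [MvPowerSeries.coeff_map] at h3
  rw [map_zero, map_zero]
  exact h3

end Universal
end ModifiedGUE
end

noncomputable section
namespace ModifiedGUE
open Finset

/-! ### Existence and uniqueness of the genus expansion -/

section GenusExpansion
open Polynomial

theorem genusEval_eq_eval_eval (p : ℂ[X][X]) (k : ℕ) (ε : Set.Ioi (0 : ℝ)) :
    genusEval p (k, ε) =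
      (p.eval (C (((ε : ℝ) : ℂ) ^ 2))).eval (((k : ℂ) + 1 / 2) * (ε : ℝ)) := by
  rw [genusEval_apply, eval_map, ← coe_evalRingHom (((k : ℂ) + 1 / 2) * (ε : ℝ)),
    ← eval₂_id (p := p), hom_eval₂]
  simp

theorem finsum_genus (p : ℂ[X][X]) {N : ℕ} (hN : 1 ≤ N) (ε : Set.Ioi (0 : ℝ)) :
    ∑ᶠ g : ℕ, (((ε : ℝ) : ℂ)) ^ (2 * (g : ℤ) - 2) *
        ((p.coeff g).eval ((N : ℂ) * (ε : ℝ) + (ε : ℝ) / 2) +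
          (p.coeff g).eval ((N : ℂ) * (ε : ℝ) - (ε : ℝ) / 2)) =
      (((ε : ℝ) : ℂ) ^ 2)⁻¹ * (genusEval p (N, ε) + genusEval p (N - 1, ε)) := by
  have hε : ((ε : ℝ) : ℂ) ≠ 0 := by exact_mod_cast (ne_of_gt ε.2)
  rw [finsum_eq_sum_of_support_subset (s := range (p.natDegree + 1))]
  · rw [genusEval_apply, genusEval_apply, eval_map, eval_map, eval₂_eq_sum_range,
      eval₂_eq_sum_range, ← sum_add_distrib, mul_sum]
    refine sum_congr rfl fun g _ => ?_
    rw [zpow_sub₀ hε, zpow_mul, zpow_natCast, coe_evalRingHom, coe_evalRingHom,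
      show ((N - 1 : ℕ) : ℂ) = N - 1 by push_cast [hN]; ring,
      show ((N : ℂ) + 1 / 2) * (ε : ℝ) = N * (ε : ℝ) + (ε : ℝ) / 2 by ring,
      show ((N : ℂ) - 1 + 1 / 2) * (ε : ℝ) = N * (ε : ℝ) - (ε : ℝ) / 2 by ring]
    have h2 : ∀ z : ℂ, z ^ (2 : ℤ) = z ^ 2 := fun z => by norm_cast
    rw [h2]
    field_simp
  · intro g hg
    simp only [coe_range, Set.mem_Iio]
    by_contra h
    rw [Function.mem_support, coeff_eq_zero_of_natDegree_lt (by omega)] at hg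
    simp at hg

/-- Injectivity of `Λ^(1/2) + Λ^(-1/2)`: for fixed `ε` the polynomial identity `P(t + ε) + P(t) = 0`
holds, and its leading coefficient is twice that of `P`. -/
theorem eq_zero_of_genusEval_add {p : ℂ[X][X]}
    (h : ∀ (k : ℕ) ε, genusEval p (k + 1, ε) + genusEval p (k, ε) = 0) : p = 0 := by
  refine genusEval_injective ?_
  rw [map_zero]
  funext ⟨k, ε⟩
  rw [genusEval_eq_eval_eval]
  set P := p.eval (C (((ε : ℝ) : ℂ) ^ 2)) with hP
  have hε : ((ε : ℝ) : ℂ) ≠ 0 := by exact_mod_cast (ne_of_gt ε.2)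
  have h1 : taylor (((ε : ℝ) : ℂ)) P + P = 0 := by
    refine Polynomial.eq_zero_of_infinite_isRoot _ (Set.Infinite.mono (s := Set.range
      fun k : ℕ => ((k : ℂ) + 1 / 2) * (ε : ℝ)) ?_ (Set.infinite_range_of_injective ?_))
    · rintro _ ⟨k, rfl⟩
      have h2 := h k ε
      rw [genusEval_eq_eval_eval, genusEval_eq_eval_eval, ← hP] at h2
      change eval _ _ = 0
      rw [eval_add, taylor_eval, ← h2]
      push_cast
      ring_nf
    · intro a b hab
      exact_mod_cast add_right_cancel (mul_right_cancel₀ hε hab)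
  have h2 := congrArg (fun q => coeff q P.natDegree) h1
  simp only [coeff_add, coeff_taylor_natDegree, coeff_natDegree, coeff_zero] at h2
  have h3 : P = 0 := leadingCoeff_eq_zero.mp (by linear_combination h2 / 2)
  rw [h3]
  simp

variable {Φ : MvPowerSeries ℕ+ ℂ[X][X]}

theorem coeff_logEvenPartition
    (hΦ : ∀ μ, genusEval (MvPowerSeries.coeff μ Φ) = MvPowerSeries.coeff μ scaledLog)
    (μ : ℕ+ →₀ ℕ) {N : ℕ} (hN : 1 ≤ N) (ε : Set.Ioi (0 : ℝ)) :
    MvPowerSeries.coeff μ (logEvenPartition N ε) = (((ε : ℝ) : ℂ) ^ 2)⁻¹ *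
      (genusEval (MvPowerSeries.coeff μ Φ) (N, ε) +
        genusEval (MvPowerSeries.coeff μ Φ) (N - 1, ε)) := by
  have hε : ((ε : ℝ) : ℂ) ^ 2 ≠ 0 := pow_ne_zero _ (by exact_mod_cast (ne_of_gt ε.2))
  rw [logEvenPartition_eq ε.2 hN, hΦ, coeff_scaledLog, coeff_scaledLog, ← mul_add,
    inv_mul_cancel_left₀ hε, map_add]

theorem isModifiedFreeEnergy_universal
    (hΦ : ∀ μ, genusEval (MvPowerSeries.coeff μ Φ) = MvPowerSeries.coeff μ scaledLog) :
    IsModifiedFreeEnergy fun g μ => (MvPowerSeries.coeff μ Φ).coeff g where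
  finite μ _ := by
    refine (MvPowerSeries.coeff μ Φ).support.finite_toSet.subset fun g hg => ?_
    exact mem_coe.mpr (mem_support_iff.mpr hg)
  shift μ _ N hN ε hε := by
    rw [coeff_logEvenPartition hΦ μ hN ⟨ε, hε⟩, ← finsum_genus _ hN]
    rfl

/-- Finiteness of the genus expansion allows the coefficients of an arbitrary solution to be
assembled into one polynomial in `e`, to which the injectivity statement applies. -/
theorem IsModifiedFreeEnergy.coeff_eq {F : ℕ → MvPowerSeries ℕ+ ℂ[X]} (hF : IsModifiedFreeEnergy F)
    (hΦ : ∀ μ, genusEval (MvPowerSeries.coeff μ Φ) = MvPowerSeries.coeff μ scaledLog)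
    {μ : ℕ+ →₀ ℕ} (hμ : μ ≠ 0) (g : ℕ) :
    MvPowerSeries.coeff μ (F g) = (MvPowerSeries.coeff μ Φ).coeff g := by
  obtain ⟨q, hq⟩ : ∃ q : ℂ[X][X], ∀ g, q.coeff g = MvPowerSeries.coeff μ (F g) := by
    refine ⟨∑ g ∈ (hF.finite μ hμ).toFinset, monomial g (MvPowerSeries.coeff μ (F g)), fun g => ?_⟩
    rw [Polynomial.finsetSum_coeff]
    simp only [coeff_monomial]
    rw [sum_ite_eq']
    split_ifs with h
    · rfl
    · simpa using Eq.symm (not_not.mp (fun h' => h (by simpa using h')))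
  suffices h : q - MvPowerSeries.coeff μ Φ = 0 by rw [← hq, sub_eq_zero.mp h]
  refine eq_zero_of_genusEval_add fun k ε => ?_
  have h1 := hF.shift μ hμ (k + 1) (by omega) ε ε.2
  simp only [← hq] at h1
  rw [finsum_genus q (by omega), coeff_logEvenPartition hΦ μ (by omega)] at h1
  have hε : (((ε : ℝ) : ℂ) ^ 2)⁻¹ ≠ 0 :=
    inv_ne_zero (pow_ne_zero _ (by exact_mod_cast (ne_of_gt ε.2)))
  have h2 := mul_left_cancel₀ hε h1
  rw [Nat.add_sub_cancel] at h2
  rw [map_sub, Pi.sub_apply, Pi.sub_apply]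
  linear_combination -h2

end GenusExpansion

end ModifiedGUE
end

noncomputable section
namespace ModifiedGUE
open Finset

/-! ### Loop equations for the correlators -/

section LoopEquations
open Polynomial

/-- The coefficient of `e^g` in the derivative of `φ` with multi-index `μ` at the origin,
evaluated at `t`. -/
def genusDeriv (t : ℂ) (g : ℕ) (μ : ℕ+ →₀ ℕ) (φ : MvPowerSeries ℕ+ ℂ[X][X]) : ℂ :=
  ((derivAt μ φ).coeff g).eval t

variable (t : ℂ) (g : ℕ) (μ : ℕ+ →₀ ℕ) (φ ψ : MvPowerSeries ℕ+ ℂ[X][X])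

@[simp] theorem genusDeriv_zero : genusDeriv t g μ 0 = 0 := by simp [genusDeriv]

theorem genusDeriv_add : genusDeriv t g μ (φ + ψ) = genusDeriv t g μ φ + genusDeriv t g μ ψ := by
  simp [genusDeriv]

theorem genusDeriv_sum {κ : Type*} (s : Finset κ) (f : κ → MvPowerSeries ℕ+ ℂ[X][X]) :
    genusDeriv t g μ (∑ i ∈ s, f i) = ∑ i ∈ s, genusDeriv t g μ (f i) := by
  simp [genusDeriv, eval_finsetSum]

theorem genusDeriv_two_mul : genusDeriv t g μ (2 * φ) = 2 * genusDeriv t g μ φ := by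
  rw [two_mul, genusDeriv_add, two_mul]

theorem genusDeriv_C_X_mul : genusDeriv t g μ (MvPowerSeries.C X * φ) =
    if g = 0 then 0 else genusDeriv t (g - 1) μ φ := by
  rw [genusDeriv, ← MvPowerSeries.smul_eq_C_mul, map_smul, smul_eq_mul]
  rcases g with _ | g <;> simp [genusDeriv, coeff_X_mul]

theorem genusDeriv_C_C_X_mul :
    genusDeriv t g μ (MvPowerSeries.C (C X) * φ) = t * genusDeriv t g μ φ := by
  rw [genusDeriv, ← MvPowerSeries.smul_eq_C_mul, map_smul, smul_eq_mul, coeff_C_mul, eval_mul,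
    eval_X, genusDeriv]

theorem genusDeriv_add_single (a : ℕ+) :
    genusDeriv t g (μ + Finsupp.single a 1) φ = genusDeriv t g μ (sDeriv _ a φ) := by
  rw [genusDeriv, derivAt_add_single, genusDeriv]

theorem genusDeriv_C (p : ℂ[X][X]) :
    genusDeriv t g μ (MvPowerSeries.C p) = if μ = 0 then (p.coeff g).eval t else 0 := by
  classical
  rw [genusDeriv, derivAt_apply, MvPowerSeries.coeff_C]
  split_ifs with h
  · rw [h]; simp
  · simp

variable {ι : Type*} [Fintype ι] (a : ι → ℕ+)

theorem multiIndex_ne_zero [Nonempty ι] : multiIndex a univ ≠ 0 := fun h => by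
  obtain ⟨i⟩ := ‹Nonempty ι›
  have h1 := DFunLike.congr_fun h (a i)
  rw [multiIndex, Finsupp.finsetSum_apply, Finsupp.coe_zero, Pi.zero_apply, sum_eq_zero_iff] at h1
  have := h1 i (mem_univ i)
  simp at this

variable [DecidableEq ι]

theorem genusDeriv_mul : genusDeriv t g (multiIndex a univ) (φ * ψ) =
    ∑ J : Finset ι, ∑ h ∈ range (g + 1),
      genusDeriv t h (multiIndex a J) φ * genusDeriv t (g - h) (multiIndex a Jᶜ) ψ := by
  rw [genusDeriv, derivAt_multiIndex_mul, Polynomial.finsetSum_coeff, eval_finsetSum,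
    powerset_univ]
  refine sum_congr rfl fun J _ => ?_
  rw [coeff_mul, eval_finsetSum, Finset.Nat.sum_antidiagonal_eq_sum_range_succ_mk]
  refine sum_congr rfl fun h _ => ?_
  rw [eval_mul, ← compl_eq_univ_sdiff]
  rfl

theorem genusDeriv_shiftOp (m : ℕ) : genusDeriv t g (multiIndex a univ) (shiftOp m φ) =
    ∑ j, (a j : ℂ) * genusDeriv t g (multiIndex a (univ.erase j)) (sDeriv _ (a j + m) φ) := by
  rw [genusDeriv, derivAt_multiIndex_shiftOp, Polynomial.finsetSum_coeff, eval_finsetSum]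
  refine sum_congr rfl fun j _ => ?_
  rw [← nsmul_eq_mul, coeff_smul, nsmul_eq_mul, eval_mul, eval_natCast]
  rfl

/-- The genus `g` loop equations. -/
theorem loop_equation {Φ : MvPowerSeries ℕ+ ℂ[X][X]} (hΦ : ∀ m, virasoroDefect X (C X) Φ m = 0)
    (m : ℕ) :
    genusDeriv t g (multiIndex a univ) (sDeriv _ (m + 1) Φ) =
      2 * ((if g = 0 then 0 else ∑ p ∈ antidiagonal m,
          genusDeriv t (g - 1) (multiIndex a univ) (sDeriv _ p.1 (sDeriv _ p.2 Φ))) +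
        ∑ p ∈ antidiagonal m, ∑ J : Finset ι, ∑ h ∈ range (g + 1),
          genusDeriv t h (multiIndex a J) (sDeriv _ p.1 Φ) *
            genusDeriv t (g - h) (multiIndex a Jᶜ) (sDeriv _ p.2 Φ) +
        t * genusDeriv t g (multiIndex a univ) (sDeriv _ m Φ) +
        ∑ j, (a j : ℂ) * genusDeriv t g (multiIndex a (univ.erase j)) (sDeriv _ (a j + m) Φ) +
        if m = 0 ∧ Fintype.card ι = 0 then (if g = 0 then t ^ 2 / 4 else if g = 1 then -(1 / 16) else 0)
          else 0) := by
  rw [sub_eq_zero.mp (hΦ m), genusDeriv_two_mul]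
  simp only [genusDeriv_add, genusDeriv_sum, genusDeriv_C_X_mul, genusDeriv_C_C_X_mul,
    genusDeriv_mul, genusDeriv_shiftOp, genusDeriv_C]
  congr 2
  by_cases hm : m = 0
  · simp only [hm, if_true, true_and]
    by_cases hι : Fintype.card ι = 0
    · have := Fintype.card_eq_zero_iff.mp hι
      rw [if_pos hι, if_pos (by simp [multiIndex])]
      rw [coeff_sub, Polynomial.algebraMap_apply, Polynomial.algebraMap_apply, ← C_pow, ← C_mul,
        Polynomial.algebraMap_apply, coeff_C_mul, coeff_C, coeff_X]
      rcases g with _ | _ | g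
      · simp; ring
      · simp
      · simp
    · rw [if_neg hι, if_neg]
      have := Fintype.card_pos_iff.mp (Nat.pos_of_ne_zero hι)
      exact multiIndex_ne_zero a
  · simp [hm]


variable (Φ : MvPowerSeries ℕ+ ℂ[X][X])

/-- The generating series `∑_m ⟨p_{2m} ⋯⟩_g w^(m+1)`. -/
def wave (t : ℂ) (Φ : MvPowerSeries ℕ+ ℂ[X][X]) (g : ℕ) (μ : ℕ+ →₀ ℕ) : PowerSeries ℂ :=
  PowerSeries.X * PowerSeries.mk fun m => genusDeriv t g μ (sDeriv _ m Φ)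

/-- The generating series `∑_{a,b} ⟨p_{2a} p_{2b} ⋯⟩_g w^(a+b+2)`. -/
def wavePair (t : ℂ) (Φ : MvPowerSeries ℕ+ ℂ[X][X]) (g : ℕ) (μ : ℕ+ →₀ ℕ) : PowerSeries ℂ :=
  PowerSeries.X ^ 2 * PowerSeries.mk fun m =>
    ∑ p ∈ antidiagonal m, genusDeriv t g μ (sDeriv _ p.1 (sDeriv _ p.2 Φ))

/-- The operator `∑_n η_n w^n ↦ a ∑_m η_{m+a+1} w^(m+2)`. -/
def shiftSeries (a : ℕ) : PowerSeries ℂ →ₗ[ℂ] PowerSeries ℂ where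
  toFun η := PowerSeries.X ^ 2 * PowerSeries.mk fun m => a * PowerSeries.coeff (m + a + 1) η
  map_add' η ζ := by
    rw [← mul_add]
    congr 1
    ext m
    simp [mul_add]
  map_smul' c η := by
    rw [RingHom.id_apply, ← mul_smul_comm]
    congr 1
    ext m
    simp [mul_left_comm]

theorem shiftSeries_apply (a : ℕ) (η : PowerSeries ℂ) : shiftSeries a η =
    PowerSeries.X ^ 2 * PowerSeries.mk fun m => a * PowerSeries.coeff (m + a + 1) η := rfl

theorem coeff_wave_succ (m : ℕ) :
    PowerSeries.coeff (m + 1) (wave t Φ g μ) = genusDeriv t g μ (sDeriv _ m Φ) := by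
  rw [wave, PowerSeries.coeff_succ_X_mul, PowerSeries.coeff_mk]

theorem wave_eq : wave t Φ g μ = PowerSeries.X ^ 2 *
    PowerSeries.mk fun m => genusDeriv t g μ (sDeriv _ (m + 1) Φ) := by
  rw [wave, sq, mul_assoc]
  congr 1
  ext m
  rcases m with _ | m
  · simp
  · rw [PowerSeries.coeff_succ_X_mul, PowerSeries.coeff_mk, PowerSeries.coeff_mk]

/-- The loop equations in terms of generating series. -/
theorem wave_loop_equation {Φ : MvPowerSeries ℕ+ ℂ[X][X]}
    (hΦ : ∀ m, virasoroDefect X (C X) Φ m = 0) :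
    wave t Φ g (multiIndex a univ) =
      2 * ((if g = 0 then 0 else wavePair t Φ (g - 1) (multiIndex a univ)) +
        ∑ J : Finset ι, ∑ h ∈ range (g + 1),
          wave t Φ h (multiIndex a J) * wave t Φ (g - h) (multiIndex a Jᶜ) +
        PowerSeries.C t * PowerSeries.X * wave t Φ g (multiIndex a univ) +
        ∑ j, shiftSeries (a j) (wave t Φ g (multiIndex a (univ.erase j))) +
        if Fintype.card ι = 0 then PowerSeries.C (if g = 0 then t ^ 2 / 4 else
          if g = 1 then -(1 / 16) else 0) * PowerSeries.X ^ 2 else 0) := by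
  have h1 : (if g = 0 then 0 else wavePair t Φ (g - 1) (multiIndex a univ)) =
      PowerSeries.X ^ 2 * PowerSeries.mk fun m => if g = 0 then 0 else ∑ p ∈ antidiagonal m,
          genusDeriv t (g - 1) (multiIndex a univ) (sDeriv _ p.1 (sDeriv _ p.2 Φ)) := by
    split_ifs with h
    · symm
      convert mul_zero _
      ext m
      simp
    · rfl
  have h2 : ∑ J : Finset ι, ∑ h ∈ range (g + 1),
      wave t Φ h (multiIndex a J) * wave t Φ (g - h) (multiIndex a Jᶜ) =
      PowerSeries.X ^ 2 * PowerSeries.mk fun m => ∑ p ∈ antidiagonal m, ∑ J : Finset ι,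
        ∑ h ∈ range (g + 1), genusDeriv t h (multiIndex a J) (sDeriv _ p.1 Φ) *
            genusDeriv t (g - h) (multiIndex a Jᶜ) (sDeriv _ p.2 Φ) := by
    rw [show (PowerSeries.mk fun m => ∑ p ∈ antidiagonal m, ∑ J : Finset ι,
        ∑ h ∈ range (g + 1), genusDeriv t h (multiIndex a J) (sDeriv _ p.1 Φ) *
            genusDeriv t (g - h) (multiIndex a Jᶜ) (sDeriv _ p.2 Φ)) =
        ∑ J : Finset ι, ∑ h ∈ range (g + 1),
          (PowerSeries.mk fun m => genusDeriv t h (multiIndex a J) (sDeriv _ m Φ)) *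
            PowerSeries.mk fun m => genusDeriv t (g - h) (multiIndex a Jᶜ) (sDeriv _ m Φ) by
      ext m
      simp only [map_sum, PowerSeries.coeff_mk, PowerSeries.coeff_mul]
      rw [sum_comm]
      refine sum_congr rfl fun J _ => sum_comm, mul_sum]
    refine sum_congr rfl fun J _ => ?_
    rw [mul_sum]
    refine sum_congr rfl fun h _ => ?_
    rw [wave, wave]
    ring
  have h3 : PowerSeries.C t * PowerSeries.X * wave t Φ g (multiIndex a univ) =
      PowerSeries.X ^ 2 * PowerSeries.mk fun m =>
        t * genusDeriv t g (multiIndex a univ) (sDeriv _ m Φ) := by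
    rw [wave, show (PowerSeries.mk fun m => t * genusDeriv t g (multiIndex a univ) (sDeriv _ m Φ)) =
      PowerSeries.C t * PowerSeries.mk fun m => genusDeriv t g (multiIndex a univ) (sDeriv _ m Φ) by
        ext m; simp]
    ring
  have h4 : ∑ j, shiftSeries (a j) (wave t Φ g (multiIndex a (univ.erase j))) =
      PowerSeries.X ^ 2 * PowerSeries.mk fun m => ∑ j, (a j : ℂ) *
        genusDeriv t g (multiIndex a (univ.erase j)) (sDeriv _ (a j + m) Φ) := by
    simp only [shiftSeries_apply, ← mul_sum]
    congr 1
    ext m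
    simp only [map_sum, PowerSeries.coeff_mk, coeff_wave_succ, add_comm m]
  have h5 : (if Fintype.card ι = 0 then PowerSeries.C (if g = 0 then t ^ 2 / 4 else
          if g = 1 then -(1 / 16) else 0) * PowerSeries.X ^ 2 else 0) = PowerSeries.X ^ 2 *
      PowerSeries.mk fun m => if m = 0 ∧ Fintype.card ι = 0 then
        (if g = 0 then t ^ 2 / 4 else if g = 1 then -(1 / 16) else 0) else 0 := by
    rw [show (PowerSeries.mk fun m => if m = 0 ∧ Fintype.card ι = 0 then
        (if g = 0 then t ^ 2 / 4 else if g = 1 then -(1 / 16) else 0) else 0) =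
      PowerSeries.C (if Fintype.card ι = 0 then
        (if g = 0 then t ^ 2 / 4 else if g = 1 then -(1 / 16) else 0) else 0) by
        ext m
        rw [PowerSeries.coeff_mk, PowerSeries.coeff_C]
        by_cases hm : m = 0 <;> simp [hm]]
    by_cases h : Fintype.card ι = 0 <;> simp [h, mul_comm]
  rw [h1, h2, h3, h4, h5, ← mul_add, ← mul_add, ← mul_add, ← mul_add, mul_left_comm, wave_eq]
  congr 1
  ext m
  rw [two_mul, map_add, PowerSeries.coeff_mk, loop_equation t g a hΦ]
  simp only [map_add, PowerSeries.coeff_mk]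
  ring

end LoopEquations

/-! ### Correlators as derivatives of the universal series. -/

section Correlators
open Polynomial

theorem derivAt_foldr_pderiv {A : Type*} [CommRing A] (l : List ℕ+) (φ : MvPowerSeries ℕ+ A)
    (μ : ℕ+ →₀ ℕ) : derivAt μ (l.foldr (fun k f => MvPowerSeries.pderiv A k f) φ) =
      derivAt (μ + (l.map fun k => Finsupp.single k 1).sum) φ := by
  induction l generalizing μ with
  | nil => simp
  | cons k l ih =>
    rw [List.foldr_cons, ← sDeriv_pnat, ← derivAt_add_single, ih, List.map_cons, List.sum_cons,
      add_assoc]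

theorem correlator_eq {F : ℕ → MvPowerSeries ℕ+ ℂ[X]} (hF : IsModifiedFreeEnergy F)
    {Φ : MvPowerSeries ℕ+ ℂ[X][X]}
    (hΦ : ∀ μ, genusEval (MvPowerSeries.coeff μ Φ) = MvPowerSeries.coeff μ scaledLog)
    (t : ℂ) (g : ℕ) {n : ℕ} (hn : 1 ≤ n) (a : Fin n → ℕ+) :
    correlator F t g a = genusDeriv t g (multiIndex a univ) Φ := by
  have : NeZero n := ⟨by omega⟩
  have h : (((List.ofFn a).map fun k => Finsupp.single k 1).sum : ℕ+ →₀ ℕ) =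
      multiIndex a univ := by
    rw [List.map_ofFn, List.sum_ofFn]
    rfl
  rw [correlator, ← derivAt_zero, derivAt_foldr_pderiv, zero_add, h, genusDeriv, derivAt_apply,
    derivAt_apply, hF.coeff_eq hΦ (multiIndex_ne_zero a), ← nsmul_eq_mul, ← nsmul_eq_mul,
    coeff_smul]

end Correlators

end ModifiedGUE
end

noncomputable section
namespace ModifiedGUE
open Finset

/-! ### Formal expansions at `x = ∞` -/

section FormalExpansion
open PowerSeries

instance charZero_powerSeries : CharZero (PowerSeries ℂ) := algebraRat.charZero _

/-- The Euler operator `w d/dw`. -/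
def eulerOp : Derivation ℂ (PowerSeries ℂ) (PowerSeries ℂ) := (X : PowerSeries ℂ) • derivative ℂ

theorem coeff_eulerOp (n : ℕ) (η : PowerSeries ℂ) : coeff n (eulerOp η) = n * coeff n η := by
  change coeff n (X * derivative ℂ η) = _
  rcases n with _ | n
  · simp
  · rw [coeff_succ_X_mul, coeff_derivative, mul_comm]; push_cast; ring

theorem eulerOp_X : eulerOp X = X := by
  ext n
  rw [coeff_eulerOp, coeff_X]
  split_ifs with h <;> simp [h]

theorem eulerOp_C (c : ℂ) : eulerOp (C c) = 0 := by
  ext n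
  rw [coeff_eulerOp, coeff_C]
  split_ifs with h <;> simp [h]

/-- The operator multiplies `w^n` by `n + c`, which is nonzero for `n > 0`. Closed forms are proved
below by comparing Euler derivatives. -/
theorem eulerOp_injective {c : ℕ} {η ζ : PowerSeries ℂ} (hη : coeff 0 η = 0) (hζ : coeff 0 ζ = 0)
    (h : eulerOp η + C (c : ℂ) * η = eulerOp ζ + C (c : ℂ) * ζ) : η = ζ := by
  ext n
  rcases Nat.eq_zero_or_pos n with rfl | hn
  · rw [hη, hζ]
  · have h1 := congrArg (coeff n) h
    simp only [map_add, coeff_eulerOp, coeff_C_mul, ← add_mul] at h1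
    refine mul_left_cancel₀ ?_ h1
    exact_mod_cast (by omega : n + c ≠ 0)

theorem shiftSeries_X_mul (a : ℕ) (η : PowerSeries ℂ) :
    shiftSeries a (X * η) = X * shiftSeries a η + C ((a : ℂ) * coeff a η) * X ^ 2 := by
  rw [shiftSeries_apply, shiftSeries_apply,
    show X * (X ^ 2 * PowerSeries.mk fun m => (a : ℂ) * coeff (m + a + 1) η) + C ((a : ℂ) * coeff a η) * X ^ 2 =
      X ^ 2 * (X * (PowerSeries.mk fun m => (a : ℂ) * coeff (m + a + 1) η) + C ((a : ℂ) * coeff a η)) by ring]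
  congr 1
  ext m
  rw [coeff_mk, coeff_succ_X_mul, map_add]
  rcases m with _ | m
  · simp
  · rw [coeff_succ_X_mul, coeff_mk, coeff_C, if_neg (by omega), add_zero,
      show m + 1 + a = m + a + 1 by ring]

theorem shiftSeries_C_mul (a : ℕ) (c : ℂ) (η : PowerSeries ℂ) :
    shiftSeries a (C c * η) = C c * shiftSeries a η := by
  rw [← smul_eq_C_mul, map_smul, smul_eq_C_mul]

/-- Homogeneity: `shiftSeries a` lowers the exponent of `w` by `a - 1`. -/
theorem eulerOp_shiftSeries (a : ℕ) (η : PowerSeries ℂ) :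
    eulerOp (shiftSeries a η) + C ((a : ℂ) - 1) * shiftSeries a η = shiftSeries a (eulerOp η) := by
  ext n
  rw [map_add, coeff_eulerOp, coeff_C_mul, shiftSeries_apply, shiftSeries_apply, coeff_X_pow_mul',
    coeff_X_pow_mul']
  split_ifs with h
  · obtain ⟨m, rfl⟩ := exists_add_of_le h
    simp only [add_tsub_cancel_left, coeff_mk, coeff_eulerOp]
    push_cast
    ring
  · simp

/-- The series `u = y^(-2) = 16 / (1 - 4 t w)`. -/
def uSeries (t : ℂ) : PowerSeries ℂ := mk fun n => 16 * (4 * t) ^ n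

theorem mul_uSeries (t : ℂ) : (1 - 4 * C t * X) * uSeries t = 16 := by
  have h4 : (4 : PowerSeries ℂ) = C 4 := (map_ofNat _ 4).symm
  ext n
  rw [h4, ← map_mul, sub_mul, one_mul, map_sub, mul_assoc, coeff_C_mul]
  rcases n with _ | n
  · rw [show (16 : PowerSeries ℂ) = C 16 from (map_ofNat _ 16).symm, coeff_C]
    simp [uSeries]
  · rw [coeff_succ_X_mul, show (16 : PowerSeries ℂ) = C 16 from (map_ofNat _ 16).symm, coeff_C,
      if_neg (by omega), uSeries, coeff_mk, coeff_mk]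
    ring

/-- The expansion of `t w² / (8 y^(2k+3))`, i.e. of `y^(-2k-2) dy/dx`, for an expansion `Y` of `y`. -/
def basisSeries (t : ℂ) (Y : PowerSeries ℂ) (k : ℕ) : PowerSeries ℂ :=
  C (t / 8) * (X ^ 2 * Y * uSeries t ^ (k + 2))

/-- The coefficient of `w^(a+1)` in `basisSeries`. -/
def basisCoeff (t : ℂ) (Y : PowerSeries ℂ) (k a : ℕ) : ℂ := coeff (a + 1) (basisSeries t Y k)

variable {t : ℂ} {Y : PowerSeries ℂ}

theorem eight_mul_basisSeries (k : ℕ) :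
    8 * basisSeries t Y k = C t * X ^ 2 * Y * uSeries t ^ (k + 2) := by
  rw [basisSeries, ← mul_assoc, show (8 : PowerSeries ℂ) * C (t / 8) = C t by
    rw [← map_ofNat C 8, ← map_mul]; congr 1; ring]
  ring

theorem basisSeries_eq (k : ℕ) : basisSeries t Y k = X * PowerSeries.mk (basisCoeff t Y k) := by
  ext n
  rcases n with _ | n
  · rw [basisSeries]; simp
  · rw [coeff_succ_X_mul, coeff_mk, basisCoeff]

theorem basisCoeff_zero (k : ℕ) : basisCoeff t Y k 0 = 0 := by
  rw [basisCoeff, basisSeries, coeff_C_mul, mul_assoc, sq, mul_assoc, coeff_succ_X_mul]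
  simp

variable (hY : 16 * Y ^ 2 = 1 - 4 * C t * X)
include hY

theorem uSeries_mul_sq : uSeries t * Y ^ 2 = 1 := by
  have h := mul_uSeries t
  rw [← hY] at h
  have h16 : (16 : PowerSeries ℂ) ≠ 0 := by norm_num
  refine mul_left_cancel₀ h16 ?_
  linear_combination h

theorem eulerOp_Y : 32 * eulerOp Y = (16 - uSeries t) * Y := by
  have h1 := congrArg eulerOp hY
  have h4 : eulerOp (4 * C t) = 0 := by
    rw [← map_ofNat C 4, ← map_mul, eulerOp_C]
  have h16 : eulerOp 16 = 0 := by rw [← map_ofNat C 16, eulerOp_C]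
  have h2 := uSeries_mul_sq hY
  rw [map_sub, Derivation.leibniz, Derivation.leibniz_pow, Derivation.map_one_eq_zero,
    Derivation.leibniz, eulerOp_X, h4, h16] at h1
  simp only [smul_eq_mul, nsmul_eq_mul, Nat.cast_ofNat, mul_zero, add_zero, zero_sub,
    pow_one, Nat.add_one_sub_one] at h1
  linear_combination (uSeries t * Y) * h1 - 32 * eulerOp Y * h2 - uSeries t * Y * hY + 16 * Y * h2

theorem eulerOp_uSeries : 16 * eulerOp (uSeries t) = uSeries t ^ 2 - 16 * uSeries t := by
  have h2 := uSeries_mul_sq hY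
  have h1 := congrArg eulerOp h2
  have h3 := eulerOp_Y hY
  rw [Derivation.leibniz, Derivation.leibniz_pow, Derivation.map_one_eq_zero] at h1
  simp only [smul_eq_mul, nsmul_eq_mul, Nat.cast_ofNat, pow_one, Nat.add_one_sub_one] at h1
  linear_combination 16 * uSeries t * h1 - uSeries t ^ 2 * Y * h3 -
    (16 * eulerOp (uSeries t) + uSeries t * (16 - uSeries t)) * h2

omit hY in
theorem X_mul_uSeries : 4 * C t * X * uSeries t = uSeries t - 16 := by
  linear_combination -mul_uSeries t

theorem eulerOp_uSeries_pow_mul (k : ℕ) :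
    8 * eulerOp (uSeries t ^ (k + 1) * Y) = ((2 * k + 1 : ℕ) : PowerSeries ℂ) * C t * X * uSeries t ^ (k + 2) * Y := by
  have h1 := eulerOp_Y hY
  have h2 := eulerOp_uSeries hY
  have h3 := X_mul_uSeries (t := t)
  have h4 : (4 : PowerSeries ℂ) ≠ 0 := by norm_num
  refine mul_left_cancel₀ h4 ?_
  rw [Derivation.leibniz, Derivation.leibniz_pow]
  simp only [smul_eq_mul, nsmul_eq_mul, Nat.add_one_sub_one]
  push_cast
  linear_combination uSeries t ^ (k + 1) * h1 + 2 * ((k : PowerSeries ℂ) + 1) * uSeries t ^ k * Y * h2 -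
    (2 * (k : PowerSeries ℂ) + 1) * uSeries t ^ (k + 1) * Y * h3

/-- Since `d/dx = -w (w d/dw)`, this reads off coefficients in `d(y^(-2k-1))/dx = -(2k+1) y^(-2k-2)
dy/dx`. -/
theorem mul_coeff_uSeries_pow_mul (k a : ℕ) :
    (a : ℂ) * coeff a (uSeries t ^ (k + 1) * Y) = (2 * k + 1) * basisCoeff t Y k a := by
  have h8 : (8 : PowerSeries ℂ) ≠ 0 := by norm_num
  have h1 : X * eulerOp (uSeries t ^ (k + 1) * Y) = C (2 * k + 1 : ℂ) * basisSeries t Y k := by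
    refine mul_left_cancel₀ h8 ?_
    have hc : (C (2 * k + 1 : ℂ) : PowerSeries ℂ) = ((2 * k + 1 : ℕ) : PowerSeries ℂ) := by
      rw [← map_natCast C]; push_cast; rfl
    rw [hc]
    linear_combination X * eulerOp_uSeries_pow_mul hY k -
      ((2 * k + 1 : ℕ) : PowerSeries ℂ) * eight_mul_basisSeries (Y := Y) k
  have h2 := congrArg (coeff (a + 1)) h1
  rwa [coeff_succ_X_mul, coeff_eulerOp, coeff_C_mul] at h2

-- On the curve `4 t w = 1 - 16 y²`, so the factor `w²` of the basis series becomes `(1 - 16 y²)²`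
-- up to a constant.
omit hY in
theorem basisSeries_expand (k : ℕ) : 128 * C t * basisSeries t Y k =
    uSeries t ^ (k + 2) * Y - 32 * (uSeries t ^ (k + 1) * Y) + 256 * (uSeries t ^ k * Y) := by
  have h1 := eight_mul_basisSeries (t := t) (Y := Y) k
  have h2 := X_mul_uSeries (t := t)
  linear_combination 16 * C t * h1 + uSeries t ^ k * Y *
    (4 * C t * X * uSeries t + uSeries t - 16) * h2

theorem eight_mul_Y_mul_basisSeries (k : ℕ) :
    8 * (Y * basisSeries t Y k) = C t * X ^ 2 * uSeries t ^ (k + 1) := by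
  have h1 := eight_mul_basisSeries (t := t) (Y := Y) k
  have h2 := uSeries_mul_sq hY
  linear_combination Y * h1 + C t * X ^ 2 * uSeries t ^ (k + 1) * h2

omit hY in
/-- Coefficients of the expansion of `(1 - 16 v)² / v^k` truncated to nonpositive powers of `v`. -/
def kernelComb {M : Type*} [AddCommGroup M] (b : ℕ → M) : ℕ → M
  | 0 => b 0
  | 1 => b 1 - (32 : ℕ) • b 0
  | k + 2 => b (k + 2) - (32 : ℕ) • b (k + 1) + (256 : ℕ) • b k

omit hY in
theorem map_kernelComb {M M' : Type*} [AddCommGroup M] [AddCommGroup M'] (f : M →+ M')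
    (b : ℕ → M) (k : ℕ) : f (kernelComb b k) = kernelComb (fun i => f (b i)) k := by
  rcases k with _ | _ | k <;> simp [kernelComb]

theorem Y_mul_kernelComb (k : ℕ) : 8 * (Y * kernelComb (basisSeries t Y) k) =
    C t * X ^ 2 * kernelComb (fun i => uSeries t ^ (i + 1)) k := by
  have h := eight_mul_Y_mul_basisSeries hY
  rcases k with _ | _ | k
  · simp only [kernelComb, h]
  · simp only [kernelComb, nsmul_eq_mul]
    push_cast
    linear_combination h 1 - 32 * h 0
  · simp only [kernelComb, nsmul_eq_mul]
    push_cast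
    linear_combination h (k + 2) - 32 * h (k + 1) + 256 * h k

/-- The formal solution for a product source. -/
theorem product_source (ht : t ≠ 0) (k l : ℕ) :
    2 * Y * (C (-(256 * t)⁻¹) * kernelComb (basisSeries t Y) (k + l + 2)) +
      basisSeries t Y k * basisSeries t Y l = 0 := by
  have h1 := Y_mul_kernelComb hY (k + l + 2)
  have h2 := X_mul_uSeries (t := t)
  have h3 := uSeries_mul_sq hY
  have hk := eight_mul_basisSeries (t := t) (Y := Y) k
  have hl := eight_mul_basisSeries (t := t) (Y := Y) l
  have hc : C (-(256 * t)⁻¹) * (256 * C t) = (-1 : PowerSeries ℂ) := by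
    rw [← map_ofNat C 256, ← map_mul, ← map_mul, neg_mul, inv_mul_cancel₀ (by simpa using ht)]
    simp
  have h4 : (256 * 16 : PowerSeries ℂ) * C t ≠ 0 := by
    rw [← map_ofNat C 256, ← map_ofNat C 16, ← map_mul, ← map_mul]
    exact (map_ne_zero_iff _ (PowerSeries.C_injective)).mpr (by simpa using ht)
  refine mul_left_cancel₀ h4 ?_
  -- The index `k + l + 2` is at least `2`, so `kernelComb` is not truncated and carries the full
  -- factor `(1 - 16 y²)² = (4 t w)²`.
  simp only [kernelComb, nsmul_eq_mul] at h1 ⊢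
  push_cast at h1 ⊢
  set u := uSeries t
  linear_combination (2 * 16 * Y * (basisSeries t Y (k + l + 2) - 32 * basisSeries t Y (k + l + 1) +
    256 * basisSeries t Y (k + l))) * hc - 4 * h1 + 64 * C t * (8 * basisSeries t Y l) * hk +
    64 * C t * (C t * X ^ 2 * Y * u ^ (k + 2)) * hl +
    64 * C t ^ 3 * X ^ 4 * u ^ (k + l + 3) * h3 +
    4 * C t * X ^ 2 * u ^ (k + l + 1) * (4 * C t * X * u + u - 16) * h2

omit hY in
/-- The linearization `η ↦ 2 G η + ∑ ...` of the loop equation in the presence of `p_{2a}`. -/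
def shiftedOp (a : ℕ) (G : PowerSeries ℂ) : PowerSeries ℂ →ₗ[ℂ] PowerSeries ℂ :=
  LinearMap.mulLeft ℂ (2 * G) + shiftSeries a

omit hY in
theorem shiftedOp_apply (a : ℕ) (G η : PowerSeries ℂ) :
    shiftedOp a G η = 2 * G * η + shiftSeries a η := rfl

omit hY in
theorem shiftedOp_C_mul (a : ℕ) (G η : PowerSeries ℂ) (c : ℂ) :
    shiftedOp a G (C c * η) = C c * shiftedOp a G η := by
  rw [← smul_eq_C_mul, map_smul, smul_eq_C_mul]

omit hY in
theorem shiftedOp_mul (a : ℕ) (G η : PowerSeries ℂ) :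
    (1 - 4 * C t * X) * shiftedOp a G η = shiftedOp a G ((1 - 4 * C t * X) * η) +
      4 * C t * C ((a : ℂ) * coeff a η) * X ^ 2 := by
  have h4 : (4 : PowerSeries ℂ) * C t = C (4 * t) := by rw [map_mul, map_ofNat]
  rw [h4, shiftedOp_apply, shiftedOp_apply, sub_mul 1 _ η, one_mul, map_sub, mul_assoc (C (4 * t)) X η,
    shiftSeries_C_mul, shiftSeries_X_mul]
  ring

variable {a : ℕ} {G : PowerSeries ℂ} (hG : 2 * Y * G + shiftSeries a Y = 0)
include hG

/-- Multiplication by `1 - 4 t w = 16/u` commutes with `shiftedOp` up to one boundary term, so each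
further power of `u` adds one summand. The hypothesis on `G` says that `Y` is annihilated, which
starts the induction. -/
theorem shiftedOp_pow (k : ℕ) : 4 * shiftedOp a G (uSeries t ^ k * Y) = C t * X ^ 2 *
    ∑ l ∈ range k, C ((2 * l + 1) * basisCoeff t Y l a) * uSeries t ^ (k - l) := by
  induction k with
  | zero =>
    rw [range_zero, sum_empty, mul_zero, pow_zero, one_mul, shiftedOp_apply,
      show 2 * G * Y + shiftSeries a Y = 0 by rw [← hG]; ring, mul_zero]
  | succ k ih =>
    have h1 := shiftedOp_mul (t := t) a G (uSeries t ^ (k + 1) * Y)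
    have h2 := mul_uSeries t
    rw [show (1 - 4 * C t * X) * (uSeries t ^ (k + 1) * Y) = C 16 * (uSeries t ^ k * Y) by
      rw [map_ofNat]; linear_combination uSeries t ^ k * Y * h2, shiftedOp_C_mul, map_ofNat,
      mul_coeff_uSeries_pow_mul hY] at h1
    rw [sum_range_succ, show k + 1 - k = 1 by omega, pow_one]
    have h3 : ∑ l ∈ range k, C ((2 * l + 1) * basisCoeff t Y l a) * uSeries t ^ (k + 1 - l) =
        uSeries t * ∑ l ∈ range k, C ((2 * l + 1) * basisCoeff t Y l a) * uSeries t ^ (k - l) := by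
      rw [mul_sum]
      refine sum_congr rfl fun l hl => ?_
      rw [Nat.succ_sub (mem_range.mp hl).le, pow_succ']
      exact mul_left_comm _ _ _
    rw [h3]
    have h4 : (4 : PowerSeries ℂ) ≠ 0 := by norm_num
    refine mul_left_cancel₀ h4 ?_
    linear_combination uSeries t * h1 + 4 * uSeries t * ih -
      shiftedOp a G (uSeries t ^ (k + 1) * Y) * h2

/-- The formal solution for a source with a factor `ω_{0,2}`. -/
theorem shifted_source (ht : t ≠ 0) (k : ℕ) :
    2 * Y * (C (-(128 * t)⁻¹) * ∑ l ∈ range (k + 2), C ((2 * l + 1) * basisCoeff t Y l a) *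
      kernelComb (basisSeries t Y) (k + 1 - l)) + shiftedOp a G (basisSeries t Y k) = 0 := by
  have h1 := congrArg (shiftedOp a G) (basisSeries_expand (Y := Y) (t := t) k)
  have h128 : (128 : PowerSeries ℂ) * C t = C (128 * t) := by rw [map_mul, map_ofNat]
  have h32 : (32 : PowerSeries ℂ) = C 32 := (map_ofNat _ _).symm
  have h256 : (256 : PowerSeries ℂ) = C 256 := (map_ofNat _ _).symm
  rw [h128, h32, h256, map_add, map_sub, shiftedOp_C_mul, shiftedOp_C_mul, shiftedOp_C_mul, ← h128,
    ← h32, ← h256] at h1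
  have e0 := shiftedOp_pow hY hG k
  have e1 := shiftedOp_pow hY hG (k + 1)
  have e2 := shiftedOp_pow hY hG (k + 2)
  have h2 : 8 * (Y * ∑ l ∈ range (k + 2), C ((2 * l + 1) * basisCoeff t Y l a) *
      kernelComb (basisSeries t Y) (k + 1 - l)) = C t * X ^ 2 * ∑ l ∈ range (k + 2),
        C ((2 * l + 1) * basisCoeff t Y l a) * kernelComb (fun i => uSeries t ^ (i + 1)) (k + 1 - l) := by
    rw [mul_sum, mul_sum, mul_sum]
    refine sum_congr rfl fun l _ => ?_
    linear_combination C ((2 * l + 1) * basisCoeff t Y l a) * Y_mul_kernelComb hY (k + 1 - l)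
  generalize ∑ l ∈ range (k + 2), C ((2 * l + 1) * basisCoeff t Y l a) *
      kernelComb (basisSeries t Y) (k + 1 - l) = S at h2 ⊢
  -- Only for `l < k` is `kernelComb` untruncated; the terms `l = k` and `l = k + 1` are treated
  -- apart.
  have h3 : ∑ l ∈ range k,
      C ((2 * l + 1) * basisCoeff t Y l a) * kernelComb (fun i => uSeries t ^ (i + 1)) (k + 1 - l) =
      ∑ l ∈ range k, C ((2 * l + 1) * basisCoeff t Y l a) * uSeries t ^ (k + 2 - l) -
      32 * ∑ l ∈ range k, C ((2 * l + 1) * basisCoeff t Y l a) * uSeries t ^ (k + 1 - l) +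
      256 * ∑ l ∈ range k, C ((2 * l + 1) * basisCoeff t Y l a) * uSeries t ^ (k - l) := by
    rw [mul_sum, mul_sum, ← sum_sub_distrib, ← sum_add_distrib]
    refine sum_congr rfl fun l hl => ?_
    obtain ⟨j, rfl⟩ := Nat.exists_eq_add_of_lt (mem_range.mp hl)
    rw [show l + j + 1 + 1 - l = j + 2 by omega, show l + j + 1 + 2 - l = j + 3 by omega,
      show l + j + 1 - l = j + 1 by omega]
    simp only [kernelComb, nsmul_eq_mul]
    push_cast
    ring
  rw [sum_range_succ, sum_range_succ, h3, show k + 1 - k = 1 by omega, show k + 1 - (k + 1) = 0 by omega] at h2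
  rw [sum_range_succ, sum_range_succ, show k + 2 - k = 2 by omega,
    show k + 2 - (k + 1) = 1 by omega] at e2
  rw [sum_range_succ, show k + 1 - k = 1 by omega] at e1
  have hc : C (-(128 * t)⁻¹) * (128 * C t) = (-1 : PowerSeries ℂ) := by
    rw [← map_ofNat C 128, ← map_mul, ← map_mul, neg_mul, inv_mul_cancel₀ (by simpa using ht)]
    simp
  have h4 : (4 : PowerSeries ℂ) * (128 * C t) ≠ 0 := by
    rw [← map_ofNat C 128, ← map_ofNat C 4, ← map_mul, ← map_mul]
    exact (map_ne_zero_iff _ (PowerSeries.C_injective)).mpr (by simpa using ht)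
  refine mul_left_cancel₀ h4 ?_
  simp only [kernelComb, nsmul_eq_mul] at h2
  push_cast at h2 e2
  linear_combination 8 * Y * S * hc - h2 + 4 * h1 + e2 - 32 * e1 + 256 * e0

omit hY in
theorem shiftedOp_Y : shiftedOp a G Y = 0 := by
  rw [shiftedOp_apply, ← hG]
  ring

theorem shiftedOp_uSeries_mul :
    4 * shiftedOp a G (uSeries t * Y) = C t * X ^ 2 * C (basisCoeff t Y 0 a) * uSeries t := by
  have h := shiftedOp_pow hY hG 1
  rw [sum_range_one, pow_one, Nat.cast_zero] at h
  rw [h]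
  simp
  ring

/-- The homogeneity of the genus zero two-point series. -/
theorem eulerOp_twoPoint :
    32 * (eulerOp G + C ((a : ℂ) - 1) * G) = C (basisCoeff t Y 0 a) * basisSeries t Y 0 := by
  have h1 := congrArg eulerOp hG
  have h2 := eulerOp_shiftSeries a Y
  have hY' := eulerOp_Y hY
  have h3 : 32 * shiftedOp a G (eulerOp Y) = - shiftedOp a G (uSeries t * Y) := by
    have h32 : (32 : PowerSeries ℂ) = C 32 := (map_ofNat _ _).symm
    rw [h32, ← shiftedOp_C_mul, ← h32, hY', sub_mul, map_sub, ← map_ofNat C 16, shiftedOp_C_mul,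
      shiftedOp_Y hG, mul_zero, zero_sub]
  have h4 := shiftedOp_uSeries_mul hY hG
  have h5 := uSeries_mul_sq hY
  have h6 := eight_mul_basisSeries (t := t) (Y := Y) 0
  rw [shiftedOp_apply] at h3
  have hE2 : eulerOp (2 : PowerSeries ℂ) = 0 := by rw [← map_ofNat C 2, eulerOp_C]
  rw [map_add, Derivation.leibniz, Derivation.leibniz, map_zero, hE2] at h1
  simp only [smul_eq_mul, mul_zero, add_zero] at h1
  have h8 : (8 : PowerSeries ℂ) ≠ 0 := by norm_num
  refine mul_left_cancel₀ h8 ?_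
  linear_combination (-256 * (eulerOp G + C ((a : ℂ) - 1) * G)) * h5 +
    128 * uSeries t * Y * (h1 - h2 + C ((a : ℂ) - 1) * hG) - 4 * uSeries t * Y * h3 +
    uSeries t * Y * h4 - C (basisCoeff t Y 0 a) * h6

omit hG in
theorem eulerOp_basisSeries_zero :
    32 * eulerOp (basisSeries t Y 0) = 16 * basisSeries t Y 0 + 3 * basisSeries t Y 1 := by
  have h0 := eight_mul_basisSeries (t := t) (Y := Y) 0
  have h1 := eight_mul_basisSeries (t := t) (Y := Y) 1
  have hY' := eulerOp_Y hY
  have hu := eulerOp_uSeries hY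
  have h2 := congrArg eulerOp h0
  have h8' : (8 : PowerSeries ℂ) = C 8 := (map_ofNat _ _).symm
  rw [h8', Derivation.leibniz, Derivation.leibniz, Derivation.leibniz, Derivation.leibniz,
    Derivation.leibniz_pow, Derivation.leibniz_pow, eulerOp_C, eulerOp_C, eulerOp_X, ← h8'] at h2
  simp only [smul_eq_mul, nsmul_eq_mul, mul_zero, add_zero, zero_add, pow_one,
    Nat.add_one_sub_one] at h2
  push_cast at h2
  have h8 : (8 : PowerSeries ℂ) ≠ 0 := by norm_num
  refine mul_left_cancel₀ h8 ?_
  linear_combination 32 * h2 + C t * X ^ 2 * uSeries t ^ 2 * hY' +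
    4 * C t * X ^ 2 * Y * uSeries t * hu - 16 * h0 - 3 * h1

omit hG in
theorem basisCoeff_one (a : ℕ) : 3 * basisCoeff t Y 1 a = (32 * a + 16) * basisCoeff t Y 0 a := by
  have h := congrArg (coeff (a + 1)) (eulerOp_basisSeries_zero hY)
  rw [← map_ofNat C 32, ← map_ofNat C 16, ← map_ofNat C 3, map_add, coeff_C_mul, coeff_C_mul,
    coeff_C_mul, coeff_eulerOp] at h
  simp only [basisCoeff]
  push_cast at h
  linear_combination -h

theorem shiftedOp_basisSeries_zero (ht : t ≠ 0) : 512 * shiftedOp a G (basisSeries t Y 0) =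
    C (basisCoeff t Y 0 a) * (X ^ 2 * uSeries t * (uSeries t + C (32 * (a : ℂ) - 16))) := by
  have h1 := congrArg (shiftedOp a G) (basisSeries_expand (Y := Y) (t := t) 0)
  have h128 : (128 : PowerSeries ℂ) * C t = C (128 * t) := by rw [map_mul, map_ofNat]
  have h32 : (32 : PowerSeries ℂ) = C 32 := (map_ofNat _ _).symm
  have h256 : (256 : PowerSeries ℂ) = C 256 := (map_ofNat _ _).symm
  rw [h128, h32, h256, map_add, map_sub, shiftedOp_C_mul, shiftedOp_C_mul, shiftedOp_C_mul, ← h128,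
    ← h32, ← h256, pow_zero, one_mul, shiftedOp_Y hG, zero_add, zero_add, pow_one, mul_zero,
    add_zero] at h1
  have e1 := shiftedOp_uSeries_mul hY hG
  have e2 := shiftedOp_pow hY hG 2
  rw [sum_range_succ, sum_range_one, Nat.cast_zero, Nat.cast_one, mul_zero, zero_add, one_mul, mul_one,
    show (2 : ℂ) + 1 = 3 by norm_num, basisCoeff_one hY, map_mul C, Nat.sub_zero, show 2 - 1 = 1 from rfl, pow_one] at e2
  have e3 : (C (32 * (a : ℂ) + 16) : PowerSeries ℂ) = C (32 * (a : ℂ) - 16) + 32 := by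
    rw [h32, ← map_add]; congr 1; ring
  rw [e3] at e2
  have h4 : (C t : PowerSeries ℂ) ≠ 0 := (map_ne_zero_iff _ (PowerSeries.C_injective)).mpr ht
  refine mul_left_cancel₀ h4 ?_
  linear_combination 4 * h1 + e2 - 32 * e1

theorem coeff_zero_twoPoint : coeff 0 G = 0 := by
  have h1 := congrArg (coeff 0) hG
  have h2 := congrArg (coeff 0) hY
  rw [shiftSeries_apply] at h1
  simp only [coeff_zero_eq_constantCoeff_apply, map_add, map_mul, map_pow, map_sub, constantCoeff_X,
    map_ofNat, map_one, mul_zero, sub_zero, map_zero] at h1 h2 ⊢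
  have h3 : constantCoeff Y ≠ 0 := fun h => by rw [h] at h2; norm_num at h2
  simpa [h3] using h1

omit hG in
/-- The formal solution of the genus zero three-point loop equation. -/
theorem threePoint (ht : t ≠ 0) {a b : ℕ} (ha : 0 < a) (hb : 0 < b) {G H : PowerSeries ℂ}
    (hG : 2 * Y * G + shiftSeries a Y = 0) (hH : 2 * Y * H + shiftSeries b Y = 0) :
    2 * Y * (C (-(128 * t)⁻¹ * (basisCoeff t Y 0 a * basisCoeff t Y 0 b)) * basisSeries t Y 0) +
      (2 * G * H + shiftSeries a H + shiftSeries b G) = 0 := by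
  have hc : (C (-(128 * t)⁻¹ * (basisCoeff t Y 0 a * basisCoeff t Y 0 b)) : PowerSeries ℂ) =
      C (-(128 * t)⁻¹) * (C (basisCoeff t Y 0 a) * C (basisCoeff t Y 0 b)) := by simp only [map_mul]
  have hκ : C (-(128 * t)⁻¹) * (128 * C t) = (-1 : PowerSeries ℂ) := by
    rw [← map_ofNat C 128, ← map_mul, ← map_mul, neg_mul, inv_mul_cancel₀ (by simpa using ht)]
    simp
  rw [hc]
  set A : PowerSeries ℂ := C (basisCoeff t Y 0 a) with hA
  set B : PowerSeries ℂ := C (basisCoeff t Y 0 b) with hB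
  have hYe := eight_mul_Y_mul_basisSeries hY 0
  have hQ : 512 * (2 * Y * (C (-(128 * t)⁻¹) * (A * B) * basisSeries t Y 0)) =
      -(A * B * (X ^ 2 * uSeries t)) := by
    linear_combination (A * B * X ^ 2 * uSeries t) * hκ + 128 * A * B * C (-(128 * t)⁻¹) * hYe
  have hs : ∀ (c : ℕ) (K L : PowerSeries ℂ) (z : ℂ), 32 * K = C z * L →
      32 * shiftSeries c K = C z * shiftSeries c L := fun c K L z h => by
    rw [← map_ofNat C 32, ← shiftSeries_C_mul, map_ofNat, h, shiftSeries_C_mul]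
  have hZG := eulerOp_twoPoint hY hG
  have hZH := eulerOp_twoPoint hY hH
  have hsG := hs b _ _ _ hZG
  have hsH := hs a _ _ _ hZH
  rw [map_add, shiftSeries_C_mul] at hsG hsH
  have hEG := eulerOp_shiftSeries b G
  have hEH := eulerOp_shiftSeries a H
  have hTa := shiftedOp_basisSeries_zero hY hG ht
  have hTb := shiftedOp_basisSeries_zero hY hH ht
  rw [shiftedOp_apply] at hTa hTb
  have h512 : (512 : PowerSeries ℂ) ≠ 0 := by norm_num
  refine mul_left_cancel₀ h512 ?_
  rw [mul_zero, mul_add, hQ, neg_add_eq_zero]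
  have hE2 : eulerOp (2 : PowerSeries ℂ) = 0 := by rw [← map_ofNat C 2, eulerOp_C]
  have hE512 : eulerOp (512 : PowerSeries ℂ) = 0 := by rw [← map_ofNat C 512, eulerOp_C]
  have hu := eulerOp_uSeries hY
  -- The homogeneities `a - 1` of `G` and `b - 1` of `H` add up to `a + b - 2`; with this constant
  -- all Euler derivatives are known from `eulerOp_twoPoint`.
  refine eulerOp_injective (c := a + b - 2) ?_ ?_ ?_
  · simp [coeff_zero_eq_constantCoeff_apply]
  · have h1 := coeff_zero_twoPoint hY hG
    have h2 := coeff_zero_twoPoint hY hH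
    rw [coeff_zero_eq_constantCoeff_apply] at h1 h2
    simp [coeff_zero_eq_constantCoeff_apply, shiftSeries_apply, h1, h2]
  · have hab : (C ((a + b - 2 : ℕ) : ℂ) : PowerSeries ℂ) = C ((a : ℂ) - 1) + C ((b : ℂ) - 1) := by
      rw [← map_add, Nat.cast_sub (by omega)]; congr 1; push_cast; ring
    have ha' : (C (32 * (a : ℂ) - 16) : PowerSeries ℂ) = 32 * C ((a : ℂ) - 1) + 16 := by
      rw [← map_ofNat C 32, ← map_ofNat C 16, ← map_mul, ← map_add]; congr 1; ring
    have hb' : (C (32 * (b : ℂ) - 16) : PowerSeries ℂ) = 32 * C ((b : ℂ) - 1) + 16 := by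
      rw [← map_ofNat C 32, ← map_ofNat C 16, ← map_mul, ← map_add]; congr 1; ring
    rw [ha'] at hTa
    rw [hb'] at hTb
    have hAe : eulerOp A = 0 := eulerOp_C _
    have hBe : eulerOp B = 0 := eulerOp_C _
    rw [hab]
    simp only [Derivation.leibniz, Derivation.leibniz_pow, map_add, hE2, hE512, hAe, hBe, eulerOp_X,
      smul_eq_mul, nsmul_eq_mul, mul_zero, add_zero, Nat.add_one_sub_one, pow_one]
    push_cast
    have h32 : (32 : PowerSeries ℂ) ≠ 0 := by norm_num
    refine mul_left_cancel₀ h32 ?_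
    linear_combination 2 * A * B * X ^ 2 * hu - 1024 * H * hZG - 1024 * G * hZH -
      512 * hsG - 512 * hsH - 512 * 32 * hEG - 512 * 32 * hEH - A * hTb - B * hTa

omit hG in
/-- The formal solution of the genus one one-point loop equation. -/
theorem onePoint_genus_one (ht : t ≠ 0) {D : PowerSeries ℂ} (hD0 : coeff 2 D = 0)
    (hD : 32 * (eulerOp D - 2 * D) = basisSeries t Y 0 ^ 2) :
    2 * Y * (C (-(1024 * t)⁻¹) * kernelComb (basisSeries t Y) 1) + (D - C (1 / 16) * X ^ 2) = 0 := by
  have hu := eulerOp_uSeries hY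
  have h0 := eight_mul_basisSeries (t := t) (Y := Y) 0
  have hX := X_mul_uSeries (t := t)
  have hYu := uSeries_mul_sq hY
  -- The closed form of `D`. The operator `w d/dw - 2` determines a series except for its
  -- coefficient at `w²`, which is why `hD0` is needed.
  have hDs : 4096 * D = X ^ 2 * (uSeries t - 16) ^ 2 := by
    have h1 : eulerOp (X ^ 2 * (uSeries t - 16) ^ 2) - 2 * (X ^ 2 * (uSeries t - 16) ^ 2) =
        eulerOp (4096 * D) - 2 * (4096 * D) := by
      have h8 : (8 : PowerSeries ℂ) ≠ 0 := by norm_num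
      refine mul_left_cancel₀ h8 ?_
      have hE : eulerOp (4096 : PowerSeries ℂ) = 0 := by rw [← map_ofNat C 4096, eulerOp_C]
      have hE' : eulerOp (16 : PowerSeries ℂ) = 0 := by rw [← map_ofNat C 16, eulerOp_C]
      simp only [Derivation.leibniz, Derivation.leibniz_pow, map_sub, eulerOp_X, hE, hE', smul_eq_mul,
        nsmul_eq_mul, mul_zero, add_zero, sub_zero, Nat.add_one_sub_one, pow_one]
      push_cast
      linear_combination X ^ 2 * (uSeries t - 16) * hu - 1024 * hD -
        16 * (8 * basisSeries t Y 0 + C t * X ^ 2 * Y * uSeries t ^ 2) * h0 -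
        16 * C t ^ 2 * X ^ 4 * uSeries t ^ 3 * hYu - X ^ 2 * uSeries t *
          (4 * C t * X * uSeries t + uSeries t - 16) * hX
    ext n
    have h2 := congrArg (coeff n) h1
    have h2' : (2 : PowerSeries ℂ) = C 2 := (map_ofNat _ _).symm
    rw [h2', map_sub, map_sub, coeff_C_mul, coeff_C_mul, coeff_eulerOp, coeff_eulerOp, ← sub_mul,
      ← sub_mul] at h2
    by_cases hn : n = 2
    · rw [hn, ← hX, ← map_ofNat C 4096, coeff_C_mul, hD0, coeff_X_pow_mul']
      simp [coeff_zero_eq_constantCoeff_apply]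
    · refine (mul_left_cancel₀ ?_ h2).symm
      rw [sub_ne_zero]
      exact_mod_cast hn
  have h1 := Y_mul_kernelComb hY 1
  have hκ : C (-(1024 * t)⁻¹) * (1024 * C t) = (-1 : PowerSeries ℂ) := by
    rw [← map_ofNat C 1024, ← map_mul, ← map_mul, neg_mul, inv_mul_cancel₀ (by simpa using ht)]
    simp
  have h16 : (C (1 / 16) : PowerSeries ℂ) * 16 = 1 := by
    rw [← map_ofNat C 16, ← map_mul]; simp
  have h4 : (4096 : PowerSeries ℂ) ≠ 0 := by norm_num
  refine mul_left_cancel₀ h4 ?_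
  rw [show kernelComb (fun i => uSeries t ^ (i + 1)) 1 = uSeries t ^ 2 - 32 * uSeries t by
    simp [kernelComb]] at h1
  linear_combination hDs - 256 * X ^ 2 * h16 + 1024 * C (-(1024 * t)⁻¹) * h1 +
    X ^ 2 * (uSeries t ^ 2 - 32 * uSeries t) * hκ

end FormalExpansion

end ModifiedGUE
end

noncomputable section
namespace ModifiedGUE
open Finset

/-! ### Residues -/

section Residues

/-- `f` has residue `c` at `0`: its integrals over all small circles around `0` exist and have
the value `2 π i c`. -/
def HasResidue (f : ℂ → ℂ) (c : ℂ) : Prop :=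
  ∀ᶠ r in 𝓝[>] (0 : ℝ), CircleIntegrable f 0 r ∧
    (2 * (Real.pi : ℂ) * Complex.I)⁻¹ * (∮ z in C(0, r), f z) = c

variable {f g : ℂ → ℂ} {c d : ℂ}

theorem HasResidue.residue_eq (h : HasResidue f c) : residue f 0 = c := by
  refine Tendsto.limUnder_eq (tendsto_nhds_of_eventually_eq ?_)
  filter_upwards [h] with r hr using hr.2

theorem HasResidue.congr (h : HasResidue f c) (hfg : ∀ᶠ z in 𝓝[≠] (0 : ℂ), f z = g z) :
    HasResidue g c := by
  rw [eventually_nhdsWithin_iff, Metric.eventually_nhds_iff] at hfg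
  obtain ⟨δ, hδ, hfg⟩ := hfg
  filter_upwards [h, Ioo_mem_nhdsGT hδ] with r hr hrδ
  have h1 : ∀ z ∈ Metric.sphere (0 : ℂ) r, f z = g z := fun z hz => by
    have hz' : dist z 0 = r := hz
    refine hfg (by rw [hz']; exact hrδ.2) fun h0 => ?_
    rw [h0, dist_self] at hz'
    exact hrδ.1.ne hz'
  rw [← circleIntegral.integral_congr hrδ.1.le h1]
  refine ⟨?_, hr.2⟩
  have h2 : (fun θ => f (circleMap 0 r θ)) = fun θ => g (circleMap 0 r θ) :=
    funext fun θ => h1 _ (circleMap_mem_sphere _ hrδ.1.le _)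
  have h3 := hr.1
  rw [CircleIntegrable] at h3 ⊢
  rwa [← h2]

theorem HasResidue.add (hf : HasResidue f c) (hg : HasResidue g d) :
    HasResidue (fun z => f z + g z) (c + d) := by
  filter_upwards [hf, hg] with r h1 h2
  refine ⟨h1.1.add h2.1, ?_⟩
  rw [circleIntegral.integral_add h1.1 h2.1, mul_add, h1.2, h2.2]

theorem HasResidue.const_mul (hf : HasResidue f c) (a : ℂ) :
    HasResidue (fun z => a * f z) (a * c) := by
  filter_upwards [hf] with r h1
  refine ⟨h1.1.const_smul (a := a), ?_⟩
  rw [circleIntegral.integral_const_mul, mul_left_comm, h1.2]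

theorem hasResidue_zero : HasResidue (fun _ => 0) 0 :=
  Eventually.of_forall fun r => ⟨circleIntegrable_const 0 0 r, by simp [circleIntegral]⟩

theorem HasResidue.sum {ι : Type*} {s : Finset ι} {f : ι → ℂ → ℂ} {c : ι → ℂ}
    (h : ∀ i ∈ s, HasResidue (f i) (c i)) :
    HasResidue (fun z => ∑ i ∈ s, f i z) (∑ i ∈ s, c i) := by
  classical
  induction s using Finset.induction_on with
  | empty => simpa using hasResidue_zero
  | insert i s hi ih =>
    simp only [sum_insert hi]
    exact (h i (mem_insert_self i s)).add (ih fun j hj => h j (mem_insert_of_mem hj))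

theorem hasResidue_inv_mul (hf : AnalyticAt ℂ f 0) : HasResidue (fun z => z⁻¹ * f z) (f 0) := by
  obtain ⟨δ, hδ, h⟩ := Metric.eventually_nhds_iff_ball.mp hf.eventually_analyticAt
  filter_upwards [Ioo_mem_nhdsGT hδ] with r hr
  have hd : DifferentiableOn ℂ f (Metric.closedBall 0 r) := fun z hz =>
    (h z (Metric.closedBall_subset_ball hr.2 hz)).differentiableAt.differentiableWithinAt
  constructor
  · refine ContinuousOn.circleIntegrable hr.1.le (ContinuousOn.mul ?_
      (hd.continuousOn.mono Metric.sphere_subset_closedBall))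
    refine continuousOn_inv₀.mono fun z hz => ?_
    rintro rfl
    exact hr.1.ne (by simpa using hz)
  · have h1 := (hd.diffContOnCl_ball subset_rfl).two_pi_i_inv_smul_circleIntegral_sub_inv_smul
      (Metric.mem_ball_self hr.1)
    simpa using h1

theorem hasResidue_of_analyticAt (hf : AnalyticAt ℂ f 0) : HasResidue f 0 := by
  have h := hasResidue_inv_mul (analyticAt_id.mul hf)
  simp only [Pi.mul_apply, id, zero_mul] at h
  refine h.congr ?_
  filter_upwards [self_mem_nhdsWithin] with z hz
  exact inv_mul_cancel_left₀ hz _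

theorem hasResidue_zpow (n : ℤ) : HasResidue (fun z => z ^ n) (if n = -1 then 1 else 0) := by
  filter_upwards [self_mem_nhdsWithin] with r hr
  have hr' : r ≠ 0 := ne_of_gt hr
  constructor
  · have h := (circleIntegrable_sub_zpow_iff (c := 0) (w := 0) (R := r) (n := n)).mpr
      (Or.inr (Or.inr (by simpa [eq_comm (a := (0 : ℝ))] using hr')))
    simpa using h
  · split_ifs with h
    · subst h
      have h1 := circleIntegral.integral_sub_center_inv 0 hr'
      simp only [sub_zero] at h1
      simp only [zpow_neg_one]
      rw [h1, inv_mul_cancel₀ Complex.two_pi_I_ne_zero]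
    · have h1 := circleIntegral.integral_sub_zpow_of_ne h 0 0 r
      simp only [sub_zero] at h1
      rw [h1, mul_zero]

/-- `φ` is the Taylor expansion of `f` at `0`. -/
def HasTaylor (f : ℂ → ℂ) (φ : PowerSeries ℂ) : Prop :=
  ∀ k, ∃ P : Polynomial ℂ, (∀ i < k, P.coeff i = PowerSeries.coeff i φ) ∧
    ∃ h, AnalyticAt ℂ h 0 ∧ ∀ᶠ v in 𝓝 (0 : ℂ), f v = P.eval v + v ^ k * h v

theorem hasTaylor_polynomial (P : Polynomial ℂ) : HasTaylor (fun v => P.eval v) P := fun k =>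
  ⟨P, fun i _ => (Polynomial.coeff_coe P i).symm, fun _ => 0, analyticAt_const, by simp⟩

theorem analyticAt_polynomial (P : Polynomial ℂ) (z : ℂ) : AnalyticAt ℂ (fun v => P.eval v) z :=
  P.differentiable.analyticAt z

theorem HasTaylor.mul {φ ψ : PowerSeries ℂ} (hf : HasTaylor f φ) (hg : HasTaylor g ψ) :
    HasTaylor (fun v => f v * g v) (φ * ψ) := by
  intro k
  obtain ⟨P, hP, h, hh, hfP⟩ := hf k
  obtain ⟨Q, hQ, l, hl, hgQ⟩ := hg k
  refine ⟨P * Q, fun i hi => ?_, fun v => P.eval v * l v + h v * Q.eval v + v ^ k * h v * l v,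
    ?_, ?_⟩
  · rw [Polynomial.coeff_mul, PowerSeries.coeff_mul]
    refine sum_congr rfl fun p hp => ?_
    have := mem_antidiagonal.mp hp
    rw [hP _ (by omega), hQ _ (by omega)]
  · exact (((analyticAt_polynomial P 0).mul hl).add (hh.mul (analyticAt_polynomial Q 0))).add
      (((analyticAt_id.pow k).mul hh).mul hl)
  · filter_upwards [hfP, hgQ] with v h1 h2
    rw [h1, h2, Polynomial.eval_mul]
    ring

theorem HasTaylor.congr {φ : PowerSeries ℂ} (hf : HasTaylor f φ) (h : f =ᶠ[𝓝 0] g) :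
    HasTaylor g φ := fun k => by
  obtain ⟨P, hP, l, hl, hfP⟩ := hf k
  exact ⟨P, hP, l, hl, by filter_upwards [hfP, h] with v h1 h2; rw [← h2, h1]⟩

theorem hasTaylor_inv_sub {V : ℂ} (hV : V ≠ 0) :
    HasTaylor (fun v => (V - v)⁻¹) (PowerSeries.mk fun i => V⁻¹ ^ (i + 1)) := by
  intro k
  refine ⟨∑ i ∈ range k, Polynomial.monomial i (V⁻¹ ^ (i + 1)), fun i hi => ?_,
    fun v => V⁻¹ ^ k * (V - v)⁻¹, ?_, ?_⟩
  · rw [Polynomial.finsetSum_coeff, PowerSeries.coeff_mk]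
    simp only [Polynomial.coeff_monomial]
    rw [sum_ite_eq', if_pos (mem_range.mpr hi)]
  · exact analyticAt_const.mul ((analyticAt_const.sub analyticAt_id).inv (by simpa using hV))
  · have h1 : ∀ᶠ v in 𝓝 (0 : ℂ), v ≠ V := eventually_ne_nhds hV.symm
    filter_upwards [h1] with v hv
    have hv' : V - v ≠ 0 := sub_ne_zero.mpr hv.symm
    rw [Polynomial.eval_finsetSum]
    induction k with
    | zero => simp
    | succ k ih =>
      refine ih.trans ?_
      rw [sum_range_succ, Polynomial.eval_monomial, add_assoc, inv_pow, inv_pow]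
      congr 1
      field_simp
      ring

/-- In `z^(-1-2k) f(z²)` the residue comes only from the term `v^k` of the expansion of `f(v)`. -/
theorem HasTaylor.hasResidue {φ : PowerSeries ℂ} (hf : HasTaylor f φ) (k : ℕ) :
    HasResidue (fun z => z⁻¹ * ((z ^ 2)⁻¹ ^ k * f (z ^ 2))) (PowerSeries.coeff k φ) := by
  -- At order `k + 1` the remainder contributes the analytic function `z h(z²)`.
  obtain ⟨P, hP, h, hh, hfP⟩ := hf (k + 1)
  have h1 : HasResidue (fun z => ∑ i ∈ range (P.natDegree + 1 + k),
      P.coeff i * z ^ (2 * (i : ℤ) - 2 * k - 1)) (∑ i ∈ range (P.natDegree + 1 + k), P.coeff i *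
        if 2 * (i : ℤ) - 2 * k - 1 = -1 then 1 else 0) :=
    HasResidue.sum fun i _ => (hasResidue_zpow _).const_mul _
  have h2 : (∑ i ∈ range (P.natDegree + 1 + k), P.coeff i *
        if 2 * (i : ℤ) - 2 * k - 1 = -1 then 1 else 0) = PowerSeries.coeff k φ := by
    rw [sum_eq_single k, if_pos (by ring), mul_one, hP k (by omega)]
    · intro i _ hi
      rw [if_neg (by omega), mul_zero]
    · intro hk
      exact absurd (mem_range.mpr (by omega)) hk
  have ht : Tendsto (fun z : ℂ => z ^ 2) (𝓝 0) (𝓝 0) := by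
    have : ContinuousAt (fun z : ℂ => z ^ 2) 0 := by fun_prop
    simpa using this.tendsto
  have h3 : AnalyticAt ℂ (fun z => z * h (z ^ 2)) 0 := by
    refine analyticAt_id.mul (AnalyticAt.fun_comp ?_ (analyticAt_id.pow 2))
    simpa using hh
  have h4 := h1.add (hasResidue_of_analyticAt h3)
  rw [h2, add_zero] at h4
  refine h4.congr ?_
  filter_upwards [self_mem_nhdsWithin, (ht.eventually hfP).filter_mono nhdsWithin_le_nhds]
    with z hz hz2
  have hz : z ≠ 0 := hz
  rw [hz2, Polynomial.eval_eq_sum_range' (show P.natDegree < P.natDegree + 1 + k by omega), mul_add,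
    mul_add, mul_sum, mul_sum]
  congr 1
  · refine sum_congr rfl fun i _ => ?_
    rw [zpow_sub₀ hz, zpow_sub₀ hz, zpow_one, zpow_mul, zpow_mul, zpow_natCast, zpow_natCast]
    have h2 : z ^ (2 : ℤ) = z ^ 2 := by norm_cast
    rw [h2, inv_pow]
    field_simp
  · rw [inv_pow, pow_succ (z ^ 2) k]
    field_simp

end Residues

/-! ### The recursion kernel -/

section Kernel

theorem hasDerivAt_curve_x (t : ℂ) {y : ℂ} (hy : 16 * y ^ 2 ≠ 1) :
    HasDerivAt (curve t).x (128 * t * y / (1 - 16 * y ^ 2) ^ 2) y := by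
  have h0 : 1 - 16 * y ^ 2 ≠ 0 := sub_ne_zero.mpr hy.symm
  have h1 : HasDerivAt (fun y : ℂ => 1 - 16 * y ^ 2) (-(16 * (2 * y))) y := by
    simpa using (((hasDerivAt_id y).pow 2).const_mul 16).const_sub 1
  have h2 := (hasDerivAt_const y (4 * t)).div h1 h0
  exact h2.congr_deriv (by ring)

/-- The integral from `-p` to `p` is `1/(z₀ - p) - 1/(z₀ + p) = 2p/(z₀² - p²)`, and `‖p‖ < ‖z₀‖`
keeps the segment off the pole. Apart from `p⁻¹` the kernel depends only on `p²`. -/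
theorem kernel_eq (t : ℂ) (z₀ : ℂ) {p : ℂ} (hp : p ≠ 0) (hz : ‖p‖ < ‖z₀‖) (hp' : 16 * p ^ 2 ≠ 1) :
    (curve t).kernel z₀ p = p⁻¹ * ((256 * t)⁻¹ * ((1 - 16 * p ^ 2) ^ 2 * (z₀ ^ 2 - p ^ 2)⁻¹)) := by
  have h1 : ∀ s ∈ Set.Icc (0 : ℝ) 1, z₀ - (-p + (s : ℂ) * (p - -p)) ≠ 0 := by
    intro s hs h
    have h2 : z₀ = ((2 * s - 1 : ℝ) : ℂ) * p := by push_cast; linear_combination h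
    have h3 : ‖z₀‖ ≤ ‖p‖ := by
      rw [h2, norm_mul, Complex.norm_real]
      refine mul_le_of_le_one_left (norm_nonneg _) ?_
      rw [Real.norm_eq_abs, abs_le]
      constructor <;> linarith [hs.1, hs.2]
    exact absurd hz (not_lt.mpr h3)
  have h2 : ∫ s in (0 : ℝ)..1, (curve t).B z₀ ((curve t).σ p + (s : ℂ) * (p - (curve t).σ p)) *
      (p - (curve t).σ p) = (z₀ - p)⁻¹ - (z₀ + p)⁻¹ := by
    have h3 : ∀ s ∈ Set.uIcc (0 : ℝ) 1, HasDerivAt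
        (fun s : ℝ => (z₀ - (-p + (s : ℂ) * (p - -p)))⁻¹)
        ((curve t).B z₀ ((curve t).σ p + (s : ℂ) * (p - (curve t).σ p)) * (p - (curve t).σ p)) s := by
      intro s hs
      rw [Set.uIcc_of_le zero_le_one] at hs
      have h4 : HasDerivAt (fun s : ℝ => z₀ - (-p + (s : ℂ) * (p - -p))) (-(1 * (p - -p))) s :=
        (((Complex.ofRealCLM.hasDerivAt (x := s)).mul_const (p - -p)).const_add (-p)).const_sub z₀
      refine (h4.inv (h1 s hs)).congr_deriv ?_
      change _ = 1 / (z₀ - (-p + (s : ℂ) * (p - -p))) ^ 2 * (p - -p)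
      ring
    rw [intervalIntegral.integral_eq_sub_of_hasDerivAt h3]
    · congr 2
      · push_cast; ring
      · push_cast; ring
    · refine ContinuousOn.intervalIntegrable ?_
      rw [Set.uIcc_of_le zero_le_one]
      change ContinuousOn (fun s : ℝ => 1 / (z₀ - (-p + (s : ℂ) * (p - -p))) ^ 2 * (p - -p)) _
      refine ContinuousOn.mul ?_ continuousOn_const
      refine ContinuousOn.div continuousOn_const (by fun_prop) fun s hs => ?_
      exact pow_ne_zero 2 (h1 s hs)
  have h3 := (hasDerivAt_curve_x t hp').deriv
  rw [SpectralCurve.kernel, h2, h3]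
  have h4 : z₀ - p ≠ 0 := fun h => by rw [sub_eq_zero.mp h] at hz; exact lt_irrefl _ hz
  have h5 : z₀ + p ≠ 0 := fun h => by
    rw [eq_neg_of_add_eq_zero_left h, norm_neg] at hz; exact lt_irrefl _ hz
  have h6 : 1 - 16 * p ^ 2 ≠ 0 := sub_ne_zero.mpr hp'.symm
  have h7 : z₀ ^ 2 - p ^ 2 ≠ 0 := by
    rw [show z₀ ^ 2 - p ^ 2 = (z₀ - p) * (z₀ + p) by ring]; exact mul_ne_zero h4 h5
  rcases eq_or_ne t 0 with rfl | ht
  · simp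
  simp only [curve]
  rw [show z₀ ^ 2 - p ^ 2 = (z₀ - p) * (z₀ + p) by ring]
  field_simp
  ring

theorem eventually_kernel_eq (t : ℂ) {z₀ : ℂ} (hz : z₀ ≠ 0) : ∀ᶠ p in 𝓝[≠] (0 : ℂ),
    (curve t).kernel z₀ p = p⁻¹ * ((256 * t)⁻¹ * ((1 - 16 * p ^ 2) ^ 2 * (z₀ ^ 2 - p ^ 2)⁻¹)) := by
  have h1 : ∀ᶠ p in 𝓝 (0 : ℂ), ‖p‖ < ‖z₀‖ := by
    have : ContinuousAt (fun p : ℂ => ‖p‖) 0 := by fun_prop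
    exact this.eventually_lt continuousAt_const (by simpa using hz)
  have h2 : ∀ᶠ p in 𝓝 (0 : ℂ), 16 * p ^ 2 ≠ 1 := by
    have : ContinuousAt (fun p : ℂ => 16 * p ^ 2) 0 := by fun_prop
    exact this.eventually_ne (by simp)
  filter_upwards [self_mem_nhdsWithin, h1.filter_mono nhdsWithin_le_nhds,
    h2.filter_mono nhdsWithin_le_nhds] with p h3 h4 h5 using kernel_eq t z₀ h3 h4 h5

/-- The Taylor expansion of the regular part of the kernel, in terms of `v = y²`. -/
def kernelSeries (t z₀ : ℂ) : PowerSeries ℂ :=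
  PowerSeries.C (256 * t)⁻¹ * ((1 - 16 * PowerSeries.X) ^ 2 *
    PowerSeries.mk fun i => (z₀ ^ 2)⁻¹ ^ (i + 1))

theorem hasTaylor_kernelSeries (t : ℂ) {z₀ : ℂ} (hz : z₀ ≠ 0) :
    HasTaylor (fun v => (256 * t)⁻¹ * ((1 - 16 * v) ^ 2 * (z₀ ^ 2 - v)⁻¹)) (kernelSeries t z₀) := by
  have h1 := hasTaylor_polynomial (Polynomial.C (256 * t)⁻¹)
  have h2 := hasTaylor_polynomial ((1 - 16 * Polynomial.X) ^ 2)
  have h3 := h1.mul (h2.mul (hasTaylor_inv_sub (pow_ne_zero 2 hz)))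
  have h16 : Polynomial.toPowerSeries (16 : Polynomial ℂ) = 16 :=
    map_ofNat (Polynomial.coeToPowerSeries.ringHom (R := ℂ)) 16
  simpa [kernelSeries, h16] using h3

/-- The geometric series of `1/(z₀² - v)` has the basis functions of `z₀` as coefficients;
multiplication by `(1 - 16 v)² = 1 - 32 v + 256 v²` combines them as in `kernelComb`. -/
theorem coeff_kernelSeries (t z₀ : ℂ) (k : ℕ) : PowerSeries.coeff k (kernelSeries t z₀) =
    (256 * t)⁻¹ * kernelComb (fun i => (z₀ ^ 2)⁻¹ ^ (i + 1)) k := by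
  have h16 : (16 : PowerSeries ℂ) = PowerSeries.C 16 := (map_ofNat _ 16).symm
  set m : PowerSeries ℂ := PowerSeries.mk fun i => (z₀ ^ 2)⁻¹ ^ (i + 1) with hm
  rw [kernelSeries, PowerSeries.coeff_C_mul, ← hm, show (1 - 16 * PowerSeries.X) ^ 2 * m =
    m - PowerSeries.X * (PowerSeries.C 32 * m) + PowerSeries.X * (PowerSeries.X * (PowerSeries.C 256 * m)) by
      rw [map_ofNat, map_ofNat]; ring]
  congr 1
  rcases k with _ | _ | k
  · simp [kernelComb, hm]
  · simp [kernelComb, hm, PowerSeries.coeff_succ_X_mul]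
  · simp [kernelComb, hm, PowerSeries.coeff_succ_X_mul]

/-- Residues of even sources. -/
theorem HasTaylor.hasResidue_kernel {f : ℂ → ℂ} {φ : PowerSeries ℂ} (hf : HasTaylor f φ) (t : ℂ)
    {z₀ : ℂ} (hz : z₀ ≠ 0) (k : ℕ) :
    HasResidue (fun p => (curve t).kernel z₀ p * ((p ^ 2)⁻¹ ^ k * f (p ^ 2)))
      (PowerSeries.coeff k (kernelSeries t z₀ * φ)) := by
  refine (((hasTaylor_kernelSeries t hz).mul hf).hasResidue k).congr ?_
  filter_upwards [eventually_kernel_eq t hz] with p hp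
  rw [hp]
  ring

theorem hasResidue_kernel_pow (t : ℂ) {z₀ : ℂ} (hz : z₀ ≠ 0) (k : ℕ) :
    HasResidue (fun p => (curve t).kernel z₀ p * (p ^ 2)⁻¹ ^ k)
      ((256 * t)⁻¹ * kernelComb (fun i => (z₀ ^ 2)⁻¹ ^ (i + 1)) k) := by
  have h := (hasTaylor_polynomial 1).hasResidue_kernel t hz k
  simp only [Polynomial.eval_one, mul_one, Polynomial.coe_one, coeff_kernelSeries] at h
  exact h

/-- With `V = y²` and `v = p²` this is the even combination `1/(p - y)² + 1/(p + y)²`. -/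
theorem hasTaylor_bergman {V : ℂ} (hV : V ≠ 0) : HasTaylor (fun v => 2 * (V + v) * ((V - v) ^ 2)⁻¹)
    (PowerSeries.mk fun l => 2 * (2 * (l : ℂ) + 1) * V⁻¹ ^ (l + 1)) := by
  have h1 := (hasTaylor_polynomial (Polynomial.C 2 * (Polynomial.C V + Polynomial.X))).mul
    ((hasTaylor_inv_sub hV).mul (hasTaylor_inv_sub hV))
  have h2 : ((Polynomial.C 2 * (Polynomial.C V + Polynomial.X) : Polynomial ℂ) : PowerSeries ℂ) *
      ((PowerSeries.mk fun i => V⁻¹ ^ (i + 1)) * PowerSeries.mk fun i => V⁻¹ ^ (i + 1)) =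
      PowerSeries.mk fun l => 2 * (2 * (l : ℂ) + 1) * V⁻¹ ^ (l + 1) := by
    have h3 : (PowerSeries.C V - PowerSeries.X) * (PowerSeries.mk fun i => V⁻¹ ^ (i + 1)) = 1 := by
      ext n
      rw [sub_mul, map_sub, PowerSeries.coeff_C_mul, PowerSeries.coeff_one]
      rcases n with _ | n
      · simp [hV]
      · rw [PowerSeries.coeff_succ_X_mul]
        simp only [PowerSeries.coeff_mk]
        rw [if_neg (by omega), pow_succ V⁻¹ (n + 1)]
        field_simp
        ring
    have h4 : (PowerSeries.C V - PowerSeries.X) ^ 2 *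
        (PowerSeries.mk fun l => 2 * (2 * (l : ℂ) + 1) * V⁻¹ ^ (l + 1)) =
        PowerSeries.C 2 * (PowerSeries.C V + PowerSeries.X) := by
      set M : PowerSeries ℂ := PowerSeries.mk fun l => 2 * (2 * (l : ℂ) + 1) * V⁻¹ ^ (l + 1) with hM
      rw [show (PowerSeries.C V - PowerSeries.X) ^ 2 * M = PowerSeries.C (V ^ 2) * M -
        PowerSeries.X * (PowerSeries.C (2 * V) * M) + PowerSeries.X * (PowerSeries.X * M) by
          rw [map_mul, map_pow, map_ofNat]; ring]
      ext n
      rcases n with _ | _ | n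
      · simp [hM]
        field_simp
      · rw [map_add, map_sub, PowerSeries.coeff_C_mul, PowerSeries.coeff_succ_X_mul,
          PowerSeries.coeff_succ_X_mul, PowerSeries.coeff_C_mul, PowerSeries.coeff_C_mul, map_add,
          PowerSeries.coeff_C, PowerSeries.coeff_X, hM]
        simp only [PowerSeries.coeff_mk]
        simp
        field_simp
        ring
      · rw [map_add, map_sub, PowerSeries.coeff_C_mul, PowerSeries.coeff_succ_X_mul,
          PowerSeries.coeff_succ_X_mul, PowerSeries.coeff_C_mul, PowerSeries.coeff_C_mul, map_add,
          PowerSeries.coeff_C, PowerSeries.coeff_X, PowerSeries.coeff_succ_X_mul, hM]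
        simp only [PowerSeries.coeff_mk]
        rw [if_neg (by omega), if_neg (by omega)]
        push_cast
        linear_combination V⁻¹ ^ (n + 1) * ((4 * (n : ℂ) + 10) * V * V⁻¹ - (4 * n + 2)) *
          mul_inv_cancel₀ hV
    set m : PowerSeries ℂ := PowerSeries.mk fun i => V⁻¹ ^ (i + 1)
    set M : PowerSeries ℂ := PowerSeries.mk fun l => 2 * (2 * (l : ℂ) + 1) * V⁻¹ ^ (l + 1)
    simp only [Polynomial.coe_mul, Polynomial.coe_add, Polynomial.coe_C, Polynomial.coe_X]
    rw [← h4]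
    linear_combination M * ((PowerSeries.C V - PowerSeries.X) * m + 1) * h3
  rw [h2] at h1
  refine h1.congr (Eventually.of_forall fun v => ?_)
  simp only [Polynomial.eval_mul, Polynomial.eval_C, Polynomial.eval_add, Polynomial.eval_X]
  rw [← mul_inv, ← sq]

/-- The residue of a source with a factor `ω_{0,2}`. -/
theorem hasResidue_kernel_bergman (t : ℂ) {z₀ y : ℂ} (hz : z₀ ≠ 0) (hy : y ≠ 0) (k : ℕ) :
    HasResidue (fun p => (curve t).kernel z₀ p *
      ((p ^ 2)⁻¹ ^ (k + 1) * (1 / (p - y) ^ 2 + 1 / (-p - y) ^ 2)))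
      ((128 * t)⁻¹ * ∑ l ∈ range (k + 2), (2 * (l : ℂ) + 1) * (y ^ 2)⁻¹ ^ (l + 1) *
        kernelComb (fun i => (z₀ ^ 2)⁻¹ ^ (i + 1)) (k + 1 - l)) := by
  have h := (hasTaylor_bergman (pow_ne_zero 2 hy)).hasResidue_kernel t hz (k + 1)
  rw [mul_comm (kernelSeries t z₀), PowerSeries.coeff_mul,
    Finset.Nat.sum_antidiagonal_eq_sum_range_succ_mk] at h
  simp only [PowerSeries.coeff_mk, coeff_kernelSeries] at h
  convert h.congr ?_ using 1
  · rw [mul_sum]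
    refine sum_congr rfl fun l _ => ?_
    rw [show (128 * t)⁻¹ = 2 * (256 * t)⁻¹ by
      rw [show 256 * t = 2 * (128 * t) by ring, mul_inv 2]; ring]
    ring
  · have h1 : ∀ᶠ p in 𝓝[≠] (0 : ℂ), p ≠ y := (eventually_ne_nhds hy.symm).filter_mono nhdsWithin_le_nhds
    have h2 : ∀ᶠ p in 𝓝[≠] (0 : ℂ), p ≠ -y :=
      (eventually_ne_nhds (neg_ne_zero.mpr hy).symm).filter_mono nhdsWithin_le_nhds
    filter_upwards [h1, h2] with p hp1 hp2
    have h3 : p - y ≠ 0 := sub_ne_zero.mpr hp1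
    have h4 : -p - y ≠ 0 := fun h => hp2 (by linear_combination -h)
    have h5 : y ^ 2 - p ^ 2 ≠ 0 := by
      rw [show y ^ 2 - p ^ 2 = (p - y) * (-p - y) by ring]; exact mul_ne_zero h3 h4
    congr 2
    rw [show y ^ 2 - p ^ 2 = (p - y) * (-p - y) by ring]
    field_simp
    ring

end Kernel
end ModifiedGUE
end

noncomputable section
namespace ModifiedGUE
open Finset

/-! ### Sources and their solutions -/

section SubsetTuples

variable {n : ℕ} (I : Finset (Fin n))

theorem prod_orderEmbOfFin {M : Type*} [CommMonoid M] (f : Fin n → M) :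
    ∏ i, f (I.orderEmbOfFin rfl i) = ∏ i ∈ I, f i := by
  conv_rhs => rw [← Finset.map_orderEmbOfFin_univ I rfl, prod_map]
  rfl

theorem exists_tuple_of_subsets (k : Fin I.card → ℕ) (l : Fin Iᶜ.card → ℕ) : ∃ c : Fin n → ℕ,
    (∀ i, c (I.orderEmbOfFin rfl i) = k i) ∧ ∀ i, c (Iᶜ.orderEmbOfFin rfl i) = l i := by
  classical
  refine ⟨fun i => if h : i ∈ I then k ((I.orderIsoOfFin rfl).symm ⟨i, h⟩) else
    l ((Iᶜ.orderIsoOfFin rfl).symm ⟨i, mem_compl.mpr h⟩), fun i => ?_, fun i => ?_⟩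
  · have h := I.orderEmbOfFin_mem rfl i
    simp only [h, dif_pos]
    congr 1
    rw [OrderIso.symm_apply_eq]
    rfl
  · have h := mem_compl.mp (Iᶜ.orderEmbOfFin_mem rfl i)
    simp only [h, dif_neg, not_false_eq_true]
    congr 1
    rw [OrderIso.symm_apply_eq]
    rfl

end SubsetTuples

section Sources
open PowerSeries

/-- Extension by zero to the index `0`. -/
def extendZero : (ℕ+ → ℂ) →ₗ[ℂ] (ℕ → ℂ) where
  toFun f m := if h : 0 < m then f ⟨m, h⟩ else 0
  map_add' f g := by
    funext m
    by_cases h : 0 < m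
    · simp only [Pi.add_apply, dif_pos h]
      rfl
    · simp [h]
  map_smul' c f := by
    funext m
    by_cases h : 0 < m
    · simp only [Pi.smul_apply, dif_pos h, RingHom.id_apply]
      rfl
    · simp [h]

theorem extendZero_pnat (f : ℕ+ → ℂ) (m : ℕ+) : extendZero f m = f m := dif_pos m.pos

theorem extendZero_apply_zero (f : ℕ+ → ℂ) : extendZero f 0 = 0 := rfl

theorem extendZero_eq {f : ℕ+ → ℂ} {F : ℕ → ℂ} (h0 : F 0 = 0) (h : ∀ m : ℕ+, F m = f m) :
    extendZero f = F := by
  funext m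
  rcases Nat.eq_zero_or_pos m with rfl | hm
  · rw [h0, extendZero_apply_zero]
  · lift m to ℕ+ using hm
    rw [extendZero_pnat, h]

/-- The generating series `∑_m f_m w^(m+1)`. -/
def genSeries : (ℕ+ → ℂ) →ₗ[ℂ] PowerSeries ℂ where
  toFun f := X * PowerSeries.mk (extendZero f)
  map_add' f g := by
    rw [map_add, ← mul_add]
    rfl
  map_smul' c f := by
    rw [map_smul, RingHom.id_apply, ← mul_smul_comm]
    rfl

theorem genSeries_apply (f : ℕ+ → ℂ) : genSeries f = X * PowerSeries.mk (extendZero f) := rfl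

theorem coeff_genSeries (f : ℕ+ → ℂ) (m : ℕ+) : coeff ((m : ℕ) + 1) (genSeries f) = f m := by
  rw [genSeries_apply, coeff_succ_X_mul, coeff_mk, extendZero_pnat]

/-- The generating series `∑_{p,q} f_{p,q} w^(p+q+2)`. -/
def pairSeries : (ℕ+ → ℕ+ → ℂ) →ₗ[ℂ] PowerSeries ℂ where
  toFun f := X ^ 2 * PowerSeries.mk fun m => ∑ p ∈ antidiagonal m,
    extendZero (fun i => extendZero (f i) p.2) p.1
  map_add' f g := by
    rw [← mul_add]
    congr 1
    ext m
    rw [coeff_mk, map_add, coeff_mk, coeff_mk, ← sum_add_distrib]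
    refine sum_congr rfl fun p _ => ?_
    rw [show (fun i => extendZero ((f + g) i) p.2) =
      (fun i => extendZero (f i) p.2) + fun i => extendZero (g i) p.2 by
        funext i; rw [Pi.add_apply, map_add]; rfl, map_add, Pi.add_apply]
  map_smul' c f := by
    rw [RingHom.id_apply, ← mul_smul_comm]
    congr 1
    ext m
    rw [coeff_mk, map_smul, coeff_mk, smul_sum]
    refine sum_congr rfl fun p _ => ?_
    rw [show (fun i => extendZero ((c • f) i) p.2) = c • fun i => extendZero (f i) p.2 by
        funext i; rw [Pi.smul_apply, map_smul]; rfl, map_smul, Pi.smul_apply]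

theorem pairSeries_apply (f : ℕ+ → ℕ+ → ℂ) : pairSeries f =
    X ^ 2 * PowerSeries.mk fun m => ∑ p ∈ antidiagonal m,
      extendZero (fun i => extendZero (f i) p.2) p.1 := rfl

variable (t : ℂ) (Y : PowerSeries ℂ)

theorem genSeries_basisCoeff (k : ℕ) :
    genSeries (fun m : ℕ+ => basisCoeff t Y k m) = basisSeries t Y k := by
  rw [genSeries_apply, extendZero_eq (basisCoeff_zero k) fun m => rfl, ← basisSeries_eq]

theorem pairSeries_basisCoeff (k l : ℕ) :
    pairSeries (fun p q => basisCoeff t Y k p * basisCoeff t Y l q) =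
      basisSeries t Y k * basisSeries t Y l := by
  have h : ∀ p : ℕ × ℕ, extendZero (fun i : ℕ+ => extendZero (fun q : ℕ+ =>
      basisCoeff t Y k i * basisCoeff t Y l q) p.2) p.1 =
      basisCoeff t Y k p.1 * basisCoeff t Y l p.2 := fun p => by
    have h1 : ∀ i : ℕ+, extendZero (fun q : ℕ+ => basisCoeff t Y k i * basisCoeff t Y l q) =
        fun q => basisCoeff t Y k i * basisCoeff t Y l q := fun i =>
      extendZero_eq (by rw [basisCoeff_zero, mul_zero]) fun m => rfl
    simp only [h1]
    rw [extendZero_eq (F := fun i => basisCoeff t Y k i * basisCoeff t Y l p.2)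
      (by rw [basisCoeff_zero, zero_mul]) fun m => rfl]
  simp only [pairSeries_apply, h]
  rw [basisSeries_eq k, basisSeries_eq l, show (X * PowerSeries.mk (basisCoeff t Y k)) *
    (X * PowerSeries.mk (basisCoeff t Y l)) = X ^ 2 * (PowerSeries.mk (basisCoeff t Y k) *
      PowerSeries.mk (basisCoeff t Y l)) by ring]
  congr 1
  ext m
  simp [coeff_mul]

/-- An elementary multidifferential together with the coefficients of its expansion. -/
def basisPair {n : ℕ} (k : Fin n → ℕ) : ((Fin n → ℂ) → ℂ) × ((Fin n → ℕ+) → ℂ) :=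
  (fun y => ∏ i, (y i ^ 2)⁻¹ ^ (k i + 1), fun a => ∏ i, basisCoeff t Y (k i) (a i))

/-- The space of multidifferentials that are polynomial in the `y_i^(-2)`, together with their
expansions. -/
def basisSpan (n : ℕ) : Submodule ℂ (((Fin n → ℂ) → ℂ) × ((Fin n → ℕ+) → ℂ)) :=
  Submodule.span ℂ (Set.range fun k => basisPair t Y k)

variable {t Y} {n : ℕ}

theorem basisPair_mem (k : Fin n → ℕ) : basisPair t Y k ∈ basisSpan t Y n :=
  Submodule.subset_span ⟨k, rfl⟩

theorem kernelComb_mem {M : Type*} [AddCommGroup M] [Module ℂ M] {V : Submodule ℂ M} {b : ℕ → M}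
    (h : ∀ i, b i ∈ V) (k : ℕ) : kernelComb b k ∈ V := by
  rcases k with _ | _ | k
  · exact h 0
  · exact V.sub_mem (h 1) (V.nsmul_mem (h 0) _)
  · exact V.add_mem (V.sub_mem (h _) (V.nsmul_mem (h _) _)) (V.nsmul_mem (h _) _)

theorem kernelComb_basisPair_fst (k : Fin n → ℕ) (i : ℕ) (z : ℂ) (y : Fin n → ℂ) :
    (kernelComb (fun j => basisPair t Y (Fin.cons j k : Fin (n + 1) → ℕ)) i).1 (Fin.cons z y) =
      kernelComb (fun j => (z ^ 2)⁻¹ ^ (j + 1)) i * ∏ i, (y i ^ 2)⁻¹ ^ (k i + 1) := by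
  rcases i with _ | _ | i <;>
    simp [kernelComb, basisPair, Fin.prod_univ_succ, sub_mul, add_mul, mul_assoc] <;> ring

theorem genSeries_smul_basisCoeff (c : ℂ) (j : ℕ) :
    genSeries (fun m : ℕ+ => basisCoeff t Y j m * c) = C c * basisSeries t Y j := by
  rw [← genSeries_basisCoeff, ← smul_eq_C_mul, ← map_smul]
  congr 1
  funext m
  exact mul_comm _ _

theorem genSeries_kernelComb_basisPair (k : Fin n → ℕ) (i : ℕ) (a : Fin n → ℕ+) :
    genSeries (fun m => (kernelComb (fun j => basisPair t Y (Fin.cons j k : Fin (n + 1) → ℕ)) i).2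
      (Fin.cons m a)) = C (∏ i, basisCoeff t Y (k i) (a i)) * kernelComb (basisSeries t Y) i := by
  have h0 : ∀ j, (fun m : ℕ+ => (basisPair t Y (Fin.cons j k : Fin (n + 1) → ℕ)).2 (Fin.cons m a)) =
      fun m : ℕ+ => basisCoeff t Y j m * ∏ i, basisCoeff t Y (k i) (a i) := fun j => by
    funext m
    simp [basisPair, Fin.prod_univ_succ]
  let e : ((Fin (n + 1) → ℂ) → ℂ) × ((Fin (n + 1) → ℕ+) → ℂ) →+ PowerSeries ℂ :=
    { toFun := fun Φ => genSeries (fun m => Φ.2 (Fin.cons m a))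
      map_zero' := map_zero genSeries
      map_add' := fun Φ Ψ => map_add genSeries (fun m => Φ.2 (Fin.cons m a)) _ }
  have h1 := map_kernelComb e (fun j => basisPair t Y (Fin.cons j k : Fin (n + 1) → ℕ)) i
  have h2 := map_kernelComb (AddMonoidHom.mulLeft (C (∏ i, basisCoeff t Y (k i) (a i))))
    (basisSeries t Y) i
  refine h1.trans (Eq.trans ?_ h2.symm)
  congr 1
  funext j
  change genSeries (fun m => (basisPair t Y (Fin.cons j k : Fin (n + 1) → ℕ)).2 (Fin.cons m a)) = _
  rw [h0, genSeries_smul_basisCoeff]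
  rfl

variable (t Y) in
/-- The residue of the kernel times `E` is a multidifferential in `basisSpan`, and its expansion
solves the linear equation with inhomogeneity `S`. -/
def IsSource (E : ℂ → (Fin n → ℂ) → ℂ) (S : (Fin n → ℕ+) → PowerSeries ℂ) : Prop :=
  ∃ Φ ∈ basisSpan t Y (n + 1),
    (∀ z₀ ≠ 0, ∀ y : Fin n → ℂ, (∀ i, y i ≠ 0) →
      HasResidue (fun p => (curve t).kernel z₀ p * E p y) (Φ.1 (Fin.cons z₀ y))) ∧
    ∀ a, 2 * Y * genSeries (fun m => Φ.2 (Fin.cons m a)) + S a = 0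

variable {E E' : ℂ → (Fin n → ℂ) → ℂ} {S S' : (Fin n → ℕ+) → PowerSeries ℂ}

theorem IsSource.congr (h : IsSource t Y E S) (hE : ∀ p ≠ 0, ∀ y : Fin n → ℂ, (∀ i, y i ≠ 0) →
    E p y = E' p y) (hS : ∀ a, S a = S' a) : IsSource t Y E' S' := by
  obtain ⟨Φ, h1, h2, h3⟩ := h
  refine ⟨Φ, h1, fun z hz y hy => (h2 z hz y hy).congr ?_, fun a => by rw [← hS, h3]⟩
  filter_upwards [self_mem_nhdsWithin] with p hp
  rw [hE p hp y hy]

theorem IsSource.add (h : IsSource t Y E S) (h' : IsSource t Y E' S') :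
    IsSource t Y (fun p y => E p y + E' p y) (fun a => S a + S' a) := by
  obtain ⟨Φ, h1, h2, h3⟩ := h
  obtain ⟨Ψ, h4, h5, h6⟩ := h'
  refine ⟨Φ + Ψ, Submodule.add_mem _ h1 h4, fun z hz y hy => ?_, fun a => ?_⟩
  · refine ((h2 z hz y hy).add (h5 z hz y hy)).congr (Eventually.of_forall fun p => ?_)
    rw [mul_add]
  · have h7 : genSeries (fun m => (Φ + Ψ).2 (Fin.cons m a)) =
        genSeries (fun m => Φ.2 (Fin.cons m a)) + genSeries (fun m => Ψ.2 (Fin.cons m a)) := by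
      rw [← map_add]; rfl
    rw [h7]
    linear_combination h3 a + h6 a

theorem IsSource.smul (h : IsSource t Y E S) (c : ℂ) :
    IsSource t Y (fun p y => c * E p y) (fun a => C c * S a) := by
  obtain ⟨Φ, h1, h2, h3⟩ := h
  refine ⟨c • Φ, Submodule.smul_mem _ _ h1, fun z hz y hy => ?_, fun a => ?_⟩
  · refine ((h2 z hz y hy).const_mul c).congr (Eventually.of_forall fun p => ?_)
    rw [mul_left_comm]
  · have h7 : genSeries (fun m => (c • Φ).2 (Fin.cons m a)) =
        C c * genSeries (fun m => Φ.2 (Fin.cons m a)) := by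
      rw [← smul_eq_C_mul, ← map_smul]; rfl
    rw [h7]
    linear_combination C c * h3 a

theorem isSource_zero : IsSource t Y (n := n) (fun _ _ => 0) fun _ => 0 := by
  refine ⟨0, Submodule.zero_mem _, fun z hz y hy => ?_, fun a => ?_⟩
  · simpa using hasResidue_zero
  · have : genSeries (fun m => (0 : ((Fin (n + 1) → ℂ) → ℂ) × ((Fin (n + 1) → ℕ+) → ℂ)).2
      (Fin.cons m a)) = 0 := map_zero genSeries
    rw [this, mul_zero, add_zero]

theorem IsSource.sum {κ : Type*} {s : Finset κ} {E : κ → ℂ → (Fin n → ℂ) → ℂ}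
    {S : κ → (Fin n → ℕ+) → PowerSeries ℂ} (h : ∀ x ∈ s, IsSource t Y (E x) (S x)) :
    IsSource t Y (fun p y => ∑ x ∈ s, E x p y) (fun a => ∑ x ∈ s, S x a) := by
  classical
  induction s using Finset.induction_on with
  | empty => simpa using isSource_zero
  | insert i s hi ih =>
    simp only [sum_insert hi]
    exact (h i (mem_insert_self i s)).add (ih fun j hj => h j (mem_insert_of_mem hj))

variable (hY : 16 * Y ^ 2 = 1 - 4 * C t * X) (ht : t ≠ 0)
include hY ht

/-- Here the two sides meet: `hasResidue_kernel_pow` and `product_source` produce the same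
combination `kernelComb`. The minus sign is that of `dσ(p) = -dp`. -/
theorem isSource_of_exponents (k l : ℕ) (c : Fin n → ℕ) :
    IsSource t Y (fun p y => -((p ^ 2)⁻¹ ^ (k + l + 2) * ∏ i, (y i ^ 2)⁻¹ ^ (c i + 1)))
      (fun a => C (∏ i, basisCoeff t Y (c i) (a i)) * (basisSeries t Y k * basisSeries t Y l)) := by
  refine ⟨-(256 * t)⁻¹ • kernelComb (fun j => basisPair t Y (Fin.cons j c : Fin (n + 1) → ℕ))
    (k + l + 2), Submodule.smul_mem _ _ (kernelComb_mem (fun _ => basisPair_mem _) _),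
    fun z hz y _ => ?_, fun a => ?_⟩
  · have h := (hasResidue_kernel_pow t hz (k + l + 2)).const_mul
      (-∏ i, (y i ^ 2)⁻¹ ^ (c i + 1))
    convert h.congr (Eventually.of_forall fun p => ?_) using 1
    · rw [Prod.smul_fst, Pi.smul_apply, kernelComb_basisPair_fst, smul_eq_mul]
      ring
    · ring
  · have h7 : genSeries (fun m => (-(256 * t)⁻¹ • kernelComb (fun j => basisPair t Y
        (Fin.cons j c : Fin (n + 1) → ℕ)) (k + l + 2)).2 (Fin.cons m a)) =
        C (-(256 * t)⁻¹) * genSeries (fun m => (kernelComb (fun j => basisPair t Y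
        (Fin.cons j c : Fin (n + 1) → ℕ)) (k + l + 2)).2 (Fin.cons m a)) := by
      rw [← smul_eq_C_mul, ← map_smul]; rfl
    rw [h7, genSeries_kernelComb_basisPair]
    linear_combination C (∏ i, basisCoeff t Y (c i) (a i)) * product_source hY ht k l

/-- Sources of the form `ω_{g-1,n+2}(p, σ(p), ...)`. -/
theorem isSource_pair {Ψ : ((Fin (n + 2) → ℂ) → ℂ) × ((Fin (n + 2) → ℕ+) → ℂ)}
    (hΨ : Ψ ∈ basisSpan t Y (n + 2)) :
    IsSource t Y (fun p y => -Ψ.1 (Fin.cons p (Fin.cons (-p) y)))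
      (fun a => pairSeries fun p q => Ψ.2 (Fin.cons p (Fin.cons q a))) := by
  induction hΨ using Submodule.span_induction with
  | mem Ψ h =>
    obtain ⟨k, rfl⟩ := h
    refine (isSource_of_exponents hY ht (k 0) (k 1) fun i => k i.succ.succ).congr
      (fun p _ y _ => ?_) fun a => ?_
    · simp only [basisPair, Fin.prod_univ_succ, Fin.cons_zero, Fin.cons_succ, neg_sq]
      rw [Fin.succ_zero_eq_one]
      ring
    · have h1 : (fun p q : ℕ+ => (basisPair t Y k).2 (Fin.cons p (Fin.cons q a))) =
          (∏ i, basisCoeff t Y (k i.succ.succ) (a i)) •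
            fun p q : ℕ+ => basisCoeff t Y (k 0) p * basisCoeff t Y (k 1) q := by
        funext p q
        simp only [basisPair, Fin.prod_univ_succ, Fin.cons_zero, Fin.cons_succ]
        rw [Fin.succ_zero_eq_one]
        simp only [Pi.smul_apply, smul_eq_mul]
        ring
      rw [h1, map_smul, pairSeries_basisCoeff, smul_eq_C_mul]
  | zero =>
    refine isSource_zero.congr (fun p _ y _ => by simp) fun a => ?_
    exact (map_zero pairSeries).symm
  | add Φ Ψ _ _ h1 h2 =>
    refine (h1.add h2).congr (fun p _ y _ => ?_) fun a => ?_
    · simp only [Prod.fst_add, Pi.add_apply]; ring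
    · rw [← map_add]; rfl
  | smul c Φ _ h1 =>
    refine (h1.smul c).congr (fun p _ y _ => ?_) fun a => ?_
    · simp only [Prod.smul_fst, Pi.smul_apply, smul_eq_mul]; ring
    · rw [← smul_eq_C_mul, ← map_smul]; rfl

/-- Sources of the form `ω_{h,|I|+1}(p, p_I) ω_{g-h,n-|I|+1}(σ(p), ...)`, both factors stable. -/
theorem isSource_product (I : Finset (Fin n))
    {Φ : ((Fin (I.card + 1) → ℂ) → ℂ) × ((Fin (I.card + 1) → ℕ+) → ℂ)}
    {Ψ : ((Fin (Iᶜ.card + 1) → ℂ) → ℂ) × ((Fin (Iᶜ.card + 1) → ℕ+) → ℂ)}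
    (hΦ : Φ ∈ basisSpan t Y (I.card + 1)) (hΨ : Ψ ∈ basisSpan t Y (Iᶜ.card + 1)) :
    IsSource t Y (fun p y => -(Φ.1 (Fin.cons p fun i => y (I.orderEmbOfFin rfl i)) *
        Ψ.1 (Fin.cons (-p) fun i => y (Iᶜ.orderEmbOfFin rfl i))))
      (fun a => genSeries (fun m => Φ.2 (Fin.cons m fun i => a (I.orderEmbOfFin rfl i))) *
        genSeries (fun m => Ψ.2 (Fin.cons m fun i => a (Iᶜ.orderEmbOfFin rfl i)))) := by
  induction hΦ using Submodule.span_induction with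
  | mem Φ h =>
    obtain ⟨k, rfl⟩ := h
    induction hΨ using Submodule.span_induction with
    | mem Ψ h =>
      obtain ⟨l, rfl⟩ := h
      obtain ⟨c, hc1, hc2⟩ := exists_tuple_of_subsets I (fun i => k i.succ) (fun i => l i.succ)
      refine (isSource_of_exponents hY ht (k 0) (l 0) c).congr (fun p _ y _ => ?_) fun a => ?_
      · simp only [basisPair, Fin.prod_univ_succ, Fin.cons_zero, Fin.cons_succ, neg_sq]
        rw [← prod_mul_prod_compl I, ← prod_orderEmbOfFin I, ← prod_orderEmbOfFin Iᶜ]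
        simp only [hc1, hc2]
        ring
      · simp only [basisPair, Fin.prod_univ_succ, Fin.cons_zero, Fin.cons_succ]
        rw [genSeries_smul_basisCoeff, genSeries_smul_basisCoeff, ← prod_mul_prod_compl I,
          ← prod_orderEmbOfFin I, ← prod_orderEmbOfFin Iᶜ, map_mul]
        simp only [hc1, hc2]
        ring
    | zero =>
      refine isSource_zero.congr (fun p _ y _ => by simp) fun a => ?_
      rw [show (fun m => (0 : ((Fin (Iᶜ.card + 1) → ℂ) → ℂ) × ((Fin (Iᶜ.card + 1) → ℕ+) → ℂ)).2
        (Fin.cons m fun i => a (Iᶜ.orderEmbOfFin rfl i))) = 0 from rfl, map_zero, mul_zero]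
    | add Φ' Ψ _ _ h1 h2 =>
      refine (h1.add h2).congr (fun p _ y _ => ?_) fun a => ?_
      · simp only [Prod.fst_add, Pi.add_apply]; ring
      · rw [← mul_add, ← map_add]; rfl
    | smul c Ψ _ h1 =>
      refine (h1.smul c).congr (fun p _ y _ => ?_) fun a => ?_
      · simp only [Prod.smul_fst, Pi.smul_apply, smul_eq_mul]; ring
      · rw [mul_left_comm, ← smul_eq_C_mul, ← map_smul]; rfl
  | zero =>
    refine isSource_zero.congr (fun p _ y _ => by simp) fun a => ?_
    rw [show (fun m => (0 : ((Fin (I.card + 1) → ℂ) → ℂ) × ((Fin (I.card + 1) → ℕ+) → ℂ)).2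
      (Fin.cons m fun i => a (I.orderEmbOfFin rfl i))) = 0 from rfl, map_zero, zero_mul]
  | add Φ Φ' _ _ h1 h2 =>
    refine (h1.add h2).congr (fun p _ y _ => ?_) fun a => ?_
    · simp only [Prod.fst_add, Pi.add_apply]; ring
    · rw [← add_mul, ← map_add]; rfl
  | smul c Φ _ h1 =>
    refine (h1.smul c).congr (fun p _ y _ => ?_) fun a => ?_
    · simp only [Prod.smul_fst, Pi.smul_apply, smul_eq_mul]; ring
    · rw [← mul_assoc, ← smul_eq_C_mul, ← map_smul]; rfl

/-- Sources with a factor `ω_{0,2}`. -/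
theorem isSource_bergman (j : Fin n) {G : ℕ+ → PowerSeries ℂ}
    (hG : ∀ b : ℕ+, 2 * Y * G b + shiftSeries b Y = 0)
    {Ψ : ((Fin (({j} : Finset (Fin n))ᶜ.card + 1) → ℂ) → ℂ) ×
      ((Fin (({j} : Finset (Fin n))ᶜ.card + 1) → ℕ+) → ℂ)}
    (hΨ : Ψ ∈ basisSpan t Y (({j} : Finset (Fin n))ᶜ.card + 1)) :
    IsSource t Y (fun p y =>
        -(1 / (p - y j) ^ 2 * Ψ.1 (Fin.cons (-p) fun i => y (({j} : Finset (Fin n))ᶜ.orderEmbOfFin rfl i)) +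
          1 / (-p - y j) ^ 2 * Ψ.1 (Fin.cons p fun i => y (({j} : Finset (Fin n))ᶜ.orderEmbOfFin rfl i))))
      (fun a => shiftedOp (a j) (G (a j)) (genSeries fun m =>
        Ψ.2 (Fin.cons m fun i => a (({j} : Finset (Fin n))ᶜ.orderEmbOfFin rfl i)))) := by
  induction hΨ using Submodule.span_induction with
  | mem Ψ h =>
    obtain ⟨k, rfl⟩ := h
    obtain ⟨c, -, hc⟩ := exists_tuple_of_subsets ({j} : Finset (Fin n)) (fun _ => 0)
      (fun i => k i.succ)
    have hcu : ∀ (M : Type) [CommMonoid M] (f : Fin n → ℕ → M) (l : ℕ),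
        ∏ i, f i (Function.update c j l i) =
          f j l * ∏ i, f (({j} : Finset (Fin n))ᶜ.orderEmbOfFin rfl i) (k i.succ) := by
      intro M _ f l
      rw [Fintype.prod_eq_mul_prod_compl j, Function.update_self]
      congr 1
      rw [← prod_orderEmbOfFin]
      refine prod_congr rfl fun i _ => ?_
      rw [Function.update_of_ne, hc]
      exact fun h => mem_compl.mp (({j} : Finset (Fin n))ᶜ.orderEmbOfFin_mem rfl i)
        (mem_singleton.mpr h)
    refine ⟨-(128 * t)⁻¹ • ∑ l ∈ range (k 0 + 2), (2 * (l : ℂ) + 1) • kernelComb (fun i =>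
      basisPair t Y (Fin.cons i (Function.update c j l) : Fin (n + 1) → ℕ)) (k 0 + 1 - l),
      Submodule.smul_mem _ _ (Submodule.sum_mem _ fun l _ => Submodule.smul_mem _ _
        (kernelComb_mem (fun _ => basisPair_mem _) _)), fun z hz y hy => ?_, fun a => ?_⟩
    · have h := (hasResidue_kernel_bergman t hz (hy j) (k 0)).const_mul
        (-∏ i, (y (({j} : Finset (Fin n))ᶜ.orderEmbOfFin rfl i) ^ 2)⁻¹ ^ (k i.succ + 1))
      convert h.congr (Eventually.of_forall fun p => ?_) using 1
      · rw [Prod.smul_fst, Pi.smul_apply, Prod.fst_sum, Finset.sum_apply, smul_eq_mul]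
        simp only [Prod.smul_fst, Pi.smul_apply, kernelComb_basisPair_fst, smul_eq_mul,
          hcu ℂ (fun i l => (y i ^ 2)⁻¹ ^ (l + 1))]
        rw [mul_left_comm, mul_sum, mul_sum, mul_sum]
        refine sum_congr rfl fun l _ => ?_
        ring
      · simp only [basisPair, Fin.prod_univ_succ, Fin.cons_zero, Fin.cons_succ, neg_sq]
        ring
    · have h7 : genSeries (fun m => (-(128 * t)⁻¹ • ∑ l ∈ range (k 0 + 2), (2 * (l : ℂ) + 1) •
          kernelComb (fun i => basisPair t Y
          (Fin.cons i (Function.update c j l) : Fin (n + 1) → ℕ)) (k 0 + 1 - l)).2 (Fin.cons m a)) =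
          C (-(128 * t)⁻¹) * ∑ l ∈ range (k 0 + 2), C (2 * (l : ℂ) + 1) *
          genSeries (fun m => (kernelComb (fun i => basisPair t Y
          (Fin.cons i (Function.update c j l) : Fin (n + 1) → ℕ)) (k 0 + 1 - l)).2 (Fin.cons m a)) := by
        let e : ((Fin (n + 1) → ℂ) → ℂ) × ((Fin (n + 1) → ℕ+) → ℂ) →ₗ[ℂ] PowerSeries ℂ :=
          { toFun := fun Φ => genSeries (fun m => Φ.2 (Fin.cons m a))
            map_add' := fun Φ Ψ => map_add genSeries (fun m => Φ.2 (Fin.cons m a)) _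
            map_smul' := fun c Φ => map_smul genSeries c (fun m => Φ.2 (Fin.cons m a)) }
        simp only [← smul_eq_C_mul]
        change e _ = _
        rw [map_smul, map_sum]
        simp only [map_smul]
        rfl
      rw [h7]
      simp only [genSeries_kernelComb_basisPair, hcu ℂ (fun i l => basisCoeff t Y l (a i))]
      have h8 := shifted_source hY (hG (a j)) ht (k 0)
      simp only [basisPair, Fin.prod_univ_succ, Fin.cons_zero, Fin.cons_succ]
      rw [genSeries_smul_basisCoeff, shiftedOp_C_mul]
      set P := ∏ i, basisCoeff t Y (k i.succ) (a (({j} : Finset (Fin n))ᶜ.orderEmbOfFin rfl i))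
      have h9 : ∑ l ∈ range (k 0 + 2), C (2 * (l : ℂ) + 1) * (C (basisCoeff t Y l (a j) * P) *
          kernelComb (basisSeries t Y) (k 0 + 1 - l)) = C P * ∑ l ∈ range (k 0 + 2),
          C ((2 * (l : ℂ) + 1) * basisCoeff t Y l (a j)) *
            kernelComb (basisSeries t Y) (k 0 + 1 - l) := by
        rw [mul_sum]
        refine sum_congr rfl fun l _ => ?_
        simp only [map_mul]
        ring
      rw [h9]
      linear_combination C P * h8
  | zero =>
    refine isSource_zero.congr (fun p _ y _ => by simp) fun a => ?_
    rw [show (fun m => (0 : ((Fin (({j} : Finset (Fin n))ᶜ.card + 1) → ℂ) → ℂ) ×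
      ((Fin (({j} : Finset (Fin n))ᶜ.card + 1) → ℕ+) → ℂ)).2
      (Fin.cons m fun i => a (({j} : Finset (Fin n))ᶜ.orderEmbOfFin rfl i))) = 0 from rfl, map_zero,
      map_zero]
  | add Φ Φ' _ _ h1 h2 =>
    refine (h1.add h2).congr (fun p _ y _ => ?_) fun a => ?_
    · simp only [Prod.fst_add, Pi.add_apply]; ring
    · rw [← map_add, ← map_add]; rfl
  | smul c Φ _ h1 =>
    refine (h1.smul c).congr (fun p _ y _ => ?_) fun a => ?_
    · simp only [Prod.smul_fst, Pi.smul_apply, smul_eq_mul]; ring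
    · rw [← shiftedOp_C_mul, ← smul_eq_C_mul, ← map_smul]; rfl

end Sources
end ModifiedGUE
end

noncomputable section
namespace ModifiedGUE
open Finset

/-! ### The loop equations in the form of the topological recursion -/

section Combinatorics

theorem sum_of_unstable {M : Type*} [AddCommMonoid M] {g n : ℕ} (hgn : 1 ≤ g ∨ 1 ≤ n)
    (T : Fin (g + 1) → Finset (Fin n) → M) :
    ∑ h, ∑ I, (if (h.val = 0 ∧ I = ∅) ∨ (h.val = g ∧ I = univ) then T h I else 0) =
      T 0 ∅ + T (Fin.last g) univ := by
  have h1 : ((0 : Fin (g + 1)), (∅ : Finset (Fin n))) ≠ (Fin.last g, univ) := fun h => by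
    have h2 := congrArg Fin.val (congrArg Prod.fst h)
    have h3 := congrArg card (congrArg Prod.snd h)
    simp only [Fin.val_zero, Fin.val_last, card_empty, card_univ, Fintype.card_fin] at h2 h3
    omega
  rw [← Fintype.sum_prod_type' (f := fun h I => if (h.val = 0 ∧ I = ∅) ∨ (h.val = g ∧ I = univ) then
    T h I else 0), ← sum_filter, show (univ.filter fun x : Fin (g + 1) × Finset (Fin n) =>
      (x.1.val = 0 ∧ x.2 = ∅) ∨ (x.1.val = g ∧ x.2 = univ)) = {(0, ∅), (Fin.last g, univ)} by
      ext ⟨h, I⟩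
      simp only [mem_filter, mem_univ, true_and, mem_insert, mem_singleton, Prod.mk.injEq,
        Fin.ext_iff, Fin.val_zero, Fin.val_last], sum_pair h1]

/-- Once `ω_{0,1}` is excluded, either both factors are stable or exactly one of them is `ω_{0,2}`,
with a single marked point `j`. Both could be `ω_{0,2}` only for `g = 0`, `n = 2`. -/
theorem sum_of_unstable_factor {M : Type*} [AddCommMonoid M] {g n : ℕ} (hgn : 2 ≤ 2 * g + n)
    (h3 : ¬(g = 0 ∧ n = 2)) (T : Fin (g + 1) → Finset (Fin n) → M) :
    ∑ h, ∑ I, (if (h.val = 0 ∧ I = ∅) ∨ (h.val = g ∧ I = univ) then 0 else T h I) =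
      ∑ h : Fin (g + 1), ∑ I : Finset (Fin n),
        (if 2 ≤ 2 * h.val + #I ∧ 2 ≤ 2 * (g - h.val) + #Iᶜ then T h I else 0) +
      ∑ j, (T 0 {j} + T (Fin.last g) {j}ᶜ) := by
  have hA : ∀ h I, ∑ j, (if h = 0 ∧ I = {j} then T h I else 0) =
      if h.val = 0 ∧ #I = 1 then T h I else 0 := fun h I => by
    by_cases h1 : h.val = 0 ∧ #I = 1
    · obtain ⟨h0, hI⟩ := h1
      obtain ⟨j, rfl⟩ := card_eq_one.mp hI
      have h0' : h = 0 := Fin.ext h0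
      simp [h0']
    · rw [if_neg h1]
      refine sum_eq_zero fun j _ => if_neg fun h2 => h1 ⟨by rw [h2.1]; rfl, by rw [h2.2]; simp⟩
  have hB : ∀ h I, ∑ j, (if h = Fin.last g ∧ I = {j}ᶜ then T h I else 0) =
      if h.val = g ∧ #Iᶜ = 1 then T h I else 0 := fun h I => by
    by_cases h1 : h.val = g ∧ #Iᶜ = 1
    · obtain ⟨h0, hI⟩ := h1
      obtain ⟨j, hj⟩ := card_eq_one.mp hI
      have h0' : h = Fin.last g := Fin.ext h0
      have hI' : I = {j}ᶜ := by rw [← hj, compl_compl]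
      subst hI' h0'
      simp [compl_inj_iff]
    · rw [if_neg h1]
      refine sum_eq_zero fun j _ => if_neg fun h2 => h1 ⟨by rw [h2.1]; rfl, by rw [h2.2]; simp⟩
  have key : ∀ h I, (if (h.val = 0 ∧ I = ∅) ∨ (h.val = g ∧ I = univ) then 0 else T h I) =
      (if 2 ≤ 2 * h.val + #I ∧ 2 ≤ 2 * (g - h.val) + #Iᶜ then T h I else 0) +
      (∑ j, (if h = 0 ∧ I = {j} then T h I else 0) +
        ∑ j, (if h = Fin.last g ∧ I = {j}ᶜ then T h I else 0)) := fun h I => by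
    rw [hA, hB]
    have h1 : #Iᶜ + #I = n := by simp
    have h2 : I = ∅ ↔ #I = 0 := card_eq_zero.symm
    have h4 : I = univ ↔ #Iᶜ = 0 := by rw [card_eq_zero, compl_eq_empty_iff]
    have h5 := h.isLt
    simp only [h2, h4]
    split_ifs <;> first | omega | simp
  simp only [key, sum_add_distrib]
  congr 1
  congr 1
  · rw [sum_congr rfl fun h _ => sum_comm, sum_comm]
    refine sum_congr rfl fun j _ => ?_
    rw [Fintype.sum_eq_single 0 (fun h hh => by simp [hh]),
      Fintype.sum_eq_single {j} (fun I hI => by simp [hI])]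
    simp
  · rw [sum_congr rfl fun h _ => sum_comm, sum_comm]
    refine sum_congr rfl fun j _ => ?_
    rw [Fintype.sum_eq_single (Fin.last g) (fun h hh => by simp [hh]),
      Fintype.sum_eq_single {j}ᶜ (fun I hI => by simp [hI])]
    simp

end Combinatorics

/-! ### The spectral curve and the linear loop equations as power series. -/

section FormalLoop
open PowerSeries

variable (t : ℂ) (Φ : MvPowerSeries ℕ+ (Polynomial (Polynomial ℂ)))

/-- The expansion of `y` on the physical sheet. -/
def curveSeries : PowerSeries ℂ := wave t Φ 0 0 + C (t / 2) * X - C (1 / 4)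

variable {Φ}

section WaveSeries

variable {n : ℕ} (a : Fin n → ℕ+)

theorem multiIndex_cons (I : Finset (Fin n)) (m : ℕ+) :
    multiIndex (Fin.cons m fun i => a (I.orderEmbOfFin rfl i) : Fin (#I + 1) → ℕ+) univ =
      multiIndex a I + Finsupp.single m 1 := by
  rw [multiIndex, Fin.sum_univ_succ, Fin.cons_zero, add_comm, multiIndex]
  simp only [Fin.cons_succ]
  congr 1
  conv_rhs => rw [← Finset.map_orderEmbOfFin_univ I rfl, sum_map]
  rfl

theorem multiIndex_cons_univ (m : ℕ+) :
    multiIndex (Fin.cons m a : Fin (n + 1) → ℕ+) univ =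
      multiIndex a univ + Finsupp.single m 1 := by
  rw [multiIndex, Fin.sum_univ_succ, Fin.cons_zero, add_comm, multiIndex]
  simp only [Fin.cons_succ]

variable {t} {g : ℕ} {μ : ℕ+ →₀ ℕ}

theorem wave_eq_genSeries {f : ℕ+ → ℂ}
    (h : ∀ m : ℕ+, genusDeriv t g (μ + Finsupp.single m 1) Φ = f m) :
    wave t Φ g μ = genSeries f := by
  rw [wave, genSeries_apply, extendZero_eq (F := fun m => genusDeriv t g μ (sDeriv _ m Φ))
    (by rw [sDeriv_zero]; simp) fun m => ?_]
  rw [← h, genusDeriv_add_single]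

theorem wavePair_eq_pairSeries {f : ℕ+ → ℕ+ → ℂ}
    (h : ∀ p q : ℕ+, genusDeriv t g (μ + Finsupp.single q 1 + Finsupp.single p 1) Φ = f p q) :
    wavePair t Φ g μ = pairSeries f := by
  rw [wavePair, pairSeries_apply]
  congr 1
  ext m
  rw [coeff_mk, coeff_mk]
  refine sum_congr rfl fun x _ => ?_
  rw [extendZero_eq (F := fun i => genusDeriv t g μ (sDeriv _ i (sDeriv _ x.2 Φ)))
    (by rw [sDeriv_zero]; simp) fun p => ?_]
  rw [extendZero_eq (F := fun j => genusDeriv t g μ (sDeriv _ p (sDeriv _ j Φ)))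
    (by rw [sDeriv_zero]; simp) fun q => ?_]
  rw [← h, genusDeriv_add_single, genusDeriv_add_single, sDeriv_comm]

end WaveSeries

variable (hΦ : ∀ m, virasoroDefect Polynomial.X (Polynomial.C Polynomial.X) Φ m = 0)
include hΦ

/-- The planar one-point loop equation is quadratic in the one-point series; completing the square
gives the spectral curve. -/
theorem curveSeries_sq : 16 * curveSeries t Φ ^ 2 = 1 - 4 * C t * X := by
  have h := wave_loop_equation t 0 (Fin.elim0 : Fin 0 → ℕ+) hΦ
  have h1 : ∀ s, multiIndex (Fin.elim0 : Fin 0 → ℕ+) s = 0 := fun s => by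
    rw [eq_empty_of_isEmpty s, multiIndex, sum_empty]
  simp only [h1, if_true, zero_add, range_one, sum_singleton, Fintype.card_fin, univ_eq_empty,
    sum_empty, add_zero, Nat.sub_zero, Fintype.sum_unique] at h
  have h2 : (C (t / 2) : PowerSeries ℂ) * 2 = C t := by
    rw [← map_ofNat C 2, ← map_mul, div_mul_cancel₀ _ (by norm_num)]
  have h3 : (C (1 / 4) : PowerSeries ℂ) * 4 = 1 := by
    rw [← map_ofNat C 4, ← map_mul, div_mul_cancel₀ _ (by norm_num), map_one]
  have h4 : (C (t ^ 2 / 4) : PowerSeries ℂ) * 4 = C t ^ 2 := by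
    rw [← map_ofNat C 4, ← map_mul, div_mul_cancel₀ _ (by norm_num), map_pow]
  rw [curveSeries]
  set w := wave t Φ 0 0
  linear_combination (-8 * h) + (16 * w * X + 4 * X ^ 2 * (C (t / 2) * 2 + C t) - 4 * X * (C (1/4) * 4)) * h2
    - 4 * X ^ 2 * h4 + (C (1/4) * 4 + 1 - 8 * w - 4 * X * C t) * h3

theorem curveSeries_ne_zero : curveSeries t Φ ≠ 0 := fun h => by
  have h1 := congrArg constantCoeff (curveSeries_sq t hΦ)
  rw [h] at h1
  simp at h1

variable {n : ℕ} (g : ℕ) (a : Fin n → ℕ+)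

/-- The loop equation with the terms that contain the planar one-point function collected. -/
theorem wave_recursion (hgn : 1 ≤ g ∨ 1 ≤ n) :
    2 * curveSeries t Φ * wave t Φ g (multiIndex a univ) +
      ((if g = 0 then 0 else wavePair t Φ (g - 1) (multiIndex a univ)) +
      ∑ h : Fin (g + 1), ∑ I : Finset (Fin n),
        (if (h.val = 0 ∧ I = ∅) ∨ (h.val = g ∧ I = univ) then 0 else
          wave t Φ h (multiIndex a I) * wave t Φ (g - h) (multiIndex a Iᶜ)) +
      ∑ j, shiftSeries (a j) (wave t Φ g (multiIndex a {j}ᶜ)) +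
      if n = 0 ∧ g = 1 then -C (1 / 16) * X ^ 2 else 0) = 0 := by
  have h := wave_loop_equation t g a hΦ
  have h1 : ∑ J : Finset (Fin n), ∑ h ∈ range (g + 1),
      wave t Φ h (multiIndex a J) * wave t Φ (g - h) (multiIndex a Jᶜ) =
      ∑ h : Fin (g + 1), ∑ I : Finset (Fin n),
        (if (h.val = 0 ∧ I = ∅) ∨ (h.val = g ∧ I = univ) then 0 else
          wave t Φ h (multiIndex a I) * wave t Φ (g - h) (multiIndex a Iᶜ)) +
      2 * wave t Φ 0 0 * wave t Φ g (multiIndex a univ) := by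
    have h2 := sum_of_unstable hgn fun h I =>
      wave t Φ h (multiIndex a I) * wave t Φ (g - h) (multiIndex a Iᶜ)
    have h3 : multiIndex a ∅ = 0 := sum_empty
    rw [Fin.val_zero, Fin.val_last, compl_empty, compl_univ, Nat.sub_zero, Nat.sub_self, h3] at h2
    rw [show 2 * wave t Φ 0 0 * wave t Φ g (multiIndex a univ) = wave t Φ 0 0 * wave t Φ g (multiIndex a univ) +
      wave t Φ g (multiIndex a univ) * wave t Φ 0 0 by ring, ← h2, ← sum_add_distrib, sum_comm, sum_range]
    refine sum_congr rfl fun h _ => ?_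
    rw [← sum_add_distrib]
    refine sum_congr rfl fun I _ => ?_
    split_ifs <;> simp
  have h2 : (if Fintype.card (Fin n) = 0 then PowerSeries.C (if g = 0 then t ^ 2 / 4 else
          if g = 1 then -(1 / 16) else 0) * PowerSeries.X ^ 2 else 0) =
      if n = 0 ∧ g = 1 then -C (1 / 16) * X ^ 2 else 0 := by
    rw [Fintype.card_fin]
    split_ifs <;> first | omega | simp
  have h3 : ∀ j, univ.erase j = ({j} : Finset (Fin n))ᶜ := fun j => by
    ext i
    simp
  simp only [h1, h2, h3] at h
  have h4 : (C (t / 2) : PowerSeries ℂ) * 2 = C t := by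
    rw [← map_ofNat C 2, ← map_mul, div_mul_cancel₀ _ (by norm_num)]
  have h5 : (C (1 / 4) : PowerSeries ℂ) * 4 = 1 := by
    rw [← map_ofNat C 4, ← map_mul, div_mul_cancel₀ _ (by norm_num), map_one]
  refine mul_left_cancel₀ (two_ne_zero (α := PowerSeries ℂ)) ?_
  rw [curveSeries]
  linear_combination -h + 2 * X * wave t Φ g (multiIndex a univ) * h4 -
    wave t Φ g (multiIndex a univ) * h5

-- Only coefficients of index at least `b + 1 ≥ 2` enter, so the constant and linear terms added to
-- the one-point series are invisible.
omit hΦ a in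
theorem shiftSeries_curveSeries (b : ℕ+) :
    shiftSeries b (curveSeries t Φ) = shiftSeries b (wave t Φ 0 0) := by
  rw [curveSeries, add_sub_assoc, map_add, add_eq_left, shiftSeries_apply]
  convert mul_zero _
  ext m
  rw [coeff_mk, map_zero, map_sub, coeff_C_mul, coeff_X, coeff_C, if_neg (by have := b.pos; omega),
    if_neg (by omega)]
  simp

-- With one marked point the only subsets are empty or full, so every product contains the planar
-- one-point function and has been absorbed into `curveSeries`.
omit a in
theorem twoPoint_equation (b : ℕ+) :
    2 * curveSeries t Φ * wave t Φ 0 (Finsupp.single b 1) + shiftSeries b (curveSeries t Φ) = 0 := by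
  have h := wave_recursion t hΦ 0 (fun _ : Fin 1 => b) (Or.inr le_rfl)
  have h1 : multiIndex (fun _ : Fin 1 => b) univ = Finsupp.single b 1 := by simp [multiIndex]
  have h2 : multiIndex (fun _ : Fin 1 => b) ∅ = 0 := sum_empty
  have h3 : ∀ I : Finset (Fin 1), I = ∅ ∨ I = univ := by decide
  have h4 : ({0} : Finset (Fin 1))ᶜ = ∅ := by decide
  rw [if_pos rfl, zero_add, if_neg (by omega), add_zero, sum_eq_zero (fun h _ => sum_eq_zero
    fun I _ => if_pos ((h3 I).imp (⟨by omega, ·⟩) (⟨by omega, ·⟩))), zero_add, Fin.sum_univ_one, h4,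
    h1, h2, ← shiftSeries_curveSeries t] at h
  exact h

-- The coefficient form of the homogeneity relation `eulerOp_twoPoint`. It makes the planar
-- two-point correlators explicit and drives both the case `(1,1)` and the computation of `G_{0,2}`.
omit a in
theorem mul_genusDeriv_pair (p q : ℕ) : 32 * ((p : ℂ) + q) *
    genusDeriv t 0 0 (sDeriv _ p (sDeriv _ q Φ)) =
      basisCoeff t (curveSeries t Φ) 0 p * basisCoeff t (curveSeries t Φ) 0 q := by
  rcases Nat.eq_zero_or_pos q with rfl | hq
  · rw [sDeriv_zero, basisCoeff_zero]; simp
  lift q to ℕ+ using hq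
  have h := congrArg (coeff (p + 1)) (eulerOp_twoPoint (curveSeries_sq t hΦ)
    (twoPoint_equation t hΦ q))
  rw [← map_ofNat C 32, coeff_C_mul, map_add, coeff_C_mul, coeff_C_mul, coeff_eulerOp,
    coeff_wave_succ, ← zero_add (Finsupp.single q 1), genusDeriv_add_single, sDeriv_comm] at h
  rw [mul_comm (basisCoeff _ _ _ _)]
  refine Eq.trans ?_ h
  change _ = (32 : ℂ) * _
  push_cast
  ring


end FormalLoop

end ModifiedGUE
end

noncomputable section
namespace ModifiedGUE
open Finset

/-! ### The topological recursion for the correlators -/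

section Recursion
open PowerSeries

variable (t : ℂ)

theorem omega_zero_two {c : ℕ} (hc : c = 1) (z : Fin (c + 1) → ℂ) :
    (curve t).omega 0 (c + 1) z = 1 / (z 0 - z (Fin.last c)) ^ 2 := by
  rw [SpectralCurve.omega, if_neg (by omega), if_pos ⟨rfl, hc⟩]
  rfl

theorem omega_singleton {n : ℕ} {I : Finset (Fin n)} {j : Fin n} (hI : I = {j}) (p : ℂ)
    (y : Fin n → ℂ) :
    (curve t).omega 0 (#I + 1) (Fin.cons p fun i => y (I.orderEmbOfFin rfl i)) =
      1 / (p - y j) ^ 2 := by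
  subst hI
  rw [omega_zero_two t (card_singleton j)]
  have h : ∀ i : Fin #{j}, ({j} : Finset (Fin n)).orderEmbOfFin rfl i = j := fun i =>
    mem_singleton.mp (orderEmbOfFin_mem _ rfl i)
  simp only [h]
  rw [Fin.cons_zero, show Fin.last (#{j}) = Fin.succ ⟨0, by simp⟩ from by
    ext; simp, Fin.cons_succ]

/-- The integrand of the topological recursion, without the kernel. -/
def bracket (g : ℕ) {n : ℕ} (p : ℂ) (y : Fin n → ℂ) : ℂ :=
  (if g = 0 then 0 else -(curve t).omega (g - 1) (n + 2) (Fin.cons p (Fin.cons (-p) y))) +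
    ∑ h : Fin (g + 1), ∑ I : Finset (Fin n),
      if (h.val = 0 ∧ I = ∅) ∨ (h.val = g ∧ I = univ) then 0 else
        -((curve t).omega h (#I + 1) (Fin.cons p fun i => y (I.orderEmbOfFin rfl i)) *
          (curve t).omega (g - h) (#Iᶜ + 1) (Fin.cons (-p) fun i => y (Iᶜ.orderEmbOfFin rfl i)))

theorem omega_eq_residue {g n : ℕ} (hgn : 2 ≤ 2 * g + n) (z : Fin (n + 1) → ℂ) :
    (curve t).omega g (n + 1) z =
      residue (fun p => (curve t).kernel (z 0) p * bracket t g p (Fin.tail z)) 0 := by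
  rw [SpectralCurve.omega, if_neg (by omega), if_neg (by omega)]
  change residue _ 0 = _
  congr 1
  funext p
  congr 1
  have hσ : deriv (curve t).σ p = -1 := by
    change deriv (fun y : ℂ => -y) p = -1
    simp
  rw [bracket, hσ]
  congr 1
  · rcases g with _ | g
    · rfl
    · rw [if_neg (by omega)]
      change _ * (-1 : ℂ) = _
      rw [mul_neg_one]
      rfl
  · refine sum_congr rfl fun h _ => sum_congr rfl fun I _ => ?_
    split_ifs
    · rfl
    · rw [mul_neg_one, mul_neg]
      rfl

variable (Φ : MvPowerSeries ℕ+ (Polynomial (Polynomial ℂ)))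

/-- The formal counterpart of `bracket`. -/
def formalBracket (g : ℕ) {n : ℕ} (a : Fin n → ℕ+) : PowerSeries ℂ :=
  (if g = 0 then 0 else wavePair t Φ (g - 1) (multiIndex a univ)) +
    ∑ h : Fin (g + 1), ∑ I : Finset (Fin n),
      (if (h.val = 0 ∧ I = ∅) ∨ (h.val = g ∧ I = univ) then 0 else
        wave t Φ h (multiIndex a I) * wave t Φ (g - h) (multiIndex a Iᶜ)) +
    ∑ j, shiftSeries (a j) (wave t Φ g (multiIndex a {j}ᶜ)) +
    if n = 0 ∧ g = 1 then -C (1 / 16) * X ^ 2 else 0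

/-- `ω_{g,n}` is polynomial in the `y_i^(-2)`, and its expansion is given by the correlators. -/
def Matches (g n : ℕ) : Prop :=
  ∃ Ψ ∈ basisSpan t (curveSeries t Φ) n,
    (∀ y : Fin n → ℂ, (∀ i, y i ≠ 0) → (curve t).omega g n y = Ψ.1 y) ∧
    ∀ a : Fin n → ℕ+, genusDeriv t g (multiIndex a univ) Φ = Ψ.2 a

variable {Φ} (hΦ : ∀ m, virasoroDefect Polynomial.X (Polynomial.C Polynomial.X) Φ m = 0)
include hΦ

/-- The correlators and the residue both solve the same equation `2 Y η + S = 0`, and `Y ≠ 0`, so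
they agree. -/
theorem matches_of_isSource {g n : ℕ} (hgn : 2 ≤ 2 * g + n)
    (h : IsSource t (curveSeries t Φ) (bracket t g (n := n)) (formalBracket t Φ g)) :
    Matches t Φ g (n + 1) := by
  obtain ⟨Ψ, h1, h2, h3⟩ := h
  refine ⟨Ψ, h1, fun y hy => ?_, fun a => ?_⟩
  · rw [omega_eq_residue t hgn, (h2 (y 0) (hy 0) (Fin.tail y) fun i => hy i.succ).residue_eq,
      Fin.cons_self_tail]
  · have h4 := wave_recursion t hΦ g (Fin.tail a) (by omega)
    have h5 : wave t Φ g (multiIndex (Fin.tail a) univ) =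
        genSeries fun m => Ψ.2 (Fin.cons m (Fin.tail a)) := by
      refine mul_left_cancel₀ (mul_ne_zero two_ne_zero (curveSeries_ne_zero t hΦ)) ?_
      have h6 := h3 (Fin.tail a)
      rw [formalBracket] at h6
      linear_combination h4 - h6
    have h6 := congrArg (coeff ((a 0 : ℕ) + 1)) h5
    rw [coeff_wave_succ, coeff_genSeries, ← genusDeriv_add_single, ← multiIndex_cons_univ,
      Fin.cons_self_tail] at h6
    exact h6

variable (ht : t ≠ 0)
include ht

/-- An initial case in which both factors are `ω_{0,2}`. The integrand is regular at `p = 0` and the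
kernel has a simple pole, so the residue is a value at `0`; the series side is `threePoint`. -/
theorem isSource_zero_three :
    IsSource t (curveSeries t Φ) (bracket t 0 (n := 2)) (formalBracket t Φ 0) := by
  have hu : (univ : Finset (Finset (Fin 2))) = {∅, {0}, {1}, univ} := by decide
  have hsum : ∀ {M : Type} [AddCommMonoid M] (T : Finset (Fin 2) → M),
      ∑ h : Fin (0 + 1), ∑ I : Finset (Fin 2), (if (h.val = 0 ∧ I = ∅) ∨ (h.val = 0 ∧ I = univ) then 0
        else T I) = T {0} + T {1} := fun T => by
    rw [Fin.sum_univ_one, hu, sum_insert (by decide), sum_insert (by decide),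
      sum_insert (by decide), sum_singleton, if_pos (Or.inl ⟨rfl, rfl⟩), if_neg (by decide),
      if_neg (by decide), if_pos (Or.inr ⟨rfl, rfl⟩), zero_add, add_zero]
  have h01 : ({0} : Finset (Fin 2))ᶜ = {1} := by decide
  have h10 : ({1} : Finset (Fin 2))ᶜ = {0} := by decide
  refine ⟨-(128 * t)⁻¹ • basisPair t _ fun _ => 0, Submodule.smul_mem _ _ (basisPair_mem _),
    fun z hz y hy => ?_, fun a => ?_⟩
  · have hb : ∀ p, bracket t 0 p y = -(1 / (p - y 0) ^ 2 * (1 / (-p - y 1) ^ 2)) +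
        -(1 / (p - y 1) ^ 2 * (1 / (-p - y 0) ^ 2)) := fun p => by
      rw [bracket, if_pos rfl, zero_add]
      have h1 := hsum fun I => -((curve t).omega 0 (#I + 1) (Fin.cons p fun i => y (I.orderEmbOfFin rfl i)) *
          (curve t).omega 0 (#Iᶜ + 1) (Fin.cons (-p) fun i => y (Iᶜ.orderEmbOfFin rfl i)))
      rw [omega_singleton t rfl, omega_singleton t rfl, omega_singleton t h01,
        omega_singleton t h10] at h1
      rw [← h1]
      simp
    have hz2 : z ^ 2 - 0 ^ 2 ≠ 0 := by simpa using hz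
    have h0 : (0 : ℂ) - y 0 ≠ 0 := by simpa using hy 0
    have h0' : -(0 : ℂ) - y 0 ≠ 0 := by simpa using hy 0
    have h1 : (0 : ℂ) - y 1 ≠ 0 := by simpa using hy 1
    have h1' : -(0 : ℂ) - y 1 ≠ 0 := by simpa using hy 1
    have han : AnalyticAt ℂ (fun p => (256 * t)⁻¹ * ((1 - 16 * p ^ 2) ^ 2 * (z ^ 2 - p ^ 2)⁻¹) *
        (-(((p - y 0) ^ 2)⁻¹ * ((-p - y 1) ^ 2)⁻¹) + -(((p - y 1) ^ 2)⁻¹ * ((-p - y 0) ^ 2)⁻¹))) 0 := by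
      have e1 : AnalyticAt ℂ (fun p : ℂ => (z ^ 2 - p ^ 2)⁻¹) 0 :=
        AnalyticAt.inv (by fun_prop) hz2
      have e2 : AnalyticAt ℂ (fun p : ℂ => ((p - y 0) ^ 2)⁻¹) 0 :=
        AnalyticAt.inv (by fun_prop) (pow_ne_zero 2 h0)
      have e3 : AnalyticAt ℂ (fun p : ℂ => ((p - y 1) ^ 2)⁻¹) 0 :=
        AnalyticAt.inv (by fun_prop) (pow_ne_zero 2 h1)
      have e4 : AnalyticAt ℂ (fun p : ℂ => ((-p - y 0) ^ 2)⁻¹) 0 :=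
        AnalyticAt.inv (by fun_prop) (pow_ne_zero 2 h0')
      have e5 : AnalyticAt ℂ (fun p : ℂ => ((-p - y 1) ^ 2)⁻¹) 0 :=
        AnalyticAt.inv (by fun_prop) (pow_ne_zero 2 h1')
      exact (analyticAt_const.mul ((by fun_prop : AnalyticAt ℂ (fun p : ℂ => (1 - 16 * p ^ 2) ^ 2) 0).mul
        e1)).mul ((e2.mul e5).neg.add (e3.mul e4).neg)
    convert (hasResidue_inv_mul han).congr ?_ using 1
    · simp only [basisPair, Prod.smul_fst, Pi.smul_apply, Fin.prod_univ_succ, Fin.cons_zero,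
        Fin.cons_succ, smul_eq_mul]
      have := hy 0
      have := hy 1
      simp
      field_simp
      ring
    · filter_upwards [eventually_kernel_eq t hz] with p hp
      rw [hp, hb]
      simp only [one_div]
      ring
  · have h0 : multiIndex a {0} = Finsupp.single (a 0) 1 := sum_singleton _ _
    have h1 : multiIndex a {1} = Finsupp.single (a 1) 1 := sum_singleton _ _
    have h2 := hsum fun I => wave t Φ 0 (multiIndex a I) * wave t Φ 0 (multiIndex a Iᶜ)
    rw [h01, h10, h0, h1] at h2
    rw [formalBracket, if_pos rfl, zero_add, if_neg (by omega), add_zero, Fin.sum_univ_two, h01, h10,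
      h0, h1]
    have h3 := threePoint (curveSeries_sq t hΦ) ht (a 0).pos (a 1).pos (twoPoint_equation t hΦ (a 0))
      (twoPoint_equation t hΦ (a 1))
    have h4 : genSeries (fun m => (-(128 * t)⁻¹ • basisPair t (curveSeries t Φ)
        fun _ : Fin (2 + 1) => 0).2 (Fin.cons m a)) =
        C (-(128 * t)⁻¹ * (basisCoeff t (curveSeries t Φ) 0 (a 0) *
          basisCoeff t (curveSeries t Φ) 0 (a 1))) * basisSeries t (curveSeries t Φ) 0 := by
      rw [← genSeries_smul_basisCoeff]
      congr 1
      funext m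
      simp only [basisPair, Prod.smul_snd, Pi.smul_apply, Fin.prod_univ_succ, Fin.cons_zero,
        Fin.cons_succ, smul_eq_mul]
      simp
      ring
    rw [h4]
    have h5 : ∑ h : Fin (0 + 1), ∑ I : Finset (Fin 2),
        (if (h.val = 0 ∧ I = ∅) ∨ (h.val = 0 ∧ I = univ) then 0 else
          wave t Φ h (multiIndex a I) * wave t Φ (0 - h) (multiIndex a Iᶜ)) =
        2 * wave t Φ 0 (Finsupp.single (a 0) 1) * wave t Φ 0 (Finsupp.single (a 1) 1) := by
      refine Eq.trans ?_ (h2.trans (by ring))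
      refine sum_congr rfl fun h _ => sum_congr rfl fun I _ => ?_
      rw [show (h : ℕ) = 0 by omega]
    rw [h5]
    linear_combination h3

/-- The other initial case. The source is `-ω_{0,2}(p, -p) = -1/(4p²)`, whence `-(1/4) (256 t)⁻¹ =
-(1024 t)⁻¹`. -/
theorem isSource_one_one :
    IsSource t (curveSeries t Φ) (bracket t 1 (n := 0)) (formalBracket t Φ 1) := by
  have hsum : ∀ {M : Type} [AddCommMonoid M] (T : Fin 2 → Finset (Fin 0) → M),
      ∑ h : Fin 2, ∑ I : Finset (Fin 0), (if (h.val = 0 ∧ I = ∅) ∨ (h.val = 1 ∧ I = univ) then 0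
        else T h I) = 0 := fun T => by
    refine sum_eq_zero fun h _ => sum_eq_zero fun I _ => if_pos ?_
    have : h.val = 0 ∨ h.val = 1 := by omega
    exact this.imp (⟨·, Subsingleton.elim _ _⟩) (⟨·, Subsingleton.elim _ _⟩)
  refine ⟨-(1024 * t)⁻¹ • kernelComb (fun j => basisPair t (curveSeries t Φ)
    (Fin.cons j Fin.elim0 : Fin (0 + 1) → ℕ)) 1, Submodule.smul_mem _ _
      (kernelComb_mem (fun _ => basisPair_mem _) _), fun z hz y hy => ?_, fun a => ?_⟩
  · convert ((hasResidue_kernel_pow t hz 1).const_mul (-(1 / 4))).congr ?_ using 1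
    · rw [Prod.smul_fst, Pi.smul_apply, kernelComb_basisPair_fst, smul_eq_mul, univ_eq_empty,
        prod_empty, mul_inv, mul_inv]
      ring
    · refine Eventually.of_forall fun p => ?_
      rw [bracket, hsum, if_neg one_ne_zero, add_zero, Nat.sub_self, omega_zero_two t rfl]
      have h1 : Fin.last 1 = Fin.succ (0 : Fin 1) := rfl
      simp only [Fin.cons_zero, h1, Fin.cons_succ]
      rw [show p - -p = 2 * p by ring, mul_pow]
      simp only [one_div, mul_inv]
      ring
  · have h7 : genSeries (fun m => (-(1024 * t)⁻¹ • kernelComb (fun j => basisPair t (curveSeries t Φ)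
        (Fin.cons j Fin.elim0 : Fin (0 + 1) → ℕ)) 1).2 (Fin.cons m a)) =
        C (-(1024 * t)⁻¹) * genSeries (fun m => (kernelComb (fun j => basisPair t (curveSeries t Φ)
        (Fin.cons j Fin.elim0 : Fin (0 + 1) → ℕ)) 1).2 (Fin.cons m a)) := by
      rw [← smul_eq_C_mul, ← map_smul]; rfl
    have h1 : multiIndex a univ = 0 := sum_empty
    rw [h7, genSeries_kernelComb_basisPair, formalBracket, hsum, if_neg one_ne_zero, add_zero,
      Nat.sub_self, h1, univ_eq_empty, prod_empty, sum_empty, add_zero, if_pos ⟨rfl, rfl⟩, map_one,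
      one_mul, neg_mul, ← sub_eq_add_neg]
    refine onePoint_genus_one (curveSeries_sq t hΦ) ht ?_ ?_
    -- The coefficient of `w²` would be that of two insertions with index `0`, which vanish by
    -- convention.
    · rw [wavePair, ← zero_add 2, coeff_X_pow_mul, coeff_mk]
      simp
    · have h32 : (32 : PowerSeries ℂ) = C 32 := (map_ofNat _ _).symm
      have h2 : (2 : PowerSeries ℂ) = C 2 := (map_ofNat _ _).symm
      rw [basisSeries_eq, mul_pow, h32, h2]
      ext m
      rw [coeff_C_mul, map_sub, coeff_C_mul, coeff_eulerOp]
      rcases Nat.lt_or_ge m 2 with hm | hm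
      · rw [wavePair, coeff_X_pow_mul', coeff_X_pow_mul', if_neg (by omega), if_neg (by omega)]
        ring
      · obtain ⟨m, rfl⟩ := Nat.exists_eq_add_of_le' hm
        rw [wavePair, coeff_X_pow_mul, coeff_X_pow_mul, coeff_mk, sq, coeff_mul, ← sub_mul,
          ← mul_assoc, mul_sum]
        refine sum_congr rfl fun x hx => ?_
        rw [coeff_mk, coeff_mk, ← mul_genusDeriv_pair t hΦ, ← mem_antidiagonal.mp hx]
        push_cast
        ring

/-- The induction hypothesis puts every stable factor into `basisSpan`. The terms with `ω_{0,2}` on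
the analytic side correspond to the product with the planar two-point series together with the
`shiftSeries` term of the loop equation, which is `shiftedOp`. -/
theorem isSource_general {g n : ℕ} (hgn : 3 ≤ 2 * g + n)
    (ih : ∀ h m, 2 * h + m < 2 * g + n + 1 → 3 ≤ 2 * h + m → 1 ≤ m → Matches t Φ h m) :
    IsSource t (curveSeries t Φ) (bracket t g (n := n)) (formalBracket t Φ g) := by
  have hY := curveSeries_sq t hΦ
  have h1 : IsSource t (curveSeries t Φ) (n := n) (fun p y => if g = 0 then 0 else
      -(curve t).omega (g - 1) (n + 2) (Fin.cons p (Fin.cons (-p) y)))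
      (fun a => if g = 0 then 0 else wavePair t Φ (g - 1) (multiIndex a univ)) := by
    by_cases hg : g = 0
    · simp only [hg, if_true]
      exact isSource_zero
    · obtain ⟨Ψ, hΨ, e1, e2⟩ := ih (g - 1) (n + 2) (by omega) (by omega) (by omega)
      simp only [hg, if_false]
      refine (isSource_pair hY ht hΨ).congr (fun p hp y hy => ?_) fun a => ?_
      · rw [e1]
        exact Fin.cases hp (Fin.cases (neg_ne_zero.mpr hp) hy)
      · symm
        refine wavePair_eq_pairSeries fun p q => ?_
        rw [← e2, multiIndex_cons_univ, multiIndex_cons_univ]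
  have h2 : ∀ (h : Fin (g + 1)) (I : Finset (Fin n)), IsSource t (curveSeries t Φ)
      (fun p y => if 2 ≤ 2 * h.val + #I ∧ 2 ≤ 2 * (g - h.val) + #Iᶜ then
        -((curve t).omega h (#I + 1) (Fin.cons p fun i => y (I.orderEmbOfFin rfl i)) *
          (curve t).omega (g - h) (#Iᶜ + 1) (Fin.cons (-p) fun i => y (Iᶜ.orderEmbOfFin rfl i))) else 0)
      (fun a => if 2 ≤ 2 * h.val + #I ∧ 2 ≤ 2 * (g - h.val) + #Iᶜ then
        wave t Φ h (multiIndex a I) * wave t Φ (g - h) (multiIndex a Iᶜ) else 0) := fun h I => by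
    by_cases hc : 2 ≤ 2 * h.val + #I ∧ 2 ≤ 2 * (g - h.val) + #Iᶜ
    · have hI : #Iᶜ + #I = n := by simp
      have hh := h.isLt
      obtain ⟨Ψ, hΨ, e1, e2⟩ := ih h (#I + 1) (by omega) (by omega) (by omega)
      obtain ⟨Ψ', hΨ', e1', e2'⟩ := ih (g - h) (#Iᶜ + 1) (by omega) (by omega) (by omega)
      simp only [if_pos hc]
      refine (isSource_product hY ht I hΨ hΨ').congr (fun p hp y hy => ?_) fun a => ?_
      · rw [e1 _ (Fin.cases hp fun i => hy _), e1' _ (Fin.cases (neg_ne_zero.mpr hp) fun i => hy _)]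
      · rw [wave_eq_genSeries fun m => (by rw [← e2, multiIndex_cons] :
          genusDeriv t h (multiIndex a I + Finsupp.single m 1) Φ =
            Ψ.2 (Fin.cons m fun i => a (I.orderEmbOfFin rfl i))),
          wave_eq_genSeries fun m => (by rw [← e2', multiIndex_cons] :
          genusDeriv t (g - h) (multiIndex a Iᶜ + Finsupp.single m 1) Φ =
            Ψ'.2 (Fin.cons m fun i => a (Iᶜ.orderEmbOfFin rfl i)))]
    · simp only [if_neg hc]
      exact isSource_zero
  have h3 : ∀ j : Fin n, IsSource t (curveSeries t Φ)
      (fun p y =>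
        -((curve t).omega (0 : Fin (g + 1)) (#{j} + 1)
            (Fin.cons p fun i => y (({j} : Finset (Fin n)).orderEmbOfFin rfl i)) *
          (curve t).omega (g - (0 : Fin (g + 1))) (#{j}ᶜ + 1)
            (Fin.cons (-p) fun i => y (({j} : Finset (Fin n))ᶜ.orderEmbOfFin rfl i))) +
        -((curve t).omega (Fin.last g) (#{j}ᶜ + 1)
            (Fin.cons p fun i => y (({j} : Finset (Fin n))ᶜ.orderEmbOfFin rfl i)) *
          (curve t).omega (g - Fin.last g) (#({j}ᶜ)ᶜ + 1)
            (Fin.cons (-p) fun i => y (({j} : Finset (Fin n))ᶜᶜ.orderEmbOfFin rfl i))))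
      (fun a => wave t Φ (0 : Fin (g + 1)) (multiIndex a {j}) *
          wave t Φ (g - (0 : Fin (g + 1))) (multiIndex a {j}ᶜ) +
        wave t Φ (Fin.last g) (multiIndex a {j}ᶜ) *
          wave t Φ (g - Fin.last g) (multiIndex a ({j}ᶜ)ᶜ) +
        shiftSeries (a j) (wave t Φ g (multiIndex a {j}ᶜ))) := fun j => by
    have hj : #({j} : Finset (Fin n))ᶜ + 1 = n := by
      have h := card_compl_add_card ({j} : Finset (Fin n))
      rwa [card_singleton, Fintype.card_fin] at h
    obtain ⟨Ψ, hΨ, e1, e2⟩ := ih g (#({j} : Finset (Fin n))ᶜ + 1) (by omega) (by omega) (by omega)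
    refine (isSource_bergman hY ht j (twoPoint_equation t hΦ) hΨ).congr
      (fun p hp y hy => ?_) fun a => ?_
    · rw [Fin.val_last, Fin.val_zero, Nat.sub_zero, Nat.sub_self, omega_singleton t rfl,
        omega_singleton t (compl_compl _), e1 _ (Fin.cases (neg_ne_zero.mpr hp) fun i => hy _),
        e1 _ (Fin.cases hp fun i => hy _)]
      ring
    · rw [Fin.val_last, Fin.val_zero, Nat.sub_zero, Nat.sub_self, compl_compl, shiftedOp_apply,
        wave_eq_genSeries fun m => (by rw [← e2, multiIndex_cons] :
          genusDeriv t g (multiIndex a {j}ᶜ + Finsupp.single m 1) Φ =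
            Ψ.2 (Fin.cons m fun i => a (({j} : Finset (Fin n))ᶜ.orderEmbOfFin rfl i))),
        show multiIndex a {j} = Finsupp.single (a j) 1 from sum_singleton _ _]
      ring
  refine (h1.add ((IsSource.sum (s := univ) fun h _ => IsSource.sum (s := univ) fun I _ =>
    h2 h I).add (IsSource.sum (s := univ) fun j _ => h3 j))).congr (fun p _ y _ => ?_) fun a => ?_
  · rw [bracket, sum_of_unstable_factor (by omega) (by omega)]
  · rw [formalBracket, sum_of_unstable_factor (by omega) (by omega), if_neg (by omega : ¬(n = 0 ∧ g = 1)), add_zero]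
    simp only [sum_add_distrib]
    ring

theorem matches_stable (g n : ℕ) (hgn : 3 ≤ 2 * g + n) (hn : 1 ≤ n) : Matches t Φ g n := by
  induction hN : 2 * g + n using Nat.strong_induction_on generalizing g n with
  | _ N ih =>
    obtain ⟨n, rfl⟩ := Nat.exists_eq_add_of_le' hn
    refine matches_of_isSource t hΦ (by omega) ?_
    rcases Nat.lt_or_ge (2 * g + n) 3 with h | h
    · have h1 : (g = 0 ∧ n = 2) ∨ (g = 1 ∧ n = 0) := by omega
      rcases h1 with ⟨rfl, rfl⟩ | ⟨rfl, rfl⟩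
      · exact isSource_zero_three t hΦ ht
      · exact isSource_one_one t hΦ ht
    · exact isSource_general t hΦ ht h fun h m h1 h2 h3 => ih _ (by omega) h m h2 h3 rfl

end Recursion

end ModifiedGUE
end

noncomputable section
namespace ModifiedGUE
open Finset

/-! ### Convergence of the expansions -/

section Evaluation
open PowerSeries

/-- The power series `φ` converges at `w` and its sum is `v`. -/
def HasEval (φ : PowerSeries ℂ) (w v : ℂ) : Prop := HasSum (fun n => coeff n φ * w ^ n) v

variable {φ ψ : PowerSeries ℂ} {w v v' : ℂ}

theorem HasEval.unique (h : HasEval φ w v) (h' : HasEval φ w v') : v = v' := HasSum.unique h h'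

theorem HasEval.add (h : HasEval φ w v) (h' : HasEval ψ w v') : HasEval (φ + ψ) w (v + v') := by
  have h1 : (fun n => coeff n (φ + ψ) * w ^ n) = fun n => coeff n φ * w ^ n + coeff n ψ * w ^ n := by
    funext n
    rw [map_add, add_mul]
  rw [HasEval, h1]
  exact HasSum.add h h'

theorem HasEval.mul (h : HasEval φ w v) (h' : HasEval ψ w v') : HasEval (φ * ψ) w (v * v') := by
  have h1 := summable_norm_iff.mpr (HasSum.summable h)
  have h2 := summable_norm_iff.mpr (HasSum.summable h')
  have h3 : (fun n => ∑ kl ∈ antidiagonal n, coeff kl.1 φ * w ^ kl.1 * (coeff kl.2 ψ * w ^ kl.2)) =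
      fun n => coeff n (φ * ψ) * w ^ n := by
    funext n
    rw [coeff_mul, sum_mul]
    refine sum_congr rfl fun x hx => ?_
    rw [← mem_antidiagonal.mp hx, pow_add]
    ring
  have h4 := (summable_norm_sum_mul_antidiagonal_of_summable_norm h1 h2).of_norm
  have h5 := tsum_mul_tsum_eq_tsum_sum_antidiagonal_of_summable_norm h1 h2
  rw [h3] at h4 h5
  rw [HasSum.tsum_eq h, HasSum.tsum_eq h'] at h5
  rw [h5]
  exact h4.hasSum

theorem hasEval_C (c w : ℂ) : HasEval (C c) w c := by
  have h := hasSum_single (f := fun n => coeff n (C c) * w ^ n) 0 fun n hn => by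
    rw [coeff_C, if_neg hn, zero_mul]
  simpa [HasEval] using h

theorem hasEval_X (w : ℂ) : HasEval X w w := by
  have h := hasSum_single (f := fun n => coeff n (X : PowerSeries ℂ) * w ^ n) 1 fun n hn => by
    rw [coeff_X, if_neg hn, zero_mul]
  simpa [HasEval] using h

theorem HasEval.pow (h : HasEval φ w v) (k : ℕ) : HasEval (φ ^ k) w (v ^ k) := by
  induction k with
  | zero => simpa using hasEval_C 1 w
  | succ k ih => rw [pow_succ, pow_succ]; exact ih.mul h

theorem hasEval_rescale {a : ℂ} (h : HasEval φ a v) : HasEval (rescale a φ) 1 v := by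
  have : (fun n => coeff n (rescale a φ) * 1 ^ n) = fun n => coeff n φ * a ^ n := by
    funext n
    rw [coeff_rescale]
    ring
  rw [HasEval, this]
  exact h

theorem hasEval_uSeries {t : ℂ} (h : ‖4 * t * w‖ < 1) : HasEval (uSeries t) w (16 * (1 - 4 * t * w)⁻¹) := by
  have h1 := (hasSum_geometric_of_norm_lt_one h).mul_left 16
  have h2 : (fun n => coeff n (uSeries t) * w ^ n) = fun n => 16 * (4 * t * w) ^ n := by
    funext n
    rw [uSeries, coeff_mk, mul_pow _ w]
    ring
  rw [HasEval, h2]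
  exact h1

section Branch

variable {t : ℂ} {Y : PowerSeries ℂ} (hY : 16 * Y ^ 2 = 1 - 4 * C t * X)
  (hY0 : constantCoeff Y = -(1 / 4))
include hY

/-- The differential equation of the square root, read coefficientwise; it yields the geometric
bound `norm_coeff_le`. -/
theorem coeff_succ_of_sq (n : ℕ) : ((n : ℂ) + 1) * coeff (n + 1) Y = t * (4 * n - 2) * coeff n Y := by
  have h1 := eulerOp_Y hY
  have h2 := mul_uSeries t
  have h3 : eulerOp Y = C (4 * t) * (X * eulerOp Y) - C (2 * t) * (X * Y) := by
    have h4 : (32 : PowerSeries ℂ) ≠ 0 := by norm_num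
    refine mul_left_cancel₀ h4 ?_
    rw [map_mul C 4, map_mul C 2, map_ofNat, map_ofNat]
    linear_combination (1 - 4 * C t * X) * h1 - Y * h2
  have h4 := congrArg (coeff (n + 1)) h3
  rw [map_sub, coeff_C_mul, coeff_C_mul, coeff_succ_X_mul, coeff_succ_X_mul, coeff_eulerOp,
    coeff_eulerOp] at h4
  push_cast at h4
  linear_combination h4

include hY0

theorem norm_coeff_le (n : ℕ) : ‖coeff n Y‖ ≤ (4 * ‖t‖) ^ n / 4 := by
  induction n with
  | zero => rw [coeff_zero_eq_constantCoeff_apply, hY0]; norm_num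
  | succ n ih =>
    have h1 := congrArg norm (coeff_succ_of_sq hY n)
    rw [norm_mul, norm_mul, norm_mul] at h1
    have h2 : ‖(n : ℂ) + 1‖ = n + 1 := by
      rw [← Nat.cast_succ, Complex.norm_natCast]; push_cast; rfl
    have h3 : ‖(4 * n - 2 : ℂ)‖ ≤ 4 * (n + 1) := by
      refine (norm_sub_le _ _).trans ?_
      rw [norm_mul, Complex.norm_natCast]
      norm_num
      linarith
    rw [h2] at h1
    have h4 : (0 : ℝ) < n + 1 := by positivity
    refine le_of_mul_le_mul_left ?_ h4
    rw [h1]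
    calc ‖t‖ * ‖(4 * n - 2 : ℂ)‖ * ‖coeff n Y‖ ≤ ‖t‖ * (4 * (n + 1)) * ((4 * ‖t‖) ^ n / 4) := by gcongr
      _ = _ := by ring

theorem hasEval_of_sq {y : ℂ} (hw : 16 * ‖t‖ * ‖w‖ < 1) (hy : y.re < 0)
    (hyw : 16 * y ^ 2 = 1 - 4 * t * w) : HasEval Y w y := by
  have hle : ∀ n, ‖coeff n Y * w ^ n‖ ≤ (1 / 4) ^ n / 4 := fun n => by
    rw [norm_mul, norm_pow]
    calc _ ≤ (4 * ‖t‖) ^ n / 4 * ‖w‖ ^ n := by gcongr; exact norm_coeff_le hY hY0 n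
      _ = (4 * ‖t‖ * ‖w‖) ^ n / 4 := by rw [mul_pow _ ‖w‖]; ring
      _ ≤ _ := by gcongr; linarith
  have hg : HasSum (fun n : ℕ => ((1 / 4 : ℝ)) ^ n / 4) (1 / 3) := by
    have := (hasSum_geometric_of_lt_one (r := 1 / 4) (by norm_num) (by norm_num)).div_const 4
    rwa [show ((1 - 1 / 4 : ℝ)⁻¹ / 4) = 1 / 3 by norm_num] at this
  have hs : Summable fun n => coeff n Y * w ^ n := Summable.of_norm_bounded hg.summable hle
  obtain ⟨v, hv⟩ := hs
  have h1 : HasEval Y w v := hv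
  have h2 := ((hasEval_C 16 w).mul (h1.pow 2)).unique (v' := 1 - 4 * t * w) (by
    rw [map_ofNat, hY]
    have := (hasEval_C 1 w).add ((hasEval_C (-(4 * t)) w).mul (hasEval_X w))
    convert this using 1
    · simp only [map_neg, map_mul, map_ofNat, map_one]; ring
    · ring)
  -- The sum satisfies `v² = y²`. The tail bound `∑_{n ≥ 1} 4^(-n)/4 = 1/12` around the constant
  -- term `-1/4` forces `Re v < 0`, which selects `v = y`.
  have h3 : ‖v + 1 / 4‖ ≤ 1 / 12 := by
    have h4 := (hasSum_nat_add_iff' 1).mpr hv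
    have h5 := (hasSum_nat_add_iff' 1).mpr hg
    rw [sum_range_one, coeff_zero_eq_constantCoeff_apply, hY0] at h4
    rw [sum_range_one] at h5
    have h6 := tsum_of_norm_bounded h5 fun n => hle (n + 1)
    rw [h4.tsum_eq] at h6
    convert h6 using 1
    · congr 1; ring
    · norm_num
  have h4 : v.re < 0 := by
    have h5 := (Complex.re_le_norm _).trans h3
    rw [Complex.add_re] at h5
    norm_num at h5
    linarith
  have h5 : (v - y) * (v + y) = 0 := by linear_combination (h2 - hyw) / 16
  rcases mul_eq_zero.mp h5 with h6 | h6
  · rw [← sub_eq_zero.mp h6]; exact h1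
  · have := congrArg Complex.re h6
    rw [Complex.add_re, Complex.zero_re] at this
    linarith

end Branch

end Evaluation

/-! ### Sums over tuples and antidiagonals. -/

section Tuples

theorem hasSum_mul_prod {α β : Type*} {f : α → ℂ} {g : β → ℂ} {c d : ℂ} (hf : HasSum f c)
    (hg : HasSum g d) : HasSum (fun x : α × β => f x.1 * g x.2) (c * d) :=
  HasSum.mul hf hg (summable_mul_of_summable_norm hf.summable.norm hg.summable.norm)

theorem hasSum_prod_tuple {n : ℕ} {f : Fin n → ℕ+ → ℂ} {v : Fin n → ℂ} (h : ∀ i, HasSum (f i) (v i)) :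
    HasSum (fun a : Fin n → ℕ+ => ∏ i, f i (a i)) (∏ i, v i) := by
  induction n with
  | zero => simp
  | succ n ih =>
    have h1 := ih fun i => h i.succ
    have h2 := hasSum_mul_prod (h 0) h1
    rw [← (Fin.consEquiv fun _ => ℕ+).hasSum_iff, Fin.prod_univ_succ]
    have h3 : (fun a : Fin (n + 1) → ℕ+ => ∏ i, f i (a i)) ∘ (Fin.consEquiv fun _ => ℕ+) =
        fun x : ℕ+ × (Fin n → ℕ+) => f 0 x.1 * ∏ i, f i.succ (x.2 i) := by
      funext x
      rw [Function.comp_apply, Fin.prod_univ_succ]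
      rfl
    rw [h3]
    exact h2

theorem hasSum_sum_antidiagonal {F : ℕ × ℕ → ℂ} {s : ℂ} (h : HasSum F s) :
    HasSum (fun n => ∑ x ∈ antidiagonal n, F x) s := by
  have h1 := (Finset.HasAntidiagonal.sigmaAntidiagonalEquivProd (A := ℕ)).hasSum_iff.mpr h
  refine h1.sigma fun n => ?_
  have h2 := hasSum_fintype fun x : antidiagonal n => F x
  rw [sum_coe_sort (antidiagonal n) F] at h2
  exact h2

end Tuples

end ModifiedGUE
end

noncomputable section
namespace ModifiedGUE
open Finset

/-! ### Rational functions on the generic points -/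

section Rational

/-- `f` agrees on the generic points with a rational function that is regular there. -/
def IsRat {n : ℕ} (f : (Fin n → ℂ) → ℂ) : Prop :=
  ∃ P Q : MvPolynomial (Fin n) ℂ, ∀ y ∈ genericPoints n,
    MvPolynomial.eval y Q ≠ 0 ∧ f y = MvPolynomial.eval y P / MvPolynomial.eval y Q

variable {n : ℕ} {f g : (Fin n → ℂ) → ℂ}

theorem IsRat.congr (hf : IsRat f) (h : ∀ y ∈ genericPoints n, f y = g y) : IsRat g := by
  obtain ⟨P, Q, hPQ⟩ := hf
  exact ⟨P, Q, fun y hy => ⟨(hPQ y hy).1, by rw [← h y hy, (hPQ y hy).2]⟩⟩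

theorem isRat_eval (P : MvPolynomial (Fin n) ℂ) : IsRat fun y => MvPolynomial.eval y P :=
  ⟨P, 1, fun y _ => by simp⟩

theorem IsRat.add (hf : IsRat f) (hg : IsRat g) : IsRat fun y => f y + g y := by
  obtain ⟨P, Q, hPQ⟩ := hf
  obtain ⟨R, S, hRS⟩ := hg
  refine ⟨P * S + Q * R, Q * S, fun y hy => ?_⟩
  obtain ⟨h1, h2⟩ := hPQ y hy
  obtain ⟨h3, h4⟩ := hRS y hy
  simp only [map_mul, map_add]
  exact ⟨mul_ne_zero h1 h3, by rw [h2, h4, div_add_div _ _ h1 h3]⟩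

theorem IsRat.mul (hf : IsRat f) (hg : IsRat g) : IsRat fun y => f y * g y := by
  obtain ⟨P, Q, hPQ⟩ := hf
  obtain ⟨R, S, hRS⟩ := hg
  refine ⟨P * R, Q * S, fun y hy => ?_⟩
  obtain ⟨h1, h2⟩ := hPQ y hy
  obtain ⟨h3, h4⟩ := hRS y hy
  simp only [map_mul]
  exact ⟨mul_ne_zero h1 h3, by rw [h2, h4, div_mul_div_comm]⟩

theorem IsRat.prod {ι : Type*} {s : Finset ι} {f : ι → (Fin n → ℂ) → ℂ} (h : ∀ i ∈ s, IsRat (f i)) :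
    IsRat fun y => ∏ i ∈ s, f i y := by
  classical
  induction s using Finset.induction_on with
  | empty => simpa using isRat_eval (n := n) 1
  | insert i s hi ih =>
    simp only [prod_insert hi]
    exact (h i (mem_insert_self i s)).mul (ih fun j hj => h j (mem_insert_of_mem hj))

theorem isRat_div (P Q : MvPolynomial (Fin n) ℂ)
    (h : ∀ y ∈ genericPoints n, MvPolynomial.eval y Q ≠ 0) :
    IsRat fun y => MvPolynomial.eval y P / MvPolynomial.eval y Q :=
  ⟨P, Q, fun y hy => ⟨h y hy, rfl⟩⟩

theorem isRat_basisSpan {t : ℂ} {Y : PowerSeries ℂ}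
    {Ψ : ((Fin n → ℂ) → ℂ) × ((Fin n → ℕ+) → ℂ)} (hΨ : Ψ ∈ basisSpan t Y n) : IsRat Ψ.1 := by
  induction hΨ using Submodule.span_induction with
  | mem Ψ h =>
    obtain ⟨k, rfl⟩ := h
    change IsRat fun y => ∏ i, (y i ^ 2)⁻¹ ^ (k i + 1)
    refine IsRat.prod fun i _ => (isRat_div 1
      ((MvPolynomial.X i ^ 2) ^ (k i + 1)) fun y hy => ?_).congr fun y _ => ?_
    · simpa using (hy.1 i).1
    · simp
  | zero => exact (isRat_eval (n := n) 0).congr fun y _ => map_zero _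
  | add Φ Ψ _ _ h1 h2 => exact h1.add h2
  | smul c Φ _ h1 => 
    refine ((isRat_eval (MvPolynomial.C c)).mul h1).congr fun y _ => ?_
    rw [MvPolynomial.eval_C]
    rfl
end Rational

/-! ### Expansions on the physical sheet -/

section Physical
open PowerSeries

variable {t y : ℂ} (ht : t ≠ 0)
include ht

omit ht in
theorem inv_curve_x : ((curve t).x y)⁻¹ = (1 - 16 * y ^ 2) / (4 * t) := inv_div _ _

theorem curve_sq : 16 * y ^ 2 = 1 - 4 * t * ((curve t).x y)⁻¹ := by
  rw [inv_curve_x]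
  field_simp
  ring

variable (hy : y.re < 0 ∧ 16 * ‖t‖ < ‖(curve t).x y‖)
include hy

omit ht in
theorem norm_inv_curve_x : 16 * ‖t‖ * ‖((curve t).x y)⁻¹‖ < 1 := by
  have h : 0 < ‖(curve t).x y‖ := lt_of_le_of_lt (by positivity) hy.2
  rw [norm_inv, ← div_eq_mul_inv, div_lt_one h]
  exact hy.2

omit ht in
theorem physical_ne_zero : y ≠ 0 := fun h => by
  have := hy.1
  rw [h] at this
  simp at this

variable {Y : PowerSeries ℂ} (hY : 16 * Y ^ 2 = 1 - 4 * C t * X)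
  (hY0 : constantCoeff Y = -(1 / 4))
include hY hY0

theorem hasEval_curve : HasEval Y ((curve t).x y)⁻¹ y :=
  hasEval_of_sq hY hY0 (norm_inv_curve_x hy) hy.1 (curve_sq ht)

theorem hasEval_basisSeries (k : ℕ) : HasEval (basisSeries t Y k) ((curve t).x y)⁻¹
    ((y ^ 2)⁻¹ ^ (k + 1) * ((1 - 16 * y ^ 2) ^ 2 / (128 * t * y))) := by
  have hn : ‖4 * t * ((curve t).x y)⁻¹‖ < 1 := by
    have := norm_inv_curve_x hy
    rw [norm_mul, norm_mul]
    norm_num at this ⊢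
    have : 0 ≤ ‖t‖ * ‖(curve t).x y‖⁻¹ := by positivity
    linarith
  have hu := hasEval_uSeries hn
  have hy0 := physical_ne_zero hy
  rw [← curve_sq ht] at hu
  have h := (hasEval_C (t / 8) _).mul ((((hasEval_X _).pow 2).mul (hasEval_curve ht hy hY hY0)).mul
    (hu.pow (k + 2)))
  rw [← basisSeries] at h
  rw [mul_inv, mul_inv_cancel_left₀ (by norm_num)] at h
  convert h using 1
  rw [inv_curve_x]
  have h1 : (y ^ 2)⁻¹ ^ (k + 2) = (y ^ 2)⁻¹ ^ (k + 1) * (y ^ 2)⁻¹ := pow_succ _ _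
  rw [h1]
  generalize (y ^ 2)⁻¹ ^ (k + 1) = A
  field_simp
  ring

omit hY hY0 hy ht in
theorem hasSum_of_hasEval {f : ℕ → ℂ} (h0 : f 0 = 0) {w v : ℂ}
    (h : HasEval (X * PowerSeries.mk f) w v) :
    HasSum (fun a : ℕ+ => f a * w ^ ((a : ℕ) + 1)) v := by
  have hinj : Function.Injective fun a : ℕ+ => (a : ℕ) + 1 := fun a b hab =>
    PNat.coe_injective (Nat.succ_injective hab)
  have h1 := (hinj.hasSum_iff (f := fun n => coeff n (X * PowerSeries.mk f) * w ^ n)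
    fun n hn => ?_).mpr h
  · convert h1 using 1
    funext a
    rw [Function.comp_apply, coeff_succ_X_mul, coeff_mk]
  · rcases n with _ | _ | n
    · simp
    · simp [h0]
    · exact absurd ⟨n.succPNat, rfl⟩ hn

theorem hasSum_basisCoeff (k : ℕ) :
    HasSum (fun a : ℕ+ => basisCoeff t Y k a * ((curve t).x y)⁻¹ ^ ((a : ℕ) + 1))
      ((y ^ 2)⁻¹ ^ (k + 1) * ((1 - 16 * y ^ 2) ^ 2 / (128 * t * y))) := by
  refine hasSum_of_hasEval (basisCoeff_zero k) ?_
  rw [← basisSeries_eq]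
  exact hasEval_basisSeries ht hy hY hY0 k

end Physical

/-! ### Expansions in several variables and the planar two-point function. -/

section PhysicalTuples
open PowerSeries

/-- The candidate `κ X² / (Y₁ Y₂ (Y₁ + Y₂)²)` has no constant term and the prescribed Euler
derivative, hence equals `φ`. -/
theorem mul_eq_of_eulerOp {s₁ s₂ κ : ℂ} {Y₁ Y₂ φ : PowerSeries ℂ}
    (h₁ : 16 * Y₁ ^ 2 = 1 - 4 * C s₁ * X) (h₂ : 16 * Y₂ ^ 2 = 1 - 4 * C s₂ * X)
    (h₁0 : constantCoeff Y₁ = -(1 / 4)) (h₂0 : constantCoeff Y₂ = -(1 / 4))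
    (hφ0 : constantCoeff φ = 0) (hφ : 32 * eulerOp φ =
      C κ * (X ^ 2 * (Y₁ * Y₂) * (uSeries s₁ ^ 2 * uSeries s₂ ^ 2))) :
    φ * (Y₁ * Y₂) * (Y₁ + Y₂) ^ 2 = C κ * X ^ 2 := by
  have hc : constantCoeff (Y₁ + Y₂) ≠ 0 := by rw [map_add, h₁0, h₂0]; norm_num
  have hV := PowerSeries.mul_inv_cancel _ hc
  set V := (Y₁ + Y₂)⁻¹
  have q₁ := uSeries_mul_sq h₁
  have q₂ := uSeries_mul_sq h₂
  have hu₁ := eulerOp_uSeries h₁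
  have hu₂ := eulerOp_uSeries h₂
  have hY₁ := eulerOp_Y h₁
  have hY₂ := eulerOp_Y h₂
  have hθV : eulerOp V = -V ^ 2 * (eulerOp Y₁ + eulerOp Y₂) := by
    have h := congrArg eulerOp hV
    rw [Derivation.leibniz, map_add, Derivation.map_one_eq_zero, smul_eq_mul, smul_eq_mul] at h
    linear_combination V * h - eulerOp V * hV
  set u₁ := uSeries s₁
  set u₂ := uSeries s₂
  have hψ : φ = C κ * (X ^ 2 * ((u₁ * u₂) * ((Y₁ * Y₂) * V ^ 2))) := by
    refine eulerOp_injective (c := 0) (by rw [coeff_zero_eq_constantCoeff_apply, hφ0])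
      (by simp) ?_
    refine mul_left_cancel₀ (show (32 : PowerSeries ℂ) ≠ 0 by norm_num) ?_
    simp only [Derivation.leibniz, Derivation.leibniz_pow, eulerOp_C, eulerOp_X, smul_eq_mul,
      nsmul_eq_mul, Nat.cast_zero, map_zero, zero_mul, mul_zero, add_zero, Nat.cast_ofNat]
    rw [hφ]
    generalize C κ = k
    linear_combination -(2 * k * X ^ 2 * u₂ * Y₁ * Y₂ * V ^ 2) * hu₁ -
      2 * k * X ^ 2 * u₁ * Y₁ * Y₂ * V ^ 2 * hu₂ -
      k * X ^ 2 * u₁ * u₂ * Y₂ * V ^ 2 * hY₁ - k * X ^ 2 * u₁ * u₂ * Y₁ * V ^ 2 * hY₂ -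
      64 * k * X ^ 2 * u₁ * u₂ * Y₁ * Y₂ * V * hθV +
      2 * k * X ^ 2 * u₁ * u₂ * Y₁ * Y₂ * V ^ 3 * (hY₁ + hY₂) +
      32 * k * X ^ 2 * u₁ * u₂ * Y₁ * Y₂ * V ^ 2 * hV +
      k * X ^ 2 * Y₁ * Y₂ * V ^ 2 * u₁ * u₂ * (u₂ * q₁ + u₁ * q₂) +
      2 * k * X ^ 2 * u₁ * u₂ * Y₁ * Y₂ * V ^ 3 * (u₁ * Y₁ * q₂ + u₂ * Y₂ * q₁) -
      2 * k * X ^ 2 * u₁ * u₂ * Y₁ * Y₂ * V ^ 2 * u₁ * u₂ * Y₁ * Y₂ * hV -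
      k * X ^ 2 * Y₁ * Y₂ * u₁ ^ 2 * u₂ ^ 2 * ((Y₁ + Y₂) * V + 1) * hV
  rw [hψ]
  linear_combination C κ * X ^ 2 * (u₂ * Y₂ ^ 2 * q₁ + q₂) * ((Y₁ + Y₂) * V) ^ 2 +
    C κ * X ^ 2 * ((Y₁ + Y₂) * V + 1) * hV

variable {t : ℂ} (ht : t ≠ 0) {Y : PowerSeries ℂ} (hY : 16 * Y ^ 2 = 1 - 4 * C t * X)
  (hY0 : constantCoeff Y = -(1 / 4))
include ht hY hY0

theorem hasSum_basisSpan {n : ℕ} {y : Fin n → ℂ}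
    (hy : ∀ i, (y i).re < 0 ∧ 16 * ‖t‖ < ‖(curve t).x (y i)‖)
    {Ψ : ((Fin n → ℂ) → ℂ) × ((Fin n → ℕ+) → ℂ)} (hΨ : Ψ ∈ basisSpan t Y n) :
    HasSum (fun a => Ψ.2 a * ∏ i, ((curve t).x (y i))⁻¹ ^ ((a i : ℕ) + 1))
      (Ψ.1 y * ∏ i, (1 - 16 * y i ^ 2) ^ 2 / (128 * t * y i)) := by
  induction hΨ using Submodule.span_induction with
  | mem Ψ h =>
    obtain ⟨k, rfl⟩ := h
    have h1 := hasSum_prod_tuple fun i => hasSum_basisCoeff ht (hy i) hY hY0 (k i)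
    simp only [prod_mul_distrib] at h1
    exact h1
  | zero => simp
  | add Φ Ψ _ _ h1 h2 =>
    simpa only [Prod.fst_add, Prod.snd_add, Pi.add_apply, add_mul] using h1.add h2
  | smul c Φ _ h1 =>
    simpa only [Prod.smul_fst, Prod.smul_snd, Pi.smul_apply, smul_eq_mul, mul_assoc] using
      h1.mul_left c

/-- The planar two-point function. -/
theorem hasSum_twoPoint {c : ℕ → ℕ → ℂ} (hc : ∀ p q : ℕ, 32 * ((p : ℂ) + q) * c p q =
      basisCoeff t Y 0 p * basisCoeff t Y 0 q) (hc0 : c 0 0 = 0) {y₁ y₂ : ℂ}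
    (h₁ : y₁.re < 0 ∧ 16 * ‖t‖ < ‖(curve t).x y₁‖) (h₂ : y₂.re < 0 ∧ 16 * ‖t‖ < ‖(curve t).x y₂‖) :
    HasSum (fun x : ℕ × ℕ => c x.1 x.2 * (((curve t).x y₁)⁻¹ ^ (x.1 + 1) *
      ((curve t).x y₂)⁻¹ ^ (x.2 + 1)))
      (((1 - 16 * y₁ ^ 2) * (1 - 16 * y₂ ^ 2)) ^ 2 / (128 ^ 2 * t ^ 2 * (y₁ * y₂) * (y₁ + y₂) ^ 2)) := by
  set w₁ := ((curve t).x y₁)⁻¹ with hw₁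
  set w₂ := ((curve t).x y₂)⁻¹ with hw₂
  -- Since `32 (p + q) ≥ 1` unless `p = q = 0`, the double series is dominated by a product of two
  -- absolutely convergent ones.
  have hbound : ∀ p q : ℕ, ‖c p q‖ ≤ ‖basisCoeff t Y 0 p‖ * ‖basisCoeff t Y 0 q‖ := fun p q => by
    rw [← norm_mul, ← hc, norm_mul]
    rcases Nat.eq_zero_or_pos (p + q) with h | h
    · obtain ⟨rfl, rfl⟩ := Nat.add_eq_zero_iff.mp h
      rw [hc0, norm_zero, mul_zero]
    · rw [norm_mul, ← Nat.cast_add, Complex.norm_natCast]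
      refine le_mul_of_one_le_left (norm_nonneg _) ?_
      have : (1 : ℝ) ≤ (p + q : ℕ) := by exact_mod_cast h
      norm_num at this ⊢
      linarith
  have hsum : ∀ y : ℂ, (y.re < 0 ∧ 16 * ‖t‖ < ‖(curve t).x y‖) →
      Summable fun p => ‖basisCoeff t Y 0 p * ((curve t).x y)⁻¹ ^ (p + 1)‖ := fun y hy =>
    ((summable_nat_add_iff 1).mpr (HasSum.summable (hasEval_basisSeries ht hy hY hY0 0))).norm
  obtain ⟨v, hv⟩ : Summable fun x : ℕ × ℕ => c x.1 x.2 * (w₁ ^ (x.1 + 1) * w₂ ^ (x.2 + 1)) := by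
    refine Summable.of_norm_bounded ((hsum y₁ h₁).mul_norm (hsum y₂ h₂)) fun x => ?_
    rw [norm_mul, norm_mul, norm_mul, norm_mul, norm_mul]
    have h := hbound x.1 x.2
    calc _ ≤ ‖basisCoeff t Y 0 x.1‖ * ‖basisCoeff t Y 0 x.2‖ *
          (‖w₁ ^ (x.1 + 1)‖ * ‖w₂ ^ (x.2 + 1)‖) := by gcongr
      _ = _ := by ring
  have hv' := hasSum_sum_antidiagonal hv
  -- The two-point series on the ray `(λ w₁, λ w₂)`, divided by `λ²`. The Euler operator in `λ`
  -- multiplies by `p + q`, so `hc` becomes a one-variable differential equation; evaluation is at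
  -- `λ = 1`.
  set f : ℕ → ℂ := fun n => ∑ x ∈ antidiagonal n, c x.1 x.2 * (w₁ ^ (x.1 + 1) * w₂ ^ (x.2 + 1)) with hf
  have hfe : HasEval (PowerSeries.mk f) 1 v := by
    have : (fun n => coeff n (PowerSeries.mk f) * 1 ^ n) = f := by
      funext n
      rw [coeff_mk, one_pow, mul_one]
    rw [HasEval, this]
    exact hv'
  have hC : ∀ w c : ℂ, rescale w (C c) = C c := fun w c => by
    ext n
    rw [coeff_rescale, coeff_C]
    split_ifs with h <;> simp [h]
  have hE : ∀ w : ℂ, X * PowerSeries.mk (fun p => basisCoeff t Y 0 p * w ^ (p + 1)) =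
      C (t * w ^ 2 / 8) * (X ^ 2 * rescale w Y * uSeries (t * w) ^ 2) := fun w => by
    have e1 : rescale w (basisSeries t Y 0) =
        X * PowerSeries.mk (fun p => basisCoeff t Y 0 p * w ^ (p + 1)) := by
      rw [basisSeries_eq]
      ext n
      rw [coeff_rescale]
      rcases n with _ | n
      · simp
      · rw [coeff_succ_X_mul, coeff_succ_X_mul, coeff_mk, coeff_mk, mul_comm]
    have e2 : rescale w (uSeries t) = uSeries (t * w) := by
      ext n
      rw [coeff_rescale, uSeries, uSeries, coeff_mk, coeff_mk, ← mul_assoc 4, mul_pow _ w]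
      ring
    rw [← e1, basisSeries, map_mul, map_mul, map_mul, map_pow, map_pow, e2, hC, rescale_X,
      show t * w ^ 2 / 8 = t / 8 * w ^ 2 by ring, map_mul, map_pow]
    ring
  have hθ : 32 * eulerOp (PowerSeries.mk f) =
      C (t ^ 2 * w₁ ^ 2 * w₂ ^ 2 / 64) * (X ^ 2 * (rescale w₁ Y * rescale w₂ Y) *
        (uSeries (t * w₁) ^ 2 * uSeries (t * w₂) ^ 2)) := by
    have e1 : 32 * eulerOp (PowerSeries.mk f) =
        PowerSeries.mk (fun p => basisCoeff t Y 0 p * w₁ ^ (p + 1)) *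
          PowerSeries.mk (fun p => basisCoeff t Y 0 p * w₂ ^ (p + 1)) := by
      have h32 : (32 : PowerSeries ℂ) = C 32 := (map_ofNat _ _).symm
      ext n
      rw [h32, coeff_C_mul, coeff_eulerOp, coeff_mk, coeff_mul, hf, mul_sum, mul_sum]
      refine sum_congr rfl fun x hx => ?_
      have e2 := hc x.1 x.2
      rw [← Nat.cast_add, mem_antidiagonal.mp hx] at e2
      rw [coeff_mk, coeff_mk]
      linear_combination w₁ ^ (x.1 + 1) * w₂ ^ (x.2 + 1) * e2
    refine mul_left_cancel₀ (pow_ne_zero 2 (X_ne_zero (R := ℂ))) ?_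
    rw [e1, show t ^ 2 * w₁ ^ 2 * w₂ ^ 2 / 64 = (t * w₁ ^ 2 / 8) * (t * w₂ ^ 2 / 8) by ring, map_mul]
    linear_combination X * PowerSeries.mk (fun p => basisCoeff t Y 0 p * w₂ ^ (p + 1)) * hE w₁ +
      C (t * w₁ ^ 2 / 8) * (X ^ 2 * rescale w₁ Y * uSeries (t * w₁) ^ 2) * hE w₂
  have hYr : ∀ w : ℂ, 16 * rescale w Y ^ 2 = 1 - 4 * C (t * w) * X := fun w => by
    have e1 := congrArg (rescale w) hY
    rw [map_mul, map_pow, map_ofNat, map_sub, map_one, map_mul, map_mul, map_ofNat, rescale_X,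
      hC] at e1
    rw [e1, map_mul]
    ring
  have hYr0 : ∀ w : ℂ, constantCoeff (rescale w Y) = -(1 / 4) := fun w => by
    rw [← coeff_zero_eq_constantCoeff_apply, coeff_rescale, pow_zero, one_mul,
      coeff_zero_eq_constantCoeff_apply, hY0]
  have hclosed := mul_eq_of_eulerOp (hYr w₁) (hYr w₂) (hYr0 w₁) (hYr0 w₂) (by
    rw [hf, ← coeff_zero_eq_constantCoeff_apply, coeff_mk, Nat.antidiagonal_zero, sum_singleton, hc0,
      zero_mul]) hθ
  have hr₁ := hasEval_rescale (hasEval_curve ht h₁ hY hY0)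
  have hr₂ := hasEval_rescale (hasEval_curve ht h₂ hY hY0)
  have hy₁ := physical_ne_zero h₁
  have hy₂ := physical_ne_zero h₂
  have hy₁₂ : y₁ + y₂ ≠ 0 := fun h => by
    have := congrArg Complex.re h
    rw [Complex.add_re, Complex.zero_re] at this
    linarith [h₁.1, h₂.1]
  have e1 := ((hfe.mul (hr₁.mul hr₂)).mul ((hr₁.add hr₂).pow 2)).unique
    (by rw [hclosed]; exact (hasEval_C _ _).mul ((hasEval_X 1).pow 2))
  convert hv using 1
  rw [one_pow, mul_one, hw₁, hw₂, inv_curve_x, inv_curve_x] at e1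
  rw [div_eq_iff (by simp [ht, hy₁, hy₂, hy₁₂])]
  have e2 : v * (y₁ * y₂ * (y₁ + y₂) ^ 2) * (128 ^ 2 * t ^ 2) =
      ((1 - 16 * y₁ ^ 2) * (1 - 16 * y₂ ^ 2)) ^ 2 := by
    rw [← mul_assoc v, e1]
    field_simp
    ring
  linear_combination -e2

end PhysicalTuples

end ModifiedGUE
end

noncomputable section
namespace ModifiedGUE
open Finset

/-! ### The correlation functions -/

section CorrelationFunctions

variable {F : ℕ → MvPowerSeries ℕ+ (Polynomial ℂ)} (hF : IsModifiedFreeEnergy F)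
  {Φ : MvPowerSeries ℕ+ (Polynomial (Polynomial ℂ))}
  (hΦ : ∀ m, virasoroDefect Polynomial.X (Polynomial.C Polynomial.X) Φ m = 0)
  (hΦ' : ∀ μ, genusEval (MvPowerSeries.coeff μ Φ) = MvPowerSeries.coeff μ scaledLog)
  {t : ℂ} (ht : t ≠ 0)

theorem constantCoeff_curveSeries (t : ℂ) (Φ : MvPowerSeries ℕ+ (Polynomial (Polynomial ℂ))) :
    PowerSeries.constantCoeff (curveSeries t Φ) = -(1 / 4) := by
  simp [curveSeries, wave]

theorem deriv_curve_x {y : ℂ} (hy : 16 * y ^ 2 ≠ 1) :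
    deriv (curve t).x y = 128 * t * y / (1 - 16 * y ^ 2) ^ 2 :=
  (hasDerivAt_curve_x t hy).deriv

theorem modified_of_stable {g n : ℕ} (hgn : 3 ≤ 2 * g + n) (G : (Fin n → ℂ) → ℂ) (y : Fin n → ℂ) :
    modified t g n G y = G y := by
  rcases g with _ | g
  · obtain ⟨n, rfl⟩ := Nat.exists_eq_add_of_le' (show 3 ≤ n by omega)
    rfl
  · rfl

include hF hΦ hΦ' ht

theorem exists_correlationFunction_of_stable {g n : ℕ} (hgn : 3 ≤ 2 * g + n) (hn : 1 ≤ n) :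
    ∃ G : (Fin n → ℂ) → ℂ, IsCorrelationFunction F t g n G ∧
      ∀ y ∈ genericPoints n, multidifferential t g n G y = (curve t).omega g n y := by
  obtain ⟨Ψ, hΨ, h1, h2⟩ := matches_stable t hΦ ht g n hgn hn
  refine ⟨fun y => Ψ.1 y * ∏ i, (1 - 16 * y i ^ 2) ^ 2 / (128 * t * y i),
    ⟨?_, 16 * ‖t‖, by simpa using ht, fun y hy => ?_⟩, fun y hy => ?_⟩
  · refine (isRat_basisSpan hΨ).mul (IsRat.prod fun i _ => (isRat_div
      ((1 - MvPolynomial.C 16 * MvPolynomial.X i ^ 2) ^ 2)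
      (MvPolynomial.C (128 * t) * MvPolynomial.X i) fun y hy => ?_).congr fun y _ => ?_)
    · simpa [ht] using (hy.1 i).1
    · simp
  · have h3 := hasSum_basisSpan ht (curveSeries_sq t hΦ) (constantCoeff_curveSeries t Φ) hy hΨ
    simp only [← h2] at h3
    simpa only [correlator_eq hF hΦ' t g hn] using h3
  · rw [multidifferential, modified_of_stable hgn, h1 y fun i => (hy.1 i).1, mul_assoc,
      ← prod_mul_distrib]
    convert mul_one _
    refine prod_eq_one fun i _ => ?_
    obtain ⟨h3, h4⟩ := hy.1 i
    rw [deriv_curve_x h4]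
    have h5 : 1 - 16 * y i ^ 2 ≠ 0 := sub_ne_zero.mpr h4.symm
    field_simp

theorem exists_correlationFunction_zero_one :
    ∃ G : (Fin 1 → ℂ) → ℂ, IsCorrelationFunction F t 0 1 G ∧
      ∀ y ∈ genericPoints 1, multidifferential t 0 1 G y = (curve t).omega 0 1 y := by
  -- This is `y + 1/4 - t/(2x)` with `t/x = (1 - 16 y²)/4`.
  refine ⟨fun y => y 0 + 1 / 8 + 2 * y 0 ^ 2,
    ⟨?_, 16 * ‖t‖, by simpa using ht, fun y hy => ?_⟩, fun y hy => ?_⟩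
  · refine (isRat_eval (MvPolynomial.X 0 + MvPolynomial.C (1 / 8) +
      MvPolynomial.C 2 * MvPolynomial.X 0 ^ 2)).congr fun y _ => ?_
    simp
  · have h1 := hasEval_curve ht (hy 0) (curveSeries_sq t hΦ) (constantCoeff_curveSeries t Φ)
    have h2 := (h1.add ((hasEval_C (-(t / 2)) _).mul (hasEval_X _))).add (hasEval_C (1 / 4) _)
    have h3 : curveSeries t Φ + PowerSeries.C (-(t / 2)) * PowerSeries.X + PowerSeries.C (1 / 4) =
        wave t Φ 0 0 := by
      rw [curveSeries, map_neg]
      ring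
    rw [h3, wave] at h2
    have h4 := hasSum_of_hasEval (by simp) h2
    rw [← (Equiv.funUnique (Fin 1) ℕ+).hasSum_iff] at h4
    convert h4 using 1
    · funext a
      rw [correlator_eq hF hΦ' t 0 le_rfl, Fin.prod_univ_one, Function.comp_apply,
        ← genusDeriv_add_single, multiIndex, Fin.sum_univ_one, zero_add]
      rfl
    · rw [inv_curve_x]
      field_simp
      ring
  · obtain ⟨h3, h4⟩ := hy.1 0
    rw [multidifferential, Fin.prod_univ_one, SpectralCurve.omega, if_pos ⟨rfl, rfl⟩]
    congr 1
    change -(1 / 4) + t / (2 * (4 * t / (1 - 16 * y 0 ^ 2))) + _ = y 0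
    have h5 : 1 - 16 * y 0 ^ 2 ≠ 0 := sub_ne_zero.mpr h4.symm
    field_simp
    ring

theorem exists_correlationFunction_zero_two :
    ∃ G : (Fin 2 → ℂ) → ℂ, IsCorrelationFunction F t 0 2 G ∧
      ∀ y ∈ genericPoints 2, multidifferential t 0 2 G y = (curve t).omega 0 2 y := by
  -- As a bidifferential this is `dy₁ dy₂ / (y₁ + y₂)²`, the amount by which `dy₁ dy₂ / (y₁ - y₂)²`
  -- exceeds `dx₁ dx₂ / (x₁ - x₂)²`.
  refine ⟨fun y => ((1 - 16 * y 0 ^ 2) * (1 - 16 * y 1 ^ 2)) ^ 2 /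
    (128 ^ 2 * t ^ 2 * (y 0 * y 1) * (y 0 + y 1) ^ 2),
    ⟨?_, 16 * ‖t‖, by simpa using ht, fun y hy => ?_⟩, fun y hy => ?_⟩
  · refine (isRat_div (((1 - MvPolynomial.C 16 * MvPolynomial.X 0 ^ 2) *
      (1 - MvPolynomial.C 16 * MvPolynomial.X 1 ^ 2)) ^ 2) (MvPolynomial.C (128 ^ 2 * t ^ 2) *
      (MvPolynomial.X 0 * MvPolynomial.X 1) * (MvPolynomial.X 0 + MvPolynomial.X 1) ^ 2)
      fun y hy => ?_).congr fun y _ => ?_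
    · have h1 : y 0 + y 1 ≠ 0 := fun h => hy.2 0 1 (by decide) (by
        linear_combination (y 0 - y 1) * h)
      simp [ht, (hy.1 0).1, (hy.1 1).1, h1]
    · simp
  · have h1 := hasSum_twoPoint ht (curveSeries_sq t hΦ) (constantCoeff_curveSeries t Φ)
      (c := fun p q => genusDeriv t 0 0 (sDeriv _ p (sDeriv _ q Φ))) (mul_genusDeriv_pair t hΦ) (by rw [sDeriv_zero]; simp) (hy 0) (hy 1)
    have hinj : Function.Injective fun a : Fin 2 → ℕ+ => ((a 0 : ℕ), (a 1 : ℕ)) := fun a b hab => by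
      obtain ⟨h2, h3⟩ := Prod.ext_iff.mp hab
      funext i
      fin_cases i
      · exact PNat.coe_injective h2
      · exact PNat.coe_injective h3
    rw [← hinj.hasSum_iff] at h1
    · convert h1 using 1
      funext a
      rw [correlator_eq hF hΦ' t 0 one_le_two, Fin.prod_univ_two, Function.comp_apply,
        sDeriv_comm, ← genusDeriv_add_single, zero_add, ← genusDeriv_add_single, multiIndex,
        Fin.sum_univ_two, add_comm (Finsupp.single (a 1) 1)]
    · rintro ⟨p, q⟩ hx
      rcases Nat.eq_zero_or_pos p with rfl | hp
      · simp
      rcases Nat.eq_zero_or_pos q with rfl | hq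
      · simp
      exact absurd ⟨![⟨p, hp⟩, ⟨q, hq⟩], rfl⟩ hx
  · have h0 := hy.1 0
    have h1 := hy.1 1
    have hm : y 0 - y 1 ≠ 0 := fun h => hy.2 0 1 (by decide) (by
      linear_combination (y 0 + y 1) * h)
    have hp : y 0 + y 1 ≠ 0 := fun h => hy.2 0 1 (by decide) (by
      linear_combination (y 0 - y 1) * h)
    have hA : 1 - 16 * y 0 ^ 2 ≠ 0 := sub_ne_zero.mpr h0.2.symm
    have hB : 1 - 16 * y 1 ^ 2 ≠ 0 := sub_ne_zero.mpr h1.2.symm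
    rw [multidifferential, Fin.prod_univ_two, omega_zero_two t rfl, deriv_curve_x h0.2,
      deriv_curve_x h1.2]
    change (1 / ((curve t).x (y 0) - (curve t).x (y 1)) ^ 2 + _) * _ = 1 / (y 0 - y 1) ^ 2
    have hx : (curve t).x (y 0) - (curve t).x (y 1) = 64 * t * ((y 0 - y 1) * (y 0 + y 1)) /
        ((1 - 16 * y 0 ^ 2) * (1 - 16 * y 1 ^ 2)) := by
      change 4 * t / (1 - 16 * y 0 ^ 2) - 4 * t / (1 - 16 * y 1 ^ 2) = _
      rw [div_sub_div _ _ hA hB]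
      congr 1
      ring
    rw [hx]
    beta_reduce
    have hy0 := h0.1
    have hy1 := h1.1
    generalize 1 - 16 * y 0 ^ 2 = A at *
    generalize 1 - 16 * y 1 ^ 2 = B at *
    have h2 : 1 / (64 * t * ((y 0 - y 1) * (y 0 + y 1)) / (A * B)) ^ 2 +
        (A * B) ^ 2 / (128 ^ 2 * t ^ 2 * (y 0 * y 1) * (y 0 + y 1) ^ 2) =
        (A * B) ^ 2 / (128 ^ 2 * t ^ 2 * (y 0 * y 1) * (y 0 - y 1) ^ 2) := by
      field_simp
      ring
    rw [h2]
    field_simp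

theorem exists_correlationFunction (g : ℕ) {n : ℕ} (hn : 1 ≤ n) :
    ∃ G : (Fin n → ℂ) → ℂ, IsCorrelationFunction F t g n G ∧
      ∀ y ∈ genericPoints n, multidifferential t g n G y = (curve t).omega g n y := by
  rcases Nat.lt_or_ge (2 * g + n) 3 with h | h
  · have h1 : (g = 0 ∧ n = 1) ∨ (g = 0 ∧ n = 2) := by omega
    rcases h1 with ⟨rfl, rfl⟩ | ⟨rfl, rfl⟩
    · exact exists_correlationFunction_zero_one hF hΦ hΦ' ht
    · exact exists_correlationFunction_zero_two hF hΦ hΦ' ht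
  · exact exists_correlationFunction_of_stable hF hΦ hΦ' ht h hn

end CorrelationFunctions

end ModifiedGUE
end

theorem theorem4p1 :
    (∃ F : ℕ → MvPowerSeries ℕ+ (Polynomial ℂ), IsModifiedFreeEnergy F) ∧
    ∀ F : ℕ → MvPowerSeries ℕ+ (Polynomial ℂ), IsModifiedFreeEnergy F →
      ∀ t : ℂ, t ≠ 0 → ∀ g n : ℕ, 1 ≤ n →
        ∃ G : (Fin n → ℂ) → ℂ, IsCorrelationFunction F t g n G ∧
          ∀ y ∈ genericPoints n, multidifferential t g n G y = (curve t).omega g n y := by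
  obtain ⟨Φ, hΦ, hΦ'⟩ := exists_universal
  exact ⟨⟨_, isModifiedFreeEnergy_universal hΦ'⟩, fun F hF t ht g n hn =>
    exists_correlationFunction hF hΦ hΦ' ht g hn⟩
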